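/- Let $n\ge 1$, let $k,l\ge 1$ be integers and let $A_{k,l}=(-\Delta)^l+|x|^{2k}+1$ on $\mathbb{R}^n$. Let $(u_j)_{j\in\mathbb{N}}$ be an orthonormal basis of $L^2(\mathbb{R}^n)$ consisting of eigenfunctions of $A_{k,l}$, $A_{k,l}u_j=\lambda_ju_j$. For a function $F:\mathbb{R}\to\mathbb{C}$ let $F(A_{k,l})f=\sum_j F(\lambda_j)\langle f,u_j\rangle_{L^2}\,u_j$ on the domain $\{f\in L^2(\mathbb{R}^n):\sum_j|F(\lambda_j)|^2|\langle f,u_j\rangle_{L^2}|^2<\infty\}$. Fix a window $0\ne g\in\mathcal{S}(\mathbb{R}^n)$ and put $V_gf(x,\xi)=\int f(y)\overline{g(y-x)}e^{-iy\cdot\xi}\,dy$ for $f\in\mathcal{S}'(\mathbb{R}^n)$ (distributional pairing). For a weight $w$, that is, a positive locally integrable function on $\mathbb{R}^{2n}$, and $1\le p,q\le\infty$ let $$\|f\|_{\mathcal{M}^{p,q}_w}=\Big(\int_{\mathbb{R}^n}\Big(\int_{\mathbb{R}^n}|V_gf(x,\xi)|^p\,w(x,\xi)^p\,dx\Big)^{q/p}d\xi\Big)^{1/q}$$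 (with essential suprema for infinite exponents), and let $\mathcal{M}^{p,q}_w$ be the space of all $f\in\mathcal{S}'(\mathbb{R}^n)$ for which this is finite. The weight $w$ is submultiplicative if $w(z_1+z_2)\le C\,w(z_1)w(z_2)$, and polynomially moderate if $w(z_1+z_2)\le C\,(1+|z_1|^2)^{s/2}\,w(z_2)$, for all $z_1,z_2\in\mathbb{R}^{2n}$ and some constants $C$, $s$. A bounded operator $T$ on a Banach space $\mathcal{B}$ is $r$-nuclear if $T=\sum_{j}\varphi_j\otimes\psi_j$ (that is, $Tf=\sum_j\psi_j(f)\varphi_j$ for all $f\in\mathcal{B}$) with $\varphi_j\in\mathcal{B}$, $\psi_j\in\mathcal{B}'$ and $\sum_j\|\psi_j\|^r\|\varphi_j\|^r<\infty$, and nuclear if it is $1$-nuclear. A nuclear operator $T$ has the trace $\operatorname{Tr}T=t$ if $\sum_j\psi_j(\varphi_j)=t$ for every such representation of $T$ with $r=1$. **Theorem.** Let $0<r\le1$, $1\le p,q<\infty$, $\frac1p+\frac1{p'}=\frac1q+\frac1{q'}=1$, and let $w$ be a submultiplicative polynomially moderate weight. Suppose that $$\sum_{j}|F(\lambda_j)|^r\,\|u_j\|^r_{\mathcal{M}^{p,q}_w}\,\|u_j\|^r_{\mathcal{M}^{p',q'}_{1/w}}<\infty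 .$$ Then $F(A_{k,l})$ is $r$-nuclear on $\mathcal{M}^{p,q}_w$: its domain intersected with $\mathcal{M}^{p,q}_w$ is dense in $\mathcal{M}^{p,q}_w$, and there $F(A_{k,l})$ agrees with a bounded operator on $\mathcal{M}^{p,q}_w$ that is $r$-nuclear. If the assumption holds with $r=1$, then the series $\sum_jF(\lambda_j)$ converges absolutely, and (the extension to $\mathcal{M}^{p,q}_w$ of) $F(A_{k,l})$ has the trace $$\operatorname{Tr}F(A_{k,l})=\sum_jF(\lambda_j).$$ -/

import Mathlib

open MeasureTheory SchwartzMap Laplacian Filter Topology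
open scoped ENNReal InnerProductSpace

/-! ### Nuclear operators and their trace -/

section Nuclear

variable {B : Type*} [SeminormedAddCommGroup B] [NormedSpace ℂ B]

/-- `T = ∑ⱼ φⱼ ⊗ ψⱼ` with `φⱼ ∈ B`, `ψⱼ ∈ B'` (the topological dual) and
`∑ⱼ ‖ψⱼ‖ʳ ‖φⱼ‖ʳ < ∞`. -/
structure IsNuclearRepresentation (r : ℝ) (T : B →L[ℂ] B) (φ : ℕ → B) (ψ : ℕ → (B →L[ℂ] ℂ)) :
    Prop where
  summable : Summable fun j => ‖ψ j‖ ^ r * ‖φ j‖ ^ r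
  hasSum : ∀ f : B, HasSum (fun j => ψ j f • φ j) (T f)

/-- `T` is `r`-nuclear (nuclear, if `r = 1`). -/
def IsRNuclear (r : ℝ) (T : B →L[ℂ] B) : Prop :=
  ∃ (φ : ℕ → B) (ψ : ℕ → (B →L[ℂ] ℂ)), IsNuclearRepresentation r T φ ψ

/-- `T` is nuclear and `t` is its (well-defined) nuclear trace: `∑ⱼ ψⱼ(φⱼ) = t` for every
representation `T = ∑ⱼ φⱼ ⊗ ψⱼ` with `∑ⱼ ‖ψⱼ‖ ‖φⱼ‖ < ∞`. -/
def HasNuclearTrace (T : B →L[ℂ] B) (t : ℂ) : Prop :=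
  IsRNuclear 1 T ∧
    ∀ (φ : ℕ → B) (ψ : ℕ → (B →L[ℂ] ℂ)), IsNuclearRepresentation 1 T φ ψ →
      HasSum (fun j => ψ j (φ j)) t

end Nuclear

/-! ### Weights on `ℝⁿ × ℝⁿ` -/

section Weights

variable {n : ℕ}

/-- A weight on the phase space: a positive, locally integrable function. -/
structure IsWeight (w : EuclideanSpace ℝ (Fin n) × EuclideanSpace ℝ (Fin n) → ℝ) : Prop where
  pos : ∀ z, 0 < w z
  locallyIntegrable : LocallyIntegrable w volume

/-- Submultiplicativity (up to a multiplicative constant). -/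
def IsSubmultiplicativeWeight (w : EuclideanSpace ℝ (Fin n) × EuclideanSpace ℝ (Fin n) → ℝ) :
    Prop :=
  ∃ C : ℝ, ∀ z₁ z₂, w (z₁ + z₂) ≤ C * (w z₁ * w z₂)

/-- The polynomial weight `v_s(x, ξ) = (1 + |x|² + |ξ|²)^(s/2)`, with Euclidean norms. -/
noncomputable def polyWeight (s : ℝ)
    (z : EuclideanSpace ℝ (Fin n) × EuclideanSpace ℝ (Fin n)) : ℝ :=
  (1 + ‖z.1‖ ^ 2 + ‖z.2‖ ^ 2) ^ (s / 2)

/-- `w` is `v_s`-moderate for some `s`. -/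
def IsPolynomiallyModerate (w : EuclideanSpace ℝ (Fin n) × EuclideanSpace ℝ (Fin n) → ℝ) : Prop :=
  ∃ s C : ℝ, ∀ z₁ z₂, w (z₁ + z₂) ≤ C * (polyWeight s z₁ * w z₂)

end Weights

/-! ### Mixed Lebesgue norms -/

section Mixed

variable {n : ℕ}

/-- The mixed norm `‖F‖_{L^{p,q}} = (∫ (∫ |F(x,ξ)|^p dx)^{q/p} dξ)^{1/q}`, with the usual
essential suprema when an exponent is `∞`. -/
noncomputable def mixedENorm (p q : ℝ≥0∞)
    (F : EuclideanSpace ℝ (Fin n) × EuclideanSpace ℝ (Fin n) → ℂ) : ℝ≥0∞ :=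
  eLpNorm (fun ξ => eLpNorm (fun x => F (x, ξ)) p volume) q volume

theorem mixedENorm_add_le {p q : ℝ≥0∞} (hp : 1 ≤ p) (hp' : p ≠ ∞) (hq : 1 ≤ q)
    {F G : EuclideanSpace ℝ (Fin n) × EuclideanSpace ℝ (Fin n) → ℂ}
    (hF : AEStronglyMeasurable F volume) (hG : AEStronglyMeasurable G volume) :
    mixedENorm p q (fun z => F z + G z) ≤ mixedENorm p q F + mixedENorm p q G := by
  have key : ∀ {H : EuclideanSpace ℝ (Fin n) × EuclideanSpace ℝ (Fin n) → ℂ},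
      AEStronglyMeasurable H volume →
      AEStronglyMeasurable (fun ξ => eLpNorm (fun x => H (x, ξ)) p volume) volume := by
    intro H hH
    have h0 : p ≠ 0 := (zero_lt_one.trans_le hp).ne'
    simp only [eLpNorm_eq_lintegral_rpow_enorm_toReal h0 hp']
    have h1 : AEMeasurable (fun z => ‖H z‖ₑ ^ p.toReal)
        ((volume : Measure (EuclideanSpace ℝ (Fin n))).prod volume) := by
      exact (hH.enorm.pow_const _)
    exact (h1.lintegral_prod_left'.pow_const _).aestronglyMeasurable
  have hFs : ∀ᵐ ξ ∂(volume : Measure (EuclideanSpace ℝ (Fin n))),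
      AEStronglyMeasurable (fun x => F (x, ξ)) volume :=
    AEStronglyMeasurable.prodMk_right (f := F) hF
  have hGs : ∀ᵐ ξ ∂(volume : Measure (EuclideanSpace ℝ (Fin n))),
      AEStronglyMeasurable (fun x => G (x, ξ)) volume :=
    AEStronglyMeasurable.prodMk_right (f := G) hG
  refine le_trans (eLpNorm_mono_enorm_ae (g := (fun ξ => eLpNorm (fun x => F (x, ξ)) p volume) +
    (fun ξ => eLpNorm (fun x => G (x, ξ)) p volume)) ?_) (eLpNorm_add_le (key hF) (key hG) hq)
  filter_upwards [hFs, hGs] with ξ h1 h2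
  exact eLpNorm_add_le h1 h2 hp

theorem mixedENorm_const_mul_le (p q : ℝ≥0∞) (c : ℂ)
    (F : EuclideanSpace ℝ (Fin n) × EuclideanSpace ℝ (Fin n) → ℂ) :
    mixedENorm p q (fun z => c * F z) ≤ ‖c‖ₑ * mixedENorm p q F := by
  refine eLpNorm_le_nnreal_smul_eLpNorm_of_ae_le_mul' (c := ‖c‖₊) (Eventually.of_forall fun ξ => ?_) q
  exact eLpNorm_const_smul_le (c := c) (f := fun x => F (x, ξ))

end Mixed

/-! ### The short-time Fourier transform and modulation spaces -/

section Modulation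

variable {n : ℕ}

theorem hasTemperateGrowth_cexp_inner (ξ : EuclideanSpace ℝ (Fin n)) :
    (fun y : EuclideanSpace ℝ (Fin n) =>
      Complex.exp (-(Complex.I * ((⟪y, ξ⟫_ℝ : ℝ) : ℂ)))).HasTemperateGrowth := by
  have h : (fun t : ℝ => Complex.exp (-(Complex.I * (t : ℂ)))).HasTemperateGrowth := by
    have hd : ∀ m : ℕ, iteratedDeriv m (fun t : ℝ => Complex.exp (-(Complex.I * (t : ℂ))))
        = fun t : ℝ => (-Complex.I) ^ m * Complex.exp (-(Complex.I * (t : ℂ))) := by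
      intro m
      induction m with
      | zero => simp
      | succ m ih =>
        rw [iteratedDeriv_succ, ih]
        funext t
        have h1 : HasDerivAt (fun t : ℝ => -(Complex.I * (t : ℂ))) (-(Complex.I * 1)) t :=
          ((Complex.ofRealCLM.hasDerivAt (x := t)).const_mul Complex.I).neg
        have h2 := (h1.cexp.const_mul ((-Complex.I) ^ m)).deriv
        rw [h2]
        ring
    refine ⟨(contDiff_const.mul Complex.ofRealCLM.contDiff).neg.cexp, fun m => ⟨0, 1, fun t => ?_⟩⟩
    rw [norm_iteratedFDeriv_eq_norm_iteratedDeriv, hd]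
    have : -(Complex.I * (t : ℂ)) = ((-t : ℝ) : ℂ) * Complex.I := by push_cast; ring
    simp [this, Complex.norm_exp_ofReal_mul_I, -Complex.ofReal_neg]
  exact h.comp (Function.hasTemperateGrowth_inner_left ξ)

/-- The test function `y ↦ conj (g (y - x)) * exp (-i y·ξ)` for `z = (x, ξ)`. -/
noncomputable def conjTimeFrequencyShift (g : 𝓢(EuclideanSpace ℝ (Fin n), ℂ))
    (z : EuclideanSpace ℝ (Fin n) × EuclideanSpace ℝ (Fin n)) :
    𝓢(EuclideanSpace ℝ (Fin n), ℂ) :=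
  smulLeftCLM ℂ (fun y => Complex.exp (-(Complex.I * ((⟪y, z.2⟫_ℝ : ℝ) : ℂ))))
    (compSubConstCLM ℂ z.1
      (postcompCLM (𝕜 := ℝ) (Complex.conjCLE : ℂ →L[ℝ] ℂ) g))

theorem conjTimeFrequencyShift_apply (g : 𝓢(EuclideanSpace ℝ (Fin n), ℂ))
    (z : EuclideanSpace ℝ (Fin n) × EuclideanSpace ℝ (Fin n)) (y : EuclideanSpace ℝ (Fin n)) :
    conjTimeFrequencyShift g z y =
      Complex.exp (-(Complex.I * ((⟪y, z.2⟫_ℝ : ℝ) : ℂ))) *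
        (starRingEnd ℂ) (g (y - z.1)) := by
  rw [conjTimeFrequencyShift, smulLeftCLM_apply_apply (hasTemperateGrowth_cexp_inner z.2)]
  rfl

/-- The short-time Fourier transform `V_g f (x, ξ) = ∫ f(y) conj (g (y - x)) exp (-i y·ξ) dy` of a
tempered distribution `f` with respect to the window `g`, the integral being the distributional
pairing. -/
noncomputable def stft (g : 𝓢(EuclideanSpace ℝ (Fin n), ℂ)) (f : 𝓢'(EuclideanSpace ℝ (Fin n), ℂ))
    (z : EuclideanSpace ℝ (Fin n) × EuclideanSpace ℝ (Fin n)) : ℂ :=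
  f (conjTimeFrequencyShift g z)

/-- The modulation norm `‖f‖_{M_w^{p,q}} = ‖w · V_g f‖_{L^{p,q}} ∈ [0, ∞]` of a tempered
distribution. -/
noncomputable def modulationENorm (g : 𝓢(EuclideanSpace ℝ (Fin n), ℂ))
    (w : EuclideanSpace ℝ (Fin n) × EuclideanSpace ℝ (Fin n) → ℝ) (p q : ℝ≥0∞)
    (f : 𝓢'(EuclideanSpace ℝ (Fin n), ℂ)) : ℝ≥0∞ :=
  mixedENorm p q (fun z => (w z : ℂ) * stft g f z)

/-- The tempered distributions `f` with `w · V_g f ∈ L^{p,q}`, as a subspace of `𝓢'`. Since `V_g f`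
is continuous, the measurability requirement only concerns the weight and holds whenever `w` is
measurable. -/
noncomputable def modulationSubmodule (g : 𝓢(EuclideanSpace ℝ (Fin n), ℂ))
    (w : EuclideanSpace ℝ (Fin n) × EuclideanSpace ℝ (Fin n) → ℝ) (p q : ℝ≥0∞)
    [hp : Fact (1 ≤ p)] [hp' : Fact (p ≠ ∞)] [hq : Fact (1 ≤ q)] :
    Submodule ℂ (𝓢'(EuclideanSpace ℝ (Fin n), ℂ)) where
  carrier := {f | AEStronglyMeasurable (fun z => (w z : ℂ) * stft g f z) volume ∧
    modulationENorm g w p q f < ∞}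
  zero_mem' := by
    have h : ∀ z, stft g 0 z = 0 := fun z => rfl
    constructor
    · simpa [h] using aestronglyMeasurable_const
    · simp [modulationENorm, mixedENorm, h]
  add_mem' := by
    rintro f₁ f₂ ⟨h₁, k₁⟩ ⟨h₂, k₂⟩
    have h : (fun z => (w z : ℂ) * stft g (f₁ + f₂) z)
        = fun z => (w z : ℂ) * stft g f₁ z + (w z : ℂ) * stft g f₂ z := by
      funext z
      exact mul_add _ _ _
    refine ⟨by rw [h]; exact h₁.add h₂, ?_⟩
    rw [modulationENorm, h]
    exact (mixedENorm_add_le hp.out hp'.out hq.out h₁ h₂).trans_lt (ENNReal.add_lt_top.2 ⟨k₁, k₂⟩)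
  smul_mem' := by
    rintro c f ⟨h₁, k₁⟩
    have h : (fun z => (w z : ℂ) * stft g (c • f) z)
        = fun z => c * ((w z : ℂ) * stft g f z) := by
      funext z
      exact mul_left_comm _ _ _
    refine ⟨by rw [h]; exact h₁.const_mul c, ?_⟩
    rw [modulationENorm, h]
    exact (mixedENorm_const_mul_le p q c _).trans_lt (ENNReal.mul_lt_top enorm_lt_top k₁)

/-- The modulation space `M_w^{p,q}(ℝⁿ)`, `1 ≤ p, q < ∞`, with window `g`. It is a type synonym of
`modulationSubmodule`, carrying the modulation norm instead of the topology of `𝓢'`. -/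
def ModulationSpace (g : 𝓢(EuclideanSpace ℝ (Fin n), ℂ))
    (w : EuclideanSpace ℝ (Fin n) × EuclideanSpace ℝ (Fin n) → ℝ) (p q : ℝ≥0∞)
    [Fact (1 ≤ p)] [Fact (p ≠ ∞)] [Fact (1 ≤ q)] [Fact (q ≠ ∞)] : Type :=
  ↥(modulationSubmodule g w p q)

namespace ModulationSpace

variable {g : 𝓢(EuclideanSpace ℝ (Fin n), ℂ)}
  {w : EuclideanSpace ℝ (Fin n) × EuclideanSpace ℝ (Fin n) → ℝ} {p q : ℝ≥0∞}
  [hp : Fact (1 ≤ p)] [hp' : Fact (p ≠ ∞)] [hq : Fact (1 ≤ q)] [hq' : Fact (q ≠ ∞)]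

noncomputable instance instAddCommGroup : AddCommGroup (ModulationSpace g w p q) :=
  inferInstanceAs (AddCommGroup ↥(modulationSubmodule g w p q))

noncomputable instance instModule : Module ℂ (ModulationSpace g w p q) :=
  inferInstanceAs (Module ℂ ↥(modulationSubmodule g w p q))

/-- The inclusion `M_w^{p,q} ⊆ 𝓢'`. -/
noncomputable def toDistribution : ModulationSpace g w p q →ₗ[ℂ] 𝓢'(EuclideanSpace ℝ (Fin n), ℂ) :=
  (modulationSubmodule g w p q).subtype

theorem modulationENorm_lt_top (f : ModulationSpace g w p q) :
    modulationENorm g w p q (toDistribution f) < ∞ := f.2.2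

theorem modulationENorm_smul_le (c : ℂ) (f : ModulationSpace g w p q) :
    modulationENorm g w p q (toDistribution (c • f))
      ≤ ‖c‖ₑ * modulationENorm g w p q (toDistribution f) := by
  have h : (fun z => (w z : ℂ) * stft g (toDistribution (c • f)) z)
      = fun z => c * ((w z : ℂ) * stft g (toDistribution f) z) := by
    funext z
    exact mul_left_comm _ _ _
  rw [modulationENorm, h]
  exact mixedENorm_const_mul_le p q c _

theorem modulationENorm_add_le (f₁ f₂ : ModulationSpace g w p q) :
    modulationENorm g w p q (toDistribution (f₁ + f₂))
      ≤ modulationENorm g w p q (toDistribution f₁)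
        + modulationENorm g w p q (toDistribution f₂) := by
  have h : (fun z => (w z : ℂ) * stft g (toDistribution (f₁ + f₂)) z)
      = fun z => (w z : ℂ) * stft g (toDistribution f₁) z
        + (w z : ℂ) * stft g (toDistribution f₂) z := by
    funext z
    exact mul_add _ _ _
  rw [modulationENorm, h]
  exact mixedENorm_add_le hp.out hp'.out hq.out f₁.2.1 f₂.2.1

/-- The modulation norm on the modulation space. -/
noncomputable def addGroupSeminorm : AddGroupSeminorm (ModulationSpace g w p q) where
  toFun f := (modulationENorm g w p q (toDistribution f)).toReal
  map_zero' := by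
    have h := modulationENorm_smul_le (0 : ℂ) (0 : ModulationSpace g w p q)
    rw [zero_smul, enorm_zero, zero_mul] at h
    rw [nonpos_iff_eq_zero.1 h, ENNReal.toReal_zero]
  add_le' f₁ f₂ := by
    rw [← ENNReal.toReal_add (modulationENorm_lt_top f₁).ne (modulationENorm_lt_top f₂).ne]
    exact ENNReal.toReal_mono
      (ENNReal.add_lt_top.2 ⟨modulationENorm_lt_top f₁, modulationENorm_lt_top f₂⟩).ne
      (modulationENorm_add_le f₁ f₂)
  neg' f := by
    have h₁ : modulationENorm g w p q (toDistribution (-f))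
        ≤ modulationENorm g w p q (toDistribution f) := by
      simpa using modulationENorm_smul_le (-1 : ℂ) f
    have h₂ : modulationENorm g w p q (toDistribution f)
        ≤ modulationENorm g w p q (toDistribution (-f)) := by
      simpa using modulationENorm_smul_le (-1 : ℂ) (-f)
    rw [le_antisymm h₁ h₂]

/-- The modulation norm. (For a nonzero window and a positive weight it is definite.) -/
noncomputable instance instSeminormedAddCommGroup :
    SeminormedAddCommGroup (ModulationSpace g w p q) :=
  { addGroupSeminorm.toSeminormedAddGroup, instAddCommGroup with }

theorem norm_def (f : ModulationSpace g w p q) :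
    ‖f‖ = (modulationENorm g w p q (toDistribution f)).toReal := rfl

noncomputable instance instNormedSpace : NormedSpace ℂ (ModulationSpace g w p q) where
  norm_smul_le c f := by
    have h := ENNReal.toReal_mono
      (ENNReal.mul_lt_top enorm_lt_top (modulationENorm_lt_top f)).ne (modulationENorm_smul_le c f)
    rw [ENNReal.toReal_mul, toReal_enorm] at h
    exact h

end ModulationSpace

end Modulation

/-! ### The anharmonic oscillator and its functional calculus -/

section Anharmonic

variable {n : ℕ}

/-- The anharmonic oscillator `A_{k,l} = (-Δ)^l + |x|^{2k} + 1`, acting on tempered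
distributions. -/
noncomputable def anharmonicOscillator (k l : ℕ) (f : 𝓢'(EuclideanSpace ℝ (Fin n), ℂ)) :
    𝓢'(EuclideanSpace ℝ (Fin n), ℂ) :=
  (fun v : 𝓢'(EuclideanSpace ℝ (Fin n), ℂ) => -(Δ v))^[l] f
    + TemperedDistribution.smulLeftCLM ℂ
        (fun x : EuclideanSpace ℝ (Fin n) => ((‖x‖ ^ (2 * k) : ℝ) : ℂ)) f
    + f

/-- `(uⱼ)` is an orthonormal basis of `L²(ℝⁿ)` consisting of eigenfunctions of `A_{k,l}`, with
`A_{k,l} uⱼ = λⱼ uⱼ`. (The self-adjoint realization of `A_{k,l}` in `L²` has the domain of all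
`f ∈ L²` for which the distribution `A_{k,l} f` is in `L²`, so its eigenfunctions are the `f ∈ L²`
that satisfy the eigenvalue equation in `𝓢'`.) -/
def IsAnharmonicEigenbasis (k l : ℕ)
    (u : HilbertBasis ℕ ℂ (Lp ℂ 2 (volume : Measure (EuclideanSpace ℝ (Fin n)))))
    (lam : ℕ → ℝ) : Prop :=
  ∀ j, anharmonicOscillator k l (Lp.toTemperedDistribution (u j))
    = (lam j : ℂ) • Lp.toTemperedDistribution (u j)

/-- The maximal domain `{f | ∑ⱼ |mⱼ|² |⟨uⱼ, f⟩|² < ∞}` of the operator `f ↦ ∑ⱼ mⱼ ⟨uⱼ, f⟩ uⱼ`. -/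
noncomputable def spectralDomain {H : Type*} [NormedAddCommGroup H] [InnerProductSpace ℂ H]
    (u : HilbertBasis ℕ ℂ H) (m : ℕ → ℂ) : Submodule ℂ H where
  carrier := {f | Memℓp (fun j => m j * u.repr f j) 2}
  zero_mem' := by
    have h : (fun j => m j * u.repr 0 j) = 0 := by funext j; simp
    change Memℓp (fun j => m j * u.repr 0 j) 2
    rw [h]
    exact zero_memℓp
  add_mem' := by
    intro f₁ f₂ h₁ h₂
    have h : (fun j => m j * u.repr (f₁ + f₂) j)
        = (fun j => m j * u.repr f₁ j) + fun j => m j * u.repr f₂ j := by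
      funext j; simp [mul_add]
    change Memℓp (fun j => m j * u.repr (f₁ + f₂) j) 2
    rw [h]
    exact Memℓp.add h₁ h₂
  smul_mem' := by
    intro c f h₁
    have h : (fun j => m j * u.repr (c • f) j) = c • fun j => m j * u.repr f j := by
      funext j; simp [mul_left_comm]
    change Memℓp (fun j => m j * u.repr (c • f) j) 2
    rw [h]
    exact Memℓp.const_smul h₁ c

/-- The sequence of coefficients `mⱼ ⟨uⱼ, f⟩`, as an element of `ℓ²`. -/
noncomputable def spectralCoeff {H : Type*} [NormedAddCommGroup H] [InnerProductSpace ℂ H]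
    (u : HilbertBasis ℕ ℂ H) (m : ℕ → ℂ) : spectralDomain u m →ₗ[ℂ] lp (fun _ : ℕ => ℂ) 2 where
  toFun f := ⟨fun j => m j * u.repr f.1 j, f.2⟩
  map_add' f₁ f₂ := by
    ext j
    change m j * u.repr (f₁.1 + f₂.1) j = m j * u.repr f₁.1 j + m j * u.repr f₂.1 j
    simp [mul_add]
  map_smul' c f := by
    ext j
    change m j * u.repr (c • f.1) j = c * (m j * u.repr f.1 j)
    simp [mul_left_comm]

/-- The operator `f ↦ ∑ⱼ mⱼ ⟨uⱼ, f⟩ uⱼ` in a Hilbert space with orthonormal basis `(uⱼ)`, on its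
maximal domain. If `A uⱼ = λⱼ uⱼ` for all `j` and `mⱼ = F(λⱼ)`, then this is the operator `F(A)` of
the functional calculus. -/
noncomputable def spectralMultiplier {H : Type*} [NormedAddCommGroup H] [InnerProductSpace ℂ H]
    (u : HilbertBasis ℕ ℂ H) (m : ℕ → ℂ) : H →ₗ.[ℂ] H where
  domain := spectralDomain u m
  toFun := u.repr.symm.toLinearEquiv.toLinearMap ∘ₗ spectralCoeff u m

/-- The bounded operator `T` on `M_w^{p,q}` is the operator `S`, given in `L²`: the elements of the
domain of `S` that lie in `M_w^{p,q}` are dense in `M_w^{p,q}`, and there `T` agrees with `S`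
(all functions being identified with tempered distributions). -/
structure IsRealization {g : 𝓢(EuclideanSpace ℝ (Fin n), ℂ)}
    {w : EuclideanSpace ℝ (Fin n) × EuclideanSpace ℝ (Fin n) → ℝ} {p q : ℝ≥0∞}
    [Fact (1 ≤ p)] [Fact (p ≠ ∞)] [Fact (1 ≤ q)] [Fact (q ≠ ∞)]
    (S : Lp ℂ 2 (volume : Measure (EuclideanSpace ℝ (Fin n))) →ₗ.[ℂ]
      Lp ℂ 2 (volume : Measure (EuclideanSpace ℝ (Fin n))))
    (T : ModulationSpace g w p q →L[ℂ] ModulationSpace g w p q) : Prop where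
  dense : Dense {a : ModulationSpace g w p q | ∃ f : S.domain,
    ModulationSpace.toDistribution a = Lp.toTemperedDistribution f.1}
  agrees : ∀ (a : ModulationSpace g w p q) (f : S.domain),
    ModulationSpace.toDistribution a = Lp.toTemperedDistribution f.1 →
      ModulationSpace.toDistribution (T a) = Lp.toTemperedDistribution (S f)

end Anharmonic

/-! ### Mixed Lebesgue norms of nonnegative functions -/

section Minkowski

variable {X Y T : Type*} [MeasurableSpace X] [MeasurableSpace Y] [MeasurableSpace T]
  {μ : Measure X} {ν : Measure T}

/-! Write $\kappa=(2\pi)^n\|g\|_2^2$ and let $\pi(z)g$ be the time-frequency shift of the window by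
$z=(x,\xi)$. The operator is $\sum_j F(\lambda_j)\,\langle\cdot,u_j\rangle u_j$, and the proof reads
this series as a nuclear representation on $M=\mathcal M^{p,q}_w$.

The rank one terms. By the orthogonality relation $\int V_gf\,\overline{V_gh}=\kappa\langle
f,h\rangle$ (`integral_stft_mul_conj_stft`) and Hölder's inequality with $w\cdot w^{-1}=1$, the
pairing with $u_j$ extends to a functional on $M$ of norm at most $\kappa^{-1}\|u_j\|_{\mathcal
M^{p',q'}_{1/w}}$ (`exists_functional_extending_inner`). The hypothesis is then exactly the
$r$-summability of the terms. As $r\le1$, the terms are also absolutely summable; since the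
functional of the $j$-th term takes the value $F(\lambda_j)$ on its vector,
$\sum_j|F(\lambda_j)|<\infty$. In particular the multiplier is bounded and its domain is all of
$L^2$, so that its density reduces to that of $L^2\cap M$ in $M$. The operator sum exists because
$M$ is complete, and it agrees with the $L^2$ operator when tested against Schwartz functions.

The trace. It must not depend on the representation, which is the approximation property in
disguise. It is obtained here from a formula for $\psi(a)$ valid for every functional $\psi$ on $M$:
$\int V_ga(z)\,\psi(\pi(z)g)\,dz=\kappa\,\psi(a)$, with absolute convergence bounded by a constant
times $\|\psi\|\|a\|$ (`exists_lintegral_stft_mul_le`). Inserting $T=\sum\varphi_j\otimes\psi_j$ and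
interchanging sum and integral gives $\sum_j\psi_j(\varphi_j)=\kappa^{-1}\int V_g(T\pi(z)g)(z)\,dz$,
whose right side knows only $T$. The same formula yields the density of $L^2\cap M$, since a
functional that vanishes on all $\pi(z)g$ is zero.

The analytic base. The kernel formed by the pairings of two time-frequency shifts decays faster than
any polynomial in $z-z'$. With moderateness of $w$ and Young's inequality, the synthesis
$F\mapsto\int F(z)\pi(z)g\,dz$ is bounded from $\{F: wF\in L^{p,q}\}$ to $M$ (`exists_synthesis`).
The reproducing formula $\int V_gf\cdot\langle\varphi,\pi(z)g\rangle\,dz=\kappa f(\varphi)$, with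
the bilinear pairing, is needed for all tempered $f$. It is deduced from Fourier inversion on
Schwartz functions after $f$ has been represented by an $L^2$ function on phase space
(`exists_memLp_two_eq_integral_gaborPairing`). -/

theorem eLpNorm_ennreal_eq {p : ℝ≥0∞} (hp : 1 ≤ p) (hp' : p ≠ ∞) (f : X → ℝ≥0∞) :
    eLpNorm f p μ = (∫⁻ x, f x ^ p.toReal ∂μ) ^ (1 / p.toReal) := by
  rw [eLpNorm_eq_lintegral_rpow_enorm_toReal (zero_lt_one.trans_le hp).ne' hp']
  simp

theorem eLpNorm_ennreal_const_mul {p : ℝ≥0∞} (hp : 1 ≤ p) (hp' : p ≠ ∞) {c : ℝ≥0∞} (hc : c ≠ ∞)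
    (f : X → ℝ≥0∞) : eLpNorm (fun x => c * f x) p μ = c * eLpNorm f p μ := by
  have hp0 : 0 < p.toReal := ENNReal.toReal_pos (zero_lt_one.trans_le hp).ne' hp'
  rw [eLpNorm_ennreal_eq hp hp', eLpNorm_ennreal_eq hp hp']
  simp_rw [ENNReal.mul_rpow_of_nonneg _ _ hp0.le]
  rw [lintegral_const_mul' _ _ (by simp [hc, hp0.le]),
    ENNReal.mul_rpow_of_nonneg _ _ (by positivity), ← ENNReal.rpow_mul,
    mul_one_div_cancel hp0.ne', ENNReal.rpow_one]

/-- **Minkowski's integral inequality**, for nonnegative functions. -/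
theorem lintegral_lintegral_rpow_le [SigmaFinite μ] [SFinite ν] {p : ℝ} (hp : 1 ≤ p)
    {G : X → T → ℝ≥0∞} (hG : Measurable (Function.uncurry G)) :
    (∫⁻ x, (∫⁻ t, G x t ∂ν) ^ p ∂μ) ^ (1 / p)
      ≤ ∫⁻ t, (∫⁻ x, G x t ^ p ∂μ) ^ (1 / p) ∂ν := by
  rcases hp.eq_or_lt with rfl | hp1
  · simpa using (lintegral_lintegral_swap hG.aemeasurable).le
  have hp0 : 0 < p := by linarith
  set H : X → ℝ≥0∞ := fun x => ∫⁻ t, G x t ∂ν with hH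
  set R := ∫⁻ t, (∫⁻ x, G x t ^ p ∂μ) ^ (1 / p) ∂ν with hR
  have hpq := Real.HolderConjugate.conjExponent hp1
  set p' := p.conjExponent with hp'
  -- The duality argument divides by $(\int h^p)^{1/p'}$, which must be finite. It is therefore run
  -- for minorants $h\le H$ with $\int h^p<\infty$ instead of for $H$ itself.
  have key : ∀ h : X → ℝ≥0∞, Measurable h → (∀ x, h x ≤ H x) → ∫⁻ x, h x ^ p ∂μ < ∞ →
      ∫⁻ x, h x ^ p ∂μ ≤ R ^ p := by
    intro h hm hle hfin
    rcases eq_or_ne (∫⁻ x, h x ^ p ∂μ) 0 with h0 | h0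
    · simp [h0]
    have h1 : ∫⁻ x, h x ^ p ∂μ ≤ (∫⁻ x, h x ^ p ∂μ) ^ (1 / p') * R := by
      calc ∫⁻ x, h x ^ p ∂μ ≤ ∫⁻ x, ∫⁻ t, h x ^ (p - 1) * G x t ∂ν ∂μ := by
            refine lintegral_mono fun x => ?_
            rw [lintegral_const_mul (h x ^ (p - 1)) (f := G x) (hG.comp measurable_prodMk_left)]
            calc h x ^ p = h x ^ (p - 1) * h x := by
                  conv_lhs => rw [show p = (p - 1) + 1 by ring]
                  rw [ENNReal.rpow_add_of_nonneg _ _ (by linarith) zero_le_one, ENNReal.rpow_one]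
              _ ≤ _ := by gcongr; exact hle x
        _ = ∫⁻ t, ∫⁻ x, h x ^ (p - 1) * G x t ∂μ ∂ν := by
            refine lintegral_lintegral_swap (Measurable.aemeasurable ?_)
            exact ((hm.comp measurable_fst).pow_const _).mul hG
        _ ≤ ∫⁻ t, (∫⁻ x, h x ^ p ∂μ) ^ (1 / p') * (∫⁻ x, G x t ^ p ∂μ) ^ (1 / p) ∂ν := by
            refine lintegral_mono fun t => ?_
            refine (ENNReal.lintegral_mul_le_Lp_mul_Lq μ hpq.symm (hm.pow_const _).aemeasurable
              (hG.comp measurable_prodMk_right).aemeasurable).trans_eq ?_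
            congr 3
            ext x
            rw [← ENNReal.rpow_mul, hpq.sub_one_mul_conj]
        _ = _ := by
            refine lintegral_const_mul _ ?_
            refine Measurable.pow_const ?_ _
            exact Measurable.lintegral_prod_left' (f := fun z : X × T => G z.1 z.2 ^ p)
              (hG.pow_const _)
    have hA0 : (∫⁻ x, h x ^ p ∂μ) ^ (1 / p') ≠ 0 := by simp [h0, hfin.ne]
    have hAt : (∫⁻ x, h x ^ p ∂μ) ^ (1 / p') ≠ ∞ :=
      ENNReal.rpow_ne_top_of_nonneg (by simpa using hpq.symm.nonneg) hfin.ne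
    have h2 : (∫⁻ x, h x ^ p ∂μ) ^ (1 / p) ≤ R := by
      rw [← ENNReal.mul_le_mul_iff_right hA0 hAt]
      refine le_trans (le_of_eq ?_) h1
      rw [← ENNReal.rpow_add _ _ h0 hfin.ne]
      have : 1 / p' + 1 / p = 1 := by
        have := hpq.inv_add_inv_eq_one
        simp only [one_div]; linarith
      rw [this, ENNReal.rpow_one]
    calc ∫⁻ x, h x ^ p ∂μ = ((∫⁻ x, h x ^ p ∂μ) ^ (1 / p)) ^ p := by
          rw [← ENNReal.rpow_mul, one_div_mul_cancel hp0.ne', ENNReal.rpow_one]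
      _ ≤ R ^ p := by gcongr
  -- If the bound failed, some simple function below $H^p$ would have a finite integral larger than
  -- $R^p$; its $p$-th root contradicts `key`.
  have hmain : ∫⁻ x, H x ^ p ∂μ ≤ R ^ p := by
    by_contra! hlt
    rw [lintegral_eq_nnreal] at hlt
    simp_rw [lt_iSup_iff] at hlt
    obtain ⟨g₀, hg₀, g₀L⟩ := hlt
    have h'L : R ^ p < ∫⁻ x, g₀ x ∂μ := by
      convert! g₀L
      rw [← SimpleFunc.lintegral_eq_lintegral, SimpleFunc.coe_map]
      simp only [Function.comp_apply]
    obtain ⟨g, hg, gL, gtop⟩ := SimpleFunc.exists_lt_lintegral_simpleFunc_of_lt_lintegral h'L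
    have heq : ∀ x, (((g x : ℝ≥0∞)) ^ (1 / p)) ^ p = g x := fun x => by
      rw [← ENNReal.rpow_mul, one_div_mul_cancel hp0.ne', ENNReal.rpow_one]
    have := key (fun x => ((g x : ℝ≥0∞)) ^ (1 / p))
      (g.measurable.coe_nnreal_ennreal.pow_const _) (fun x => ?_) (by simpa only [heq] using gL)
    · simp only [heq] at this
      exact absurd gtop this.not_gt
    · have : (g x : ℝ≥0∞) ≤ H x ^ p := le_trans (by exact_mod_cast hg x) (hg₀ x)
      calc ((g x : ℝ≥0∞)) ^ (1 / p) ≤ (H x ^ p) ^ (1 / p) := by gcongr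
        _ = H x := by rw [← ENNReal.rpow_mul, mul_one_div_cancel hp0.ne', ENNReal.rpow_one]
  calc (∫⁻ x, H x ^ p ∂μ) ^ (1 / p) ≤ (R ^ p) ^ (1 / p) := by gcongr
    _ = R := by rw [← ENNReal.rpow_mul, mul_one_div_cancel hp0.ne', ENNReal.rpow_one]

theorem eLpNorm_lintegral_le [SigmaFinite μ] [SFinite ν] {p : ℝ≥0∞} (hp : 1 ≤ p) (hp' : p ≠ ∞)
    {G : X → T → ℝ≥0∞} (hG : Measurable (Function.uncurry G)) :
    eLpNorm (fun x => ∫⁻ t, G x t ∂ν) p μ ≤ ∫⁻ t, eLpNorm (fun x => G x t) p μ ∂ν := by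
  simp only [eLpNorm_ennreal_eq hp hp']
  exact lintegral_lintegral_rpow_le (ENNReal.toReal_mono hp' hp) hG

/-- The case $p=\infty$ is needed because Hölder's inequality brings in conjugate exponents. There
the essential supremum exceeds $c$ exactly when the slice of $\{G>c\}$ has positive measure, which
is a measurable condition on the parameter. -/
theorem measurable_eLpNorm_section [SFinite μ] {p : ℝ≥0∞} (hp : 1 ≤ p)
    {G : X → Y → ℝ≥0∞} (hG : Measurable (Function.uncurry G)) :
    Measurable fun y => eLpNorm (fun x => G x y) p μ := by
  rcases eq_or_ne p ∞ with rfl | hp'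
  · refine measurable_of_Ioi fun c => ?_
    have : (fun y => eLpNorm (fun x => G x y) ∞ μ) ⁻¹' Set.Ioi c
        = {y | μ ((fun x => (x, y)) ⁻¹' (Function.uncurry G ⁻¹' Set.Ioi c)) = 0}ᶜ := by
      ext y
      simp only [Set.mem_preimage, Set.mem_Ioi, Set.mem_compl_iff, Set.mem_ofPred_eq,
        eLpNorm_exponent_top, eLpNormEssSup_eq_essSup_enorm, enorm_eq_self]
      rw [← not_le, not_iff_not]
      constructor
      · intro h
        have := (ENNReal.ae_le_essSup (μ := μ) (fun x => G x y)).mono fun x hx => hx.trans h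
        rw [ae_iff] at this
        convert this using 2
        ext x; simp
      · intro h
        refine essSup_le_of_ae_le _ ?_
        rw [EventuallyLE, ae_iff]
        convert h using 2
        ext x; simp
    rw [this]
    exact (measurableSet_eq_fun (measurable_measure_prodMk_right (hG measurableSet_Ioi))
      measurable_const).compl
  · simp only [eLpNorm_ennreal_eq hp hp']
    refine Measurable.pow_const ?_ _
    exact Measurable.lintegral_prod_left' (f := fun z : X × Y => G z.1 z.2 ^ p.toReal)
      (hG.pow_const _)

theorem lintegral_mul_le_eLpNorm_mul_eLpNorm {p : ℝ≥0∞} (hp : 1 ≤ p) (hp' : p ≠ ∞)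
    {f g : X → ℝ≥0∞} (hf : AEMeasurable f μ) (hg : AEMeasurable g μ) :
    ∫⁻ x, f x * g x ∂μ ≤ eLpNorm f p μ * eLpNorm g p.conjExponent μ := by
  rcases hp.eq_or_lt with rfl | hp1
  · have : (1 : ℝ≥0∞).conjExponent = ∞ := by simp [ENNReal.conjExponent]
    rw [this, eLpNorm_one_eq_lintegral_enorm, eLpNorm_exponent_top]
    simp only [enorm_eq_self]
    calc ∫⁻ x, f x * g x ∂μ ≤ ∫⁻ x, f x * eLpNormEssSup g μ ∂μ := by
          refine lintegral_mono_ae ?_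
          filter_upwards [ae_le_eLpNormEssSup (f := g) (μ := μ)] with x hx
          gcongr
          simpa using hx
      _ = _ := lintegral_mul_const'' _ hf
  · have hc := ENNReal.HolderConjugate.conjExponent hp
    have hct : p.conjExponent ≠ ∞ := by
      simp [ENNReal.conjExponent, tsub_eq_zero_iff_le, hp1]
    have hc1 : 1 ≤ p.conjExponent := by simp [ENNReal.conjExponent]
    rw [eLpNorm_ennreal_eq hp hp', eLpNorm_ennreal_eq hc1 hct]
    exact ENNReal.lintegral_mul_le_Lp_mul_Lq μ
      (ENNReal.HolderConjugate.toReal_of_ne_top hp' hct) hf hg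

end Minkowski

/-! ### Mixed norms on a product: Minkowski, Hölder and dominated convergence. -/

section MixedNorm

variable {X Y T : Type*} [MeasureSpace X] [MeasureSpace Y] [MeasurableSpace T] {ν : Measure T}

/-- The mixed norm `(∫ (∫ G(x,ξ)^p dx)^{q/p} dξ)^{1/q}` of a nonnegative function. -/
noncomputable def mixedLNorm (p q : ℝ≥0∞) (G : X × Y → ℝ≥0∞) : ℝ≥0∞ :=
  eLpNorm (fun ξ => eLpNorm (fun x => G (x, ξ)) p volume) q volume

theorem mixedENorm_eq_mixedLNorm {n : ℕ} (p q : ℝ≥0∞)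
    (F : EuclideanSpace ℝ (Fin n) × EuclideanSpace ℝ (Fin n) → ℂ) :
    mixedENorm p q F = mixedLNorm p q (fun z => ‖F z‖ₑ) := by
  simp [mixedENorm, mixedLNorm]

theorem mixedLNorm_mono {p q : ℝ≥0∞} {F G : X × Y → ℝ≥0∞} (h : ∀ z, F z ≤ G z) :
    mixedLNorm p q F ≤ mixedLNorm p q G :=
  eLpNorm_mono_enorm fun ξ => by
    simpa using eLpNorm_mono_enorm fun x => by simpa using h (x, ξ)

theorem mixedLNorm_mono_ae [SFinite (volume : Measure X)] [SFinite (volume : Measure Y)]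
    {p q : ℝ≥0∞} {F G : X × Y → ℝ≥0∞} (h : ∀ᵐ z, F z ≤ G z) :
    mixedLNorm p q F ≤ mixedLNorm p q G := by
  -- The inner norm runs over the first factor, whereas slicing a null set of the product fixes the
  -- first factor; hence the swap.
  have h' : ∀ᵐ z : Y × X, F z.swap ≤ G z.swap := by
    have := (Measure.measurePreserving_swap (μ := (volume : Measure Y))
      (ν := (volume : Measure X))).quasiMeasurePreserving.ae h
    exact this
  refine eLpNorm_mono_enorm_ae ?_
  filter_upwards [Measure.ae_ae_of_ae_prod h'] with ξ hξ
  rw [enorm_eq_self, enorm_eq_self]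
  exact eLpNorm_mono_enorm_ae (hξ.mono fun x hx => by simpa using hx)

theorem mixedLNorm_congr_ae [SFinite (volume : Measure X)] [SFinite (volume : Measure Y)]
    {p q : ℝ≥0∞} {F G : X × Y → ℝ≥0∞} (h : F =ᵐ[volume] G) :
    mixedLNorm p q F = mixedLNorm p q G :=
  le_antisymm (mixedLNorm_mono_ae h.le) (mixedLNorm_mono_ae h.symm.le)

theorem mixedLNorm_const_mul {p q : ℝ≥0∞} (hp : 1 ≤ p) (hp' : p ≠ ∞) (hq : 1 ≤ q) (hq' : q ≠ ∞)
    {G : X × Y → ℝ≥0∞} {c : ℝ≥0∞} (hc : c ≠ ∞) :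
    mixedLNorm p q (fun z => c * G z) = c * mixedLNorm p q G := by
  rw [mixedLNorm, mixedLNorm,
    funext fun ξ : Y => eLpNorm_ennreal_const_mul hp hp' hc fun x => G (x, ξ)]
  exact eLpNorm_ennreal_const_mul hq hq' hc _

/-- Minkowski's integral inequality for mixed norms. -/
theorem mixedLNorm_lintegral_le [SigmaFinite (volume : Measure X)]
    [SigmaFinite (volume : Measure Y)] [SFinite ν] {p q : ℝ≥0∞} (hp : 1 ≤ p) (hp' : p ≠ ∞)
    (hq : 1 ≤ q) (hq' : q ≠ ∞) {G : X × Y → T → ℝ≥0∞} (hG : Measurable (Function.uncurry G)) :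
    mixedLNorm p q (fun z => ∫⁻ t, G z t ∂ν) ≤ ∫⁻ t, mixedLNorm p q (fun z => G z t) ∂ν := by
  have h1 : ∀ ξ : Y, eLpNorm (fun x => ∫⁻ t, G (x, ξ) t ∂ν) p volume
      ≤ ∫⁻ t, eLpNorm (fun x => G (x, ξ) t) p volume ∂ν := fun ξ =>
    eLpNorm_lintegral_le hp hp' (G := fun x t => G (x, ξ) t)
      (hG.comp (f := fun z : X × T => ((z.1, ξ), z.2)) (by fun_prop))
  refine (eLpNorm_mono_enorm (g := fun ξ => ∫⁻ t, eLpNorm (fun x => G (x, ξ) t) p volume ∂ν)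
    fun ξ => by simpa using h1 ξ).trans ?_
  refine eLpNorm_lintegral_le hq hq'
    (G := fun ξ t => eLpNorm (fun x => G (x, ξ) t) p volume) ?_
  exact measurable_eLpNorm_section hp (G := fun (x : X) (z : Y × T) => G (x, z.1) z.2)
    (hG.comp (f := fun z : X × Y × T => ((z.1, z.2.1), z.2.2)) (by fun_prop))

/-- Minkowski's integral inequality for the counting measure on `ℕ`. -/
theorem mixedLNorm_tsum_le [SigmaFinite (volume : Measure X)]
    [SigmaFinite (volume : Measure Y)] {p q : ℝ≥0∞} (hp : 1 ≤ p) (hp' : p ≠ ∞)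
    (hq : 1 ≤ q) (hq' : q ≠ ∞) {G : ℕ → X × Y → ℝ≥0∞} (hG : ∀ j, AEMeasurable (G j) volume) :
    mixedLNorm p q (fun z => ∑' j, G j z) ≤ ∑' j, mixedLNorm p q (G j) := by
  have h1 : (fun z => ∑' j, G j z) =ᵐ[volume] fun z => ∑' j, (hG j).mk _ z := by
    filter_upwards [ae_all_iff.2 fun j => (hG j).ae_eq_mk] with z hz
    exact tsum_congr hz
  rw [mixedLNorm_congr_ae h1]
  simp_rw [fun j => mixedLNorm_congr_ae (p := p) (q := q) (hG j).ae_eq_mk]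
  have := mixedLNorm_lintegral_le hp hp' hq hq' (ν := (Measure.count : Measure ℕ))
    (G := fun z j => (hG j).mk _ z)
    (measurable_from_prod_countable_left fun j => (hG j).measurable_mk)
  simpa [lintegral_count] using this

/-- Hölder's inequality for mixed norms. -/
theorem lintegral_mul_le_mixedLNorm_mul [SFinite (volume : Measure X)]
    [SFinite (volume : Measure Y)] {p q : ℝ≥0∞} (hp : 1 ≤ p) (hp' : p ≠ ∞)
    (hq : 1 ≤ q) (hq' : q ≠ ∞) {F G : X × Y → ℝ≥0∞} (hF : AEMeasurable F volume)
    (hG : AEMeasurable G volume) :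
    ∫⁻ z, F z * G z ≤ mixedLNorm p q F * mixedLNorm p.conjExponent q.conjExponent G := by
  have hc1 : 1 ≤ p.conjExponent := by simp [ENNReal.conjExponent]
  have hFG : ∫⁻ z, F z * G z = ∫⁻ z, hF.mk F z * hG.mk G z :=
    lintegral_congr_ae (hF.ae_eq_mk.mul hG.ae_eq_mk)
  rw [mixedLNorm_congr_ae hF.ae_eq_mk, mixedLNorm_congr_ae hG.ae_eq_mk, hFG]
  have hF' := hF.measurable_mk
  have hG' := hG.measurable_mk
  set F' := hF.mk F
  set G' := hG.mk G
  calc ∫⁻ z, F' z * G' z = ∫⁻ ξ, ∫⁻ x, F' (x, ξ) * G' (x, ξ) :=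
        lintegral_prod_symm' _ (hF'.mul hG')
    _ ≤ ∫⁻ ξ, eLpNorm (fun x => F' (x, ξ)) p volume
          * eLpNorm (fun x => G' (x, ξ)) p.conjExponent volume :=
        lintegral_mono fun ξ => lintegral_mul_le_eLpNorm_mul_eLpNorm hp hp'
          (hF'.comp measurable_prodMk_right).aemeasurable
          (hG'.comp measurable_prodMk_right).aemeasurable
    _ ≤ _ := lintegral_mul_le_eLpNorm_mul_eLpNorm hq hq'
          (measurable_eLpNorm_section hp (G := fun x ξ => F' (x, ξ)) hF').aemeasurable
          (measurable_eLpNorm_section hc1 (G := fun x ξ => G' (x, ξ)) hG').aemeasurable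

theorem ae_lt_top_of_eLpNorm_ne_top {p : ℝ≥0∞} (hp : 1 ≤ p) (hp' : p ≠ ∞) {f : X → ℝ≥0∞}
    (hf : AEMeasurable f volume) (h : eLpNorm f p volume ≠ ∞) : ∀ᵐ x, f x < ∞ := by
  have hp0 : 0 < p.toReal := ENNReal.toReal_pos (zero_lt_one.trans_le hp).ne' hp'
  rw [eLpNorm_ennreal_eq hp hp'] at h
  have h1 : ∫⁻ x, f x ^ p.toReal ≠ ∞ := fun h' => h (by rw [h', ENNReal.top_rpow_of_pos (by positivity)])
  filter_upwards [ae_lt_top' (hf.pow_const _) h1] with x hx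
  exact (ENNReal.rpow_lt_top_iff_of_pos hp0).1 hx

theorem ae_prod_of_ae_ae_swap [SFinite (volume : Measure X)] [SFinite (volume : Measure Y)]
    {s : Set (X × Y)} (hs : MeasurableSet s) (h : ∀ᵐ ξ : Y, ∀ᵐ x : X, (x, ξ) ∈ s) :
    ∀ᵐ z : X × Y, z ∈ s := by
  have h1 : ∀ᵐ z : Y × X, z.swap ∈ s := by
    have := (Measure.ae_prod_mem_iff_ae_ae_mem (μ := (volume : Measure Y))
      (ν := (volume : Measure X)) (s := Prod.swap ⁻¹' s) (measurable_swap hs)).2 h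
    exact this
  have := (Measure.measurePreserving_swap (μ := (volume : Measure X))
    (ν := (volume : Measure Y))).quasiMeasurePreserving.ae h1
  exact this

theorem ae_lt_top_of_mixedLNorm_ne_top [SFinite (volume : Measure X)]
    [SFinite (volume : Measure Y)] {p q : ℝ≥0∞} (hp : 1 ≤ p) (hp' : p ≠ ∞)
    (hq : 1 ≤ q) (hq' : q ≠ ∞) {G : X × Y → ℝ≥0∞} (hG : AEMeasurable G volume)
    (h : mixedLNorm p q G ≠ ∞) : ∀ᵐ z, G z < ∞ := by
  rw [mixedLNorm_congr_ae hG.ae_eq_mk] at h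
  have hG' := hG.measurable_mk
  suffices H : ∀ᵐ z, hG.mk G z < ∞ by
    filter_upwards [H, hG.ae_eq_mk] with z h1 h2
    rwa [h2]
  refine ae_prod_of_ae_ae_swap (s := hG.mk G ⁻¹' Set.Iio ∞) (hG' measurableSet_Iio) ?_
  filter_upwards [ae_lt_top_of_eLpNorm_ne_top hq hq'
    (measurable_eLpNorm_section hp (G := fun x ξ => hG.mk G (x, ξ)) hG').aemeasurable h] with ξ hξ
  exact ae_lt_top_of_eLpNorm_ne_top hp hp'
    (hG'.comp measurable_prodMk_right).aemeasurable hξ.ne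

theorem eLpNorm_tendsto_zero {p : ℝ≥0∞} (hp : 1 ≤ p) (hp' : p ≠ ∞) {G : ℕ → X → ℝ≥0∞}
    {B : X → ℝ≥0∞} (hG : ∀ j, AEMeasurable (G j) volume) (hB : eLpNorm B p volume ≠ ∞)
    (hle : ∀ j, ∀ᵐ x, G j x ≤ B x) (hlim : ∀ᵐ x, Tendsto (fun j => G j x) atTop (𝓝 0)) :
    Tendsto (fun j => eLpNorm (G j) p volume) atTop (𝓝 0) := by
  have hp0 : 0 < p.toReal := ENNReal.toReal_pos (zero_lt_one.trans_le hp).ne' hp'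
  simp only [eLpNorm_ennreal_eq hp hp'] at hB ⊢
  have h1 : ∫⁻ x, B x ^ p.toReal ≠ ∞ := fun h' => hB (by rw [h', ENNReal.top_rpow_of_pos (by positivity)])
  have h2 : Tendsto (fun j => ∫⁻ x, G j x ^ p.toReal) atTop (𝓝 (∫⁻ _ : X, 0)) := by
    refine tendsto_lintegral_of_dominated_convergence' (fun x => B x ^ p.toReal)
      (fun j => (hG j).pow_const _) (fun j => (hle j).mono fun x hx => ENNReal.rpow_le_rpow hx hp0.le) h1 ?_
    filter_upwards [hlim] with x hx
    simpa [hp0, Function.comp_def] using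
      (ENNReal.continuous_rpow_const (y := p.toReal)).continuousAt.tendsto.comp hx
  simp only [lintegral_zero] at h2
  simpa [hp0, Function.comp_def] using
    (ENNReal.continuous_rpow_const (y := 1 / p.toReal)).continuousAt.tendsto.comp h2

/-- Dominated convergence for mixed norms. -/
theorem mixedLNorm_tendsto_zero [SFinite (volume : Measure X)]
    [SFinite (volume : Measure Y)] {p q : ℝ≥0∞} (hp : 1 ≤ p) (hp' : p ≠ ∞)
    (hq : 1 ≤ q) (hq' : q ≠ ∞) {G : ℕ → X × Y → ℝ≥0∞} {B : X × Y → ℝ≥0∞}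
    (hG : ∀ j, AEMeasurable (G j) volume) (hBm : AEMeasurable B volume)
    (hB : mixedLNorm p q B ≠ ∞)
    (hle : ∀ j, ∀ᵐ z, G j z ≤ B z) (hlim : ∀ᵐ z, Tendsto (fun j => G j z) atTop (𝓝 0)) :
    Tendsto (fun j => mixedLNorm p q (G j)) atTop (𝓝 0) := by
  have hsec : ∀ {P : X × Y → Prop}, (∀ᵐ z, P z) → ∀ᵐ ξ : Y, ∀ᵐ x : X, P (x, ξ) := by
    intro P h
    have h' : ∀ᵐ z : Y × X, P z.swap := by
      have := (Measure.measurePreserving_swap (μ := (volume : Measure Y))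
        (ν := (volume : Measure X))).quasiMeasurePreserving.ae h
      exact this
    exact Measure.ae_ae_of_ae_prod h'
  rw [mixedLNorm_congr_ae hBm.ae_eq_mk] at hB
  simp_rw [fun j => mixedLNorm_congr_ae (p := p) (q := q) (hG j).ae_eq_mk]
  have hfin := ae_lt_top_of_eLpNorm_ne_top hq hq' (measurable_eLpNorm_section hp
    (G := fun x ξ => hBm.mk B (x, ξ)) hBm.measurable_mk).aemeasurable hB
  have hle' : ∀ j, ∀ᵐ z, (hG j).mk _ z ≤ hBm.mk B z := fun j => by
    filter_upwards [hle j, (hG j).ae_eq_mk, hBm.ae_eq_mk] with z h1 h2 h3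
    rwa [← h2, ← h3]
  have hlim' : ∀ᵐ z, Tendsto (fun j => (hG j).mk _ z) atTop (𝓝 0) := by
    filter_upwards [hlim, ae_all_iff.2 fun j => (hG j).ae_eq_mk] with z h1 h2
    exact h1.congr h2
  refine eLpNorm_tendsto_zero hq hq' (fun j => (measurable_eLpNorm_section hp
    (G := fun x ξ => (hG j).mk _ (x, ξ)) (hG j).measurable_mk).aemeasurable) hB (fun j => ?_) ?_
  · filter_upwards [hsec (hle' j)] with ξ hξ
    exact eLpNorm_mono_enorm_ae (hξ.mono fun x hx => by simpa using hx)
  · filter_upwards [hfin, hsec (ae_all_iff.2 hle'), hsec hlim'] with ξ h1 h2 h3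
    exact eLpNorm_tendsto_zero hp hp'
      (fun j => ((hG j).measurable_mk.comp measurable_prodMk_right).aemeasurable) h1.ne
      (fun j => h2.mono fun x hx => hx j) h3

end MixedNorm

/-! ### Translation invariance of the mixed norm and Young's inequality. -/

theorem mixedLNorm_sub_right {E : Type*} [NormedAddCommGroup E] [MeasureSpace E] [BorelSpace E]
    [(volume : Measure E).IsAddHaarMeasure] {p q : ℝ≥0∞} (hp : 1 ≤ p) (hp' : p ≠ ∞) (hq : 1 ≤ q) (hq' : q ≠ ∞)
    (G : E × E → ℝ≥0∞) (a : E × E) :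
    mixedLNorm p q (fun z => G (z - a)) = mixedLNorm p q G := by
  have hx : ∀ ξ, eLpNorm (fun x => G ((x, ξ) - a)) p volume
      = eLpNorm (fun x => G (x, ξ - a.2)) p volume := fun ξ => by
    simp only [eLpNorm_ennreal_eq hp hp']
    rw [← lintegral_sub_right_eq_self (fun x => G (x, ξ - a.2) ^ p.toReal) a.1]
    rfl
  simp only [mixedLNorm, hx, eLpNorm_ennreal_eq hq hq']
  rw [← lintegral_sub_right_eq_self
    (fun ξ => eLpNorm (fun x => G (x, ξ)) p volume ^ q.toReal) a.2]

section Young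

variable {E : Type*} [NormedAddCommGroup E] [NormedSpace ℝ E] [FiniteDimensional ℝ E]
  [MeasureSpace E] [BorelSpace E] [(volume : Measure E).IsAddHaarMeasure]

/-- Young's inequality for the convolution with an integrable kernel, in mixed norm. -/
theorem mixedLNorm_convolution_le {p q : ℝ≥0∞} (hp : 1 ≤ p) (hp' : p ≠ ∞) (hq : 1 ≤ q)
    (hq' : q ≠ ∞) {k G : E × E → ℝ≥0∞} (hk : Measurable k)
    (hk' : ∀ z, k z ≠ ∞) (hG : AEMeasurable G volume) :
    mixedLNorm p q (fun z => ∫⁻ z', k (z - z') * G z') ≤ (∫⁻ z, k z) * mixedLNorm p q G := by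
  -- With $t=z-z'$ the convolution becomes a superposition of translates of $G$, all of the same
  -- mixed norm, so Minkowski's inequality applies.
  have h0 : ∀ z, ∫⁻ z', k (z - z') * G z' = ∫⁻ t, k t * hG.mk G (z - t) := by
    intro z
    have : (volume : Measure (E × E)).IsAddHaarMeasure :=
      inferInstanceAs ((volume : Measure E).prod volume).IsAddHaarMeasure
    rw [← lintegral_sub_left_eq_self (fun t => k t * hG.mk G (z - t)) z]
    refine lintegral_congr_ae ?_
    filter_upwards [hG.ae_eq_mk] with z' h
    simp [h]
  simp_rw [h0]
  rw [mixedLNorm_congr_ae hG.ae_eq_mk]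
  have hG' := hG.measurable_mk
  refine (mixedLNorm_lintegral_le hp hp' hq hq' (ν := volume)
    (G := fun z t => k t * hG.mk G (z - t)) ?_).trans ?_
  · exact (hk.comp measurable_snd).mul (hG'.comp (measurable_fst.sub measurable_snd))
  rw [← lintegral_mul_const _ hk]
  refine lintegral_mono fun t => ?_
  rw [mixedLNorm_const_mul hp hp' hq hq' (hk' t), mixedLNorm_sub_right hp hp' hq hq']

end Young

/-! ### Translations and modulations of Schwartz functions -/

section SchwartzEstimates

variable {n : ℕ}

local notation "𝔼" => EuclideanSpace ℝ (Fin n)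

open FourierTransform

theorem one_add_norm_le_mul {E : Type*} [SeminormedAddCommGroup E] (a b : E) :
    1 + ‖a + b‖ ≤ (1 + ‖a‖) * (1 + ‖b‖) := by
  nlinarith [norm_add_le a b, norm_nonneg a, norm_nonneg b]

theorem one_add_norm_le_mul_sub {E : Type*} [SeminormedAddCommGroup E] (a b : E) :
    1 + ‖a‖ ≤ (1 + ‖b‖) * (1 + ‖a - b‖) := by
  simpa using one_add_norm_le_mul b (a - b)

theorem Seminorm.finsetSum_apply {𝕜 V ι : Type*} [SeminormedRing 𝕜] [AddCommGroup V] [Module 𝕜 V]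
    (p : ι → Seminorm 𝕜 V) (s : Finset ι) (x : V) : (∑ i ∈ s, p i) x = ∑ i ∈ s, p i x := by
  change FunLike.coeAddMonoidHom _ _ _ (∑ i ∈ s, p i) x = _
  rw [map_sum, Finset.sum_apply]
  rfl

theorem SchwartzMap.continuous_seminorm (k l : ℕ) :
    Continuous (SchwartzMap.seminorm ℂ k l : Seminorm ℂ 𝓢(𝔼, ℂ)) :=
  (schwartz_withSeminorms ℂ 𝔼 ℂ).continuous_seminorm (k, l)

/-- The estimates for Schwartz functions below are stated with a single continuous seminorm, so that
uniformity in the phase-space point and continuity in the function can both be read off. A finite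
sum of seminorms replaces the supremum because its continuity is immediate. -/
theorem SchwartzMap.exists_seminorm_one_add_norm_pow_mul_iteratedFDeriv_le (k l : ℕ) :
    ∃ p : Seminorm ℂ 𝓢(𝔼, ℂ), Continuous p ∧
      ∀ (φ : 𝓢(𝔼, ℂ)) (y : 𝔼), (1 + ‖y‖) ^ k * ‖iteratedFDeriv ℝ l φ y‖ ≤ p φ := by
  refine ⟨(2 ^ k : NNReal) • ∑ m ∈ Finset.Iic (k, l), SchwartzMap.seminorm ℂ m.1 m.2, ?_,
    fun φ y => ?_⟩
  · have : Continuous (⇑(∑ m ∈ Finset.Iic (k, l),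
        (SchwartzMap.seminorm ℂ m.1 m.2 : Seminorm ℂ 𝓢(𝔼, ℂ)))) :=
      Seminorm.continuous_finsetSum fun m _ => SchwartzMap.continuous_seminorm m.1 m.2
    exact this.const_smul _
  · refine (SchwartzMap.one_add_le_sup_seminorm_apply (𝕜 := ℂ) (m := (k, l)) le_rfl le_rfl
      φ y).trans ?_
    rw [smul_apply, NNReal.smul_def, smul_eq_mul]
    rw [NNReal.coe_pow, NNReal.coe_ofNat]
    gcongr
    exact Seminorm.finset_sup_le_sum (fun m : ℕ × ℕ => SchwartzMap.seminorm ℂ m.1 m.2) _ φ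

theorem SchwartzMap.exists_seminorm_one_add_norm_pow_mul_le (k : ℕ) :
    ∃ p : Seminorm ℂ 𝓢(𝔼, ℂ), Continuous p ∧
      ∀ (φ : 𝓢(𝔼, ℂ)) (y : 𝔼), (1 + ‖y‖) ^ k * ‖φ y‖ ≤ p φ := by
  obtain ⟨p, hp, h⟩ := SchwartzMap.exists_seminorm_one_add_norm_pow_mul_iteratedFDeriv_le (n := n) k 0
  exact ⟨p, hp, fun φ y => by simpa using h φ y⟩

theorem integrable_one_add_norm_pow_inv {N : ℕ} (hN : n < N) :
    Integrable fun y : 𝔼 => ((1 + ‖y‖) ^ N)⁻¹ := by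
  have := integrable_one_add_norm (E := 𝔼) (μ := volume) (r := N) (by simpa using hN)
  refine this.congr (Eventually.of_forall fun y => ?_)
  simp only []
  rw [Real.rpow_neg (by positivity), Real.rpow_natCast]

/-- By $1+|a|\le(1+|y|)(1+|a-y|)$, the decay in $a$ is paid for by $N$ powers of decay of each
factor; $n+1$ further powers of $\varphi$ make the integral converge. -/
theorem SchwartzMap.exists_seminorm_integral_mul_comp_sub_le (h : 𝓢(𝔼, ℂ)) (N : ℕ) :
    ∃ p : Seminorm ℂ 𝓢(𝔼, ℂ), Continuous p ∧
      ∀ (φ : 𝓢(𝔼, ℂ)) (a : 𝔼), ∫ y, ‖φ y‖ * ‖h (y - a)‖ ≤ p φ * ((1 + ‖a‖) ^ N)⁻¹ := by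
  obtain ⟨p, hp, hφ⟩ := SchwartzMap.exists_seminorm_one_add_norm_pow_mul_le (n := n) (N + (n + 1))
  obtain ⟨p', -, hh⟩ := SchwartzMap.exists_seminorm_one_add_norm_pow_mul_le (n := n) N
  set I := ∫ y : 𝔼, ((1 + ‖y‖) ^ (n + 1))⁻¹ with hI
  have hI0 : 0 ≤ I := integral_nonneg fun y => by positivity
  refine ⟨(p' h * I).toNNReal • p, hp.const_smul _,
    fun φ a => ?_⟩
  rw [smul_apply, NNReal.smul_def, smul_eq_mul, Real.coe_toNNReal _ (mul_nonneg (apply_nonneg _ _) hI0)]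
  have hpt : ∀ y, ‖φ y‖ * ‖h (y - a)‖
      ≤ (p' h * p φ * ((1 + ‖a‖) ^ N)⁻¹) * ((1 + ‖y‖) ^ (n + 1))⁻¹ := by
    intro y
    have h1 := hφ φ y
    have h2 := hh h (y - a)
    rw [← norm_neg (y - a), neg_sub] at h2
    have h3 : (1 + ‖a‖) ^ N ≤ (1 + ‖y‖) ^ N * (1 + ‖a - y‖) ^ N := by
      rw [← mul_pow]; gcongr; exact one_add_norm_le_mul_sub a y
    rw [mul_assoc (p' h * p φ), ← mul_inv, ← div_eq_mul_inv, le_div_iff₀ (by positivity)]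
    calc ‖φ y‖ * ‖h (y - a)‖ * ((1 + ‖a‖) ^ N * (1 + ‖y‖) ^ (n + 1))
        ≤ ‖φ y‖ * ‖h (y - a)‖ * (((1 + ‖y‖) ^ N * (1 + ‖a - y‖) ^ N) * (1 + ‖y‖) ^ (n + 1)) := by
          gcongr
      _ = ((1 + ‖a - y‖) ^ N * ‖h (y - a)‖) * ((1 + ‖y‖) ^ (N + (n + 1)) * ‖φ y‖) := by ring
      _ ≤ p' h * p φ := by gcongr
  calc ∫ y, ‖φ y‖ * ‖h (y - a)‖
      ≤ ∫ y : 𝔼, (p' h * p φ * ((1 + ‖a‖) ^ N)⁻¹) * ((1 + ‖y‖) ^ (n + 1))⁻¹ :=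
        integral_mono_of_nonneg (Eventually.of_forall fun y => by positivity)
          ((integrable_one_add_norm_pow_inv (Nat.lt_succ_self n)).const_mul _)
          (Eventually.of_forall hpt)
    _ = p' h * I * p φ * ((1 + ‖a‖) ^ N)⁻¹ := by rw [integral_const_mul]; ring

/-- A continuous seminorm is dominated by finitely many Schwartz seminorms, and in each of them
$|y|^k$ costs at most a factor $(1+|a|)^k$ after translation. -/
theorem SchwartzMap.exists_seminorm_compSubConst_le (p : Seminorm ℂ 𝓢(𝔼, ℂ)) (hp : Continuous p) :
    ∃ (N : ℕ) (q : Seminorm ℂ 𝓢(𝔼, ℂ)), Continuous q ∧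
      ∀ (φ : 𝓢(𝔼, ℂ)) (a : 𝔼), p (compSubConstCLM ℂ a φ) ≤ (1 + ‖a‖) ^ N * q φ := by
  obtain ⟨s, C, -, hC⟩ := Seminorm.bound_of_continuous (schwartz_withSeminorms ℂ 𝔼 ℂ) p hp
  choose q hq hle using fun m : ℕ × ℕ =>
    SchwartzMap.exists_seminorm_one_add_norm_pow_mul_iteratedFDeriv_le (n := n) m.1 m.2
  refine ⟨∑ m ∈ s, m.1, C • ∑ m ∈ s, q m, ?_, fun φ a => ?_⟩
  · have : Continuous (⇑(∑ m ∈ s, q m)) := Seminorm.continuous_finsetSum fun m _ => hq m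
    exact this.const_smul _
  have h1 : ∀ m ∈ s, SchwartzMap.seminorm ℂ m.1 m.2 (compSubConstCLM ℂ a φ)
      ≤ (1 + ‖a‖) ^ (∑ m ∈ s, m.1) * q m φ := by
    intro m hm
    refine SchwartzMap.seminorm_le_bound ℂ _ _ _ (by positivity) fun y => ?_
    have : iteratedFDeriv ℝ m.2 (compSubConstCLM ℂ a φ) y = iteratedFDeriv ℝ m.2 φ (y - a) := by
      rw [← iteratedFDeriv_comp_sub]; rfl
    rw [this]
    calc ‖y‖ ^ m.1 * ‖iteratedFDeriv ℝ m.2 φ (y - a)‖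
        ≤ ((1 + ‖a‖) * (1 + ‖y - a‖)) ^ m.1 * ‖iteratedFDeriv ℝ m.2 φ (y - a)‖ := by
          gcongr
          linarith [one_add_norm_le_mul_sub y a]
      _ = (1 + ‖a‖) ^ m.1 * ((1 + ‖y - a‖) ^ m.1 * ‖iteratedFDeriv ℝ m.2 φ (y - a)‖) := by
          rw [mul_pow, mul_assoc]
      _ ≤ (1 + ‖a‖) ^ (∑ m ∈ s, m.1) * q m φ := by
          gcongr
          · linarith [norm_nonneg a]
          · exact Finset.single_le_sum (f := fun m : ℕ × ℕ => m.1) (fun _ _ => Nat.zero_le _) hm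
          · exact hle m φ (y - a)
  calc p (compSubConstCLM ℂ a φ) ≤ (C • s.sup (schwartzSeminormFamily ℂ 𝔼 ℂ)) (compSubConstCLM ℂ a φ) := hC _
    _ ≤ C * ∑ m ∈ s, SchwartzMap.seminorm ℂ m.1 m.2 (compSubConstCLM ℂ a φ) := by
        rw [smul_apply, NNReal.smul_def, smul_eq_mul]
        gcongr
        refine (Seminorm.finset_sup_le_sum _ _ _).trans_eq ?_
        rw [Seminorm.finsetSum_apply]; rfl
    _ ≤ C * ∑ m ∈ s, (1 + ‖a‖) ^ (∑ m ∈ s, m.1) * q m φ := by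
        gcongr with m hm
        exact h1 m hm
    _ = (1 + ‖a‖) ^ (∑ m ∈ s, m.1) * (C • ∑ m ∈ s, q m) φ := by
        rw [smul_apply, NNReal.smul_def, smul_eq_mul, Seminorm.finsetSum_apply, ← Finset.mul_sum]
        ring

/-- The modulation `φ ↦ exp (-i y·ξ) φ(y)`. -/
noncomputable def SchwartzMap.modulationCLM (ξ : 𝔼) : 𝓢(𝔼, ℂ) →L[ℂ] 𝓢(𝔼, ℂ) :=
  smulLeftCLM ℂ (fun y : 𝔼 => Complex.exp (-(Complex.I * ((⟪y, ξ⟫_ℝ : ℝ) : ℂ))))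

theorem SchwartzMap.modulationCLM_apply (ξ : 𝔼) (φ : 𝓢(𝔼, ℂ)) (y : 𝔼) :
    modulationCLM ξ φ y = Complex.exp (-(Complex.I * ((⟪y, ξ⟫_ℝ : ℝ) : ℂ))) * φ y := by
  rw [modulationCLM, smulLeftCLM_apply_apply (hasTemperateGrowth_cexp_inner ξ)]
  rfl

/-- The factor $(2\pi)^{-1}$ reconciles the modulation $e^{-iy\cdot\xi}$ with the kernel $e^{-2\pi i
y\cdot\eta}$ of the Fourier transform `𝓕`. -/
theorem SchwartzMap.fourier_modulationCLM (ξ : 𝔼) (φ : 𝓢(𝔼, ℂ)) :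
    𝓕 (modulationCLM ξ φ) = compSubConstCLM ℂ (-(2 * Real.pi)⁻¹ • ξ) (𝓕 φ) := by
  ext η
  rw [compSubConstCLM_apply, fourier_coe, fourier_coe, Real.fourier_eq', Real.fourier_eq']
  congr 1
  ext y
  rw [modulationCLM_apply, smul_eq_mul, smul_eq_mul, ← mul_assoc, ← Complex.exp_add]
  congr 2
  rw [inner_sub_right, neg_smul, inner_neg_right, inner_smul_right]
  push_cast
  field_simp
  ring

theorem SchwartzMap.modulationCLM_eq (ξ : 𝔼) (φ : 𝓢(𝔼, ℂ)) :
    modulationCLM ξ φ = 𝓕⁻ (compSubConstCLM ℂ (-(2 * Real.pi)⁻¹ • ξ) (𝓕 φ)) := by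
  rw [← fourier_modulationCLM, fourierInv_fourier_eq]

/-- Conjugation with the Fourier transform, a topological isomorphism of `𝓢`, turns modulations into
translations. -/
theorem SchwartzMap.exists_seminorm_modulation_le (p : Seminorm ℂ 𝓢(𝔼, ℂ)) (hp : Continuous p) :
    ∃ (N : ℕ) (q : Seminorm ℂ 𝓢(𝔼, ℂ)), Continuous q ∧
      ∀ (φ : 𝓢(𝔼, ℂ)) (ξ : 𝔼), p (modulationCLM ξ φ) ≤ (1 + ‖ξ‖) ^ N * q φ := by
  obtain ⟨N, q, hq, h⟩ := SchwartzMap.exists_seminorm_compSubConst_le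
    (p.comp (fourierCLE ℂ 𝓢(𝔼, ℂ)).symm.toLinearEquiv.toLinearMap)
    (hp.comp (fourierCLE ℂ 𝓢(𝔼, ℂ)).symm.continuous)
  refine ⟨N, q.comp (fourierCLE ℂ 𝓢(𝔼, ℂ)).toLinearEquiv.toLinearMap,
    hq.comp (fourierCLE ℂ 𝓢(𝔼, ℂ)).continuous, fun φ ξ => ?_⟩
  rw [modulationCLM_eq]
  refine (h (𝓕 φ) _).trans ?_
  have h0 : ‖-(2 * Real.pi)⁻¹ • ξ‖ ≤ ‖ξ‖ := by
    rw [norm_smul, norm_neg, Real.norm_of_nonneg (by positivity)]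
    refine mul_le_of_le_one_left (norm_nonneg _) (inv_le_one_of_one_le₀ ?_)
    nlinarith [Real.pi_gt_three]
  change _ ≤ (1 + ‖ξ‖) ^ N * q (𝓕 φ)
  gcongr

end SchwartzEstimates

/-! ### Decay of the short-time Fourier transform of Schwartz functions -/

section Decay

variable {n : ℕ}

local notation "𝔼" => EuclideanSpace ℝ (Fin n)

open FourierTransform

/-- The submultiplicative weight `(1 + |x|) (1 + |ξ|)` on phase space. -/
noncomputable def phaseWeight (z : 𝔼 × 𝔼) : ℝ := (1 + ‖z.1‖) * (1 + ‖z.2‖)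

theorem one_le_phaseWeight (z : 𝔼 × 𝔼) : 1 ≤ phaseWeight z := by
  unfold phaseWeight
  nlinarith [norm_nonneg z.1, norm_nonneg z.2, mul_nonneg (norm_nonneg z.1) (norm_nonneg z.2)]

theorem phaseWeight_pos (z : 𝔼 × 𝔼) : 0 < phaseWeight z :=
  zero_lt_one.trans_le (one_le_phaseWeight z)

theorem phaseWeight_le_mul_sub (z z' : 𝔼 × 𝔼) :
    phaseWeight z ≤ phaseWeight z' * phaseWeight (z - z') := by
  unfold phaseWeight
  calc _ ≤ ((1 + ‖z'.1‖) * (1 + ‖z.1 - z'.1‖)) * ((1 + ‖z'.2‖) * (1 + ‖z.2 - z'.2‖)) := by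
        gcongr
        · exact one_add_norm_le_mul_sub _ _
        · exact one_add_norm_le_mul_sub _ _
    _ = _ := by simp only [Prod.fst_sub, Prod.snd_sub]; ring

theorem phaseWeight_neg (z : 𝔼 × 𝔼) : phaseWeight (-z) = phaseWeight z := by
  simp [phaseWeight]

theorem phaseWeight_sub_comm (z z' : 𝔼 × 𝔼) : phaseWeight (z - z') = phaseWeight (z' - z) := by
  rw [← phaseWeight_neg, neg_sub]

@[fun_prop]
theorem continuous_phaseWeight : Continuous (phaseWeight (n := n)) := by
  unfold phaseWeight; fun_prop

theorem integrable_phaseWeight_pow_inv {N : ℕ} (hN : n < N) :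
    Integrable fun z : 𝔼 × 𝔼 => (phaseWeight z ^ N)⁻¹ := by
  have := (integrable_one_add_norm_pow_inv hN).mul_prod (integrable_one_add_norm_pow_inv hN)
  refine this.congr (Eventually.of_forall fun z => ?_)
  simp only [phaseWeight]
  rw [mul_pow, mul_inv]

theorem SchwartzMap.norm_fourierInv_compSubConstCLM (h : 𝓢(𝔼, ℂ)) (x η : 𝔼) :
    ‖𝓕⁻ (compSubConstCLM ℂ x h) η‖ = ‖𝓕⁻ h η‖ := by
  have : 𝓕⁻ (compSubConstCLM ℂ x h) η
      = Complex.exp (↑(2 * Real.pi * ⟪x, η⟫_ℝ) * Complex.I) * 𝓕⁻ h η := by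
    rw [fourierInv_coe, fourierInv_coe, Real.fourierInv_eq', Real.fourierInv_eq',
      ← integral_const_mul, ← integral_add_right_eq_self _ x]
    congr 1
    ext y
    rw [compSubConstCLM_apply, smul_eq_mul, smul_eq_mul, ← mul_assoc, ← Complex.exp_add,
      add_sub_cancel_right]
    congr 2
    rw [inner_add_left]
    push_cast
    ring
  rw [this, norm_mul, Complex.norm_exp_ofReal_mul_I, one_mul]

theorem norm_cexp_neg_I_mul (t : ℝ) : ‖Complex.exp (-(Complex.I * (t : ℂ)))‖ = 1 := by
  have : -(Complex.I * (t : ℂ)) = ((-t : ℝ) : ℂ) * Complex.I := by push_cast; ring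
  rw [this, Complex.norm_exp_ofReal_mul_I]

/-- Decay in $x$ comes from the decay of the two factors. Decay in $\xi$ is the same estimate on the
Fourier side, where the modulation is a translation and the translation only a phase. The geometric
mean of the two bounds decays in both variables at once, which is why each is proved with exponent
$2N$. -/
theorem SchwartzMap.exists_seminorm_integral_modulation_mul_le (h : 𝓢(𝔼, ℂ)) (N : ℕ) :
    ∃ p : Seminorm ℂ 𝓢(𝔼, ℂ), Continuous p ∧ ∀ (φ : 𝓢(𝔼, ℂ)) (z : 𝔼 × 𝔼),
      ‖∫ y, modulationCLM z.2 φ y * h (y - z.1)‖ ≤ p φ * (phaseWeight z ^ N)⁻¹ := by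
  obtain ⟨p, hp, hpφ⟩ := SchwartzMap.exists_seminorm_integral_mul_comp_sub_le h (2 * N)
  obtain ⟨q, hq, hqφ⟩ := SchwartzMap.exists_seminorm_integral_mul_comp_sub_le (𝓕⁻ h) (2 * N)
  set q' : Seminorm ℂ 𝓢(𝔼, ℂ) :=
    ((2 * Real.pi) ^ (2 * N)).toNNReal • q.comp (fourierCLE ℂ 𝓢(𝔼, ℂ)).toLinearEquiv.toLinearMap
    with hq'
  have hq'c : Continuous q' := by
    have : Continuous (q.comp (fourierCLE ℂ 𝓢(𝔼, ℂ)).toLinearEquiv.toLinearMap) :=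
      hq.comp (fourierCLE ℂ 𝓢(𝔼, ℂ)).continuous
    exact this.const_smul _
  refine ⟨p + q', hp.add hq'c, fun φ z => ?_⟩
  obtain ⟨x, ξ⟩ := z
  simp only []
  set J := ∫ y, modulationCLM ξ φ y * h (y - x)
  have h1 : ‖J‖ ≤ p φ * ((1 + ‖x‖) ^ (2 * N))⁻¹ := by
    refine le_trans (norm_integral_le_integral_norm _) (le_trans (le_of_eq ?_) (hpφ φ x))
    congr 1
    ext y
    rw [norm_mul, modulationCLM_apply, norm_mul, norm_cexp_neg_I_mul, one_mul]
  have h2 : ‖J‖ ≤ q' φ * ((1 + ‖ξ‖) ^ (2 * N))⁻¹ := by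
    have e1 : J = ∫ η, 𝓕 (modulationCLM ξ φ) η * 𝓕⁻ (compSubConstCLM ℂ x h) η := by
      rw [integral_fourier_mul_eq, fourier_fourierInv_eq]
      rfl
    have e2 : ‖J‖ ≤ ∫ η, ‖(𝓕 φ) η‖ * ‖(𝓕⁻ h) (η - (2 * Real.pi)⁻¹ • ξ)‖ := by
      rw [e1, ← integral_sub_right_eq_self _ ((2 * Real.pi)⁻¹ • ξ)]
      refine (norm_integral_le_integral_norm _).trans_eq ?_
      congr 1
      ext η
      rw [norm_mul, norm_fourierInv_compSubConstCLM, fourier_modulationCLM, compSubConstCLM_apply,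
        neg_smul, sub_neg_eq_add, sub_add_cancel]
    refine e2.trans ((hqφ (𝓕 φ) _).trans ?_)
    have e3 : q' φ = (2 * Real.pi) ^ (2 * N) * q (𝓕 φ) := by
      rw [hq', smul_apply, NNReal.smul_def, smul_eq_mul, Real.coe_toNNReal _ (by positivity)]
      rfl
    have e4 : 1 + ‖ξ‖ ≤ (2 * Real.pi) * (1 + ‖(2 * Real.pi)⁻¹ • ξ‖) := by
      rw [norm_smul, Real.norm_of_nonneg (by positivity), mul_add, ← mul_assoc,
        mul_inv_cancel₀ (by positivity)]
      nlinarith [Real.pi_gt_three]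
    rw [e3, mul_comm ((2 * Real.pi) ^ (2 * N)), mul_assoc]
    gcongr
    rw [← div_eq_mul_inv, le_div_iff₀ (by positivity), inv_mul_le_iff₀ (by positivity), mul_comm,
      ← mul_pow]
    exact pow_le_pow_left₀ (by positivity) (e4.trans_eq (mul_comm _ _)) _
  have hP : 0 ≤ p φ := apply_nonneg _ _
  have hQ : 0 ≤ q' φ := apply_nonneg _ _
  change ‖J‖ ≤ (p φ + q' φ) * _
  have h0 : 0 ≤ (p φ + q' φ) * (phaseWeight (x, ξ) ^ N)⁻¹ :=
    mul_nonneg (add_nonneg hP hQ) (inv_nonneg.2 (pow_nonneg (phaseWeight_pos _).le _))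
  rw [← pow_le_pow_iff_left₀ (norm_nonneg J) h0 two_ne_zero]
  calc ‖J‖ ^ 2 = ‖J‖ * ‖J‖ := sq _
    _ ≤ (p φ * ((1 + ‖x‖) ^ (2 * N))⁻¹) * (q' φ * ((1 + ‖ξ‖) ^ (2 * N))⁻¹) := by gcongr
    _ = (p φ * q' φ) * (((phaseWeight (x, ξ) ^ N)⁻¹) ^ 2) := by
        rw [phaseWeight, mul_pow, mul_inv, mul_comm 2 N, pow_mul, pow_mul, mul_pow]
        simp only [inv_pow]
        ring
    _ ≤ (p φ + q' φ) ^ 2 * (((phaseWeight (x, ξ) ^ N)⁻¹) ^ 2) := by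
        gcongr
        nlinarith
    _ = _ := by ring

/-- The time-frequency shift `y ↦ g (y - x) * exp (i y·ξ)` for `z = (x, ξ)`. -/
noncomputable def timeFrequencyShift (g : 𝓢(𝔼, ℂ)) (z : 𝔼 × 𝔼) : 𝓢(𝔼, ℂ) :=
  postcompCLM (𝕜 := ℝ) (Complex.conjCLE : ℂ →L[ℝ] ℂ) (conjTimeFrequencyShift g z)

theorem timeFrequencyShift_apply (g : 𝓢(𝔼, ℂ)) (z : 𝔼 × 𝔼) (y : 𝔼) :
    timeFrequencyShift g z y = (starRingEnd ℂ) (conjTimeFrequencyShift g z y) := rfl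

theorem timeFrequencyShift_apply' (g : 𝓢(𝔼, ℂ)) (z : 𝔼 × 𝔼) (y : 𝔼) :
    timeFrequencyShift g z y
      = Complex.exp (-(Complex.I * ((⟪y, -z.2⟫_ℝ : ℝ) : ℂ))) * g (y - z.1) := by
  rw [timeFrequencyShift_apply, conjTimeFrequencyShift_apply, map_mul, Complex.conj_conj,
    ← Complex.exp_conj]
  congr 2
  simp [inner_neg_right]

/-- The coefficient `∫ φ(y) g(y - x) exp (i y·ξ) dy` of a Schwartz function. -/
noncomputable def gaborPairing (g φ : 𝓢(𝔼, ℂ)) (z : 𝔼 × 𝔼) : ℂ :=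
  ∫ y, φ y * timeFrequencyShift g z y

theorem SchwartzMap.integrable_mul (φ ψ : 𝓢(𝔼, ℂ)) : Integrable fun y => φ y * ψ y :=
  (SchwartzMap.pairing (ContinuousLinearMap.mul ℂ ℂ) φ ψ).integrable

theorem gaborPairing_eq_integral_modulation (g φ : 𝓢(𝔼, ℂ)) (z : 𝔼 × 𝔼) :
    gaborPairing g φ z = ∫ y, modulationCLM (-z.2) φ y * g (y - z.1) := by
  rw [gaborPairing]
  congr 1
  ext y
  rw [timeFrequencyShift_apply', modulationCLM_apply]
  ring

theorem exists_seminorm_norm_gaborPairing_le (g : 𝓢(𝔼, ℂ)) (N : ℕ) :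
    ∃ p : Seminorm ℂ 𝓢(𝔼, ℂ), Continuous p ∧ ∀ (φ : 𝓢(𝔼, ℂ)) (z : 𝔼 × 𝔼),
      ‖gaborPairing g φ z‖ ≤ p φ * (phaseWeight z ^ N)⁻¹ := by
  obtain ⟨p, hp, h⟩ := SchwartzMap.exists_seminorm_integral_modulation_mul_le g N
  refine ⟨p, hp, fun φ z => ?_⟩
  rw [gaborPairing_eq_integral_modulation]
  simpa [phaseWeight] using h φ (z.1, -z.2)

/-- Up to a phase, the reproducing kernel depends only on $z-z'$. Hence integration against it is
dominated by a convolution, to which Young's inequality applies. -/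
theorem gaborPairing_conjTimeFrequencyShift (g : 𝓢(𝔼, ℂ)) (z z' : 𝔼 × 𝔼) :
    gaborPairing g (conjTimeFrequencyShift g z') z
      = Complex.exp (-(Complex.I * ((⟪z'.1, z'.2 - z.2⟫_ℝ : ℝ) : ℂ))) *
        gaborPairing g (postcompCLM (𝕜 := ℝ) (Complex.conjCLE : ℂ →L[ℝ] ℂ) g) (z - z') := by
  rw [gaborPairing, gaborPairing, ← integral_const_mul, ← integral_add_right_eq_self _ z'.1]
  congr 1
  ext y
  rw [conjTimeFrequencyShift_apply, timeFrequencyShift_apply', timeFrequencyShift_apply',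
    add_sub_cancel_right, show y + z'.1 - z.1 = y - (z - z').1 by rw [Prod.fst_sub]; abel]
  have : (postcompCLM (𝕜 := ℝ) (Complex.conjCLE : ℂ →L[ℝ] ℂ) g) y = (starRingEnd ℂ) (g y) := rfl
  rw [this, mul_mul_mul_comm, mul_left_comm ((starRingEnd ℂ) (g y)), ← mul_assoc (Complex.exp _),
    ← Complex.exp_add, ← Complex.exp_add]
  congr 2
  simp only [inner_sub_right, inner_add_left, inner_neg_right, Prod.snd_sub]
  push_cast
  ring

theorem exists_norm_gaborPairing_conjTimeFrequencyShift_le (g : 𝓢(𝔼, ℂ)) (N : ℕ) :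
    ∃ C : ℝ, 0 < C ∧ ∀ z z' : 𝔼 × 𝔼,
      ‖gaborPairing g (conjTimeFrequencyShift g z') z‖ ≤ C * (phaseWeight (z - z') ^ N)⁻¹ := by
  obtain ⟨p, -, h⟩ := exists_seminorm_norm_gaborPairing_le g N
  -- The summand $1$ serves only to make the constant strictly positive.
  refine ⟨p (postcompCLM (𝕜 := ℝ) (Complex.conjCLE : ℂ →L[ℝ] ℂ) g) + 1, by positivity,
    fun z z' => ?_⟩
  rw [gaborPairing_conjTimeFrequencyShift, norm_mul, norm_cexp_neg_I_mul, one_mul]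
  refine (h _ _).trans ?_
  have := phaseWeight_pos (z - z')
  gcongr
  linarith

/-- Translations and modulations each cost a power of the phase weight. This polynomial growth is
later absorbed by the rapid decay of `gaborPairing`. -/
theorem exists_seminorm_conjTimeFrequencyShift_le (g : 𝓢(𝔼, ℂ)) (p : Seminorm ℂ 𝓢(𝔼, ℂ))
    (hp : Continuous p) :
    ∃ (N : ℕ) (C : ℝ), 0 < C ∧ ∀ z : 𝔼 × 𝔼,
      p (conjTimeFrequencyShift g z) ≤ C * phaseWeight z ^ N := by
  obtain ⟨N, q, hq, h1⟩ := SchwartzMap.exists_seminorm_modulation_le p hp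
  obtain ⟨N', q', -, h2⟩ := SchwartzMap.exists_seminorm_compSubConst_le q hq
  set g' : 𝓢(𝔼, ℂ) := postcompCLM (𝕜 := ℝ) (Complex.conjCLE : ℂ →L[ℝ] ℂ) g with hg'
  refine ⟨N + N', q' g' + 1, by positivity, fun z => ?_⟩
  have hz1 : 1 + ‖z.1‖ ≤ phaseWeight z :=
    le_mul_of_one_le_right (by positivity) (by linarith [norm_nonneg z.2])
  have hz2 : 1 + ‖z.2‖ ≤ phaseWeight z :=
    le_mul_of_one_le_left (by positivity) (by linarith [norm_nonneg z.1])
  have h0 := (phaseWeight_pos z).le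
  calc p (conjTimeFrequencyShift g z) ≤ (1 + ‖z.2‖) ^ N * q (compSubConstCLM ℂ z.1 g') := h1 _ _
    _ ≤ (1 + ‖z.2‖) ^ N * ((1 + ‖z.1‖) ^ N' * q' g') := by gcongr; exact h2 _ _
    _ ≤ phaseWeight z ^ N * (phaseWeight z ^ N' * (q' g' + 1)) := by
        gcongr
        linarith
    _ = _ := by ring

end Decay

/-! ### Inversion of the short-time Fourier transform on Schwartz functions -/

section Inversion

variable {n : ℕ}

local notation "𝔼" => EuclideanSpace ℝ (Fin n)

open FourierTransform

theorem contDiff_conjTimeFrequencyShift_uncurry (g : 𝓢(𝔼, ℂ)) :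
    ContDiff ℝ (⊤ : ℕ∞) fun w : (𝔼 × 𝔼) × 𝔼 => conjTimeFrequencyShift g w.1 w.2 := by
  simp_rw [conjTimeFrequencyShift_apply]
  have h1 : ContDiff ℝ (⊤ : ℕ∞) fun w : (𝔼 × 𝔼) × 𝔼 => ⟪w.2, w.1.2⟫_ℝ :=
    contDiff_snd.inner ℝ (contDiff_snd.comp contDiff_fst)
  have h2 : ContDiff ℝ (⊤ : ℕ∞) fun w : (𝔼 × 𝔼) × 𝔼 => g (w.2 - w.1.1) :=
    (g.smooth ⊤).comp (by fun_prop)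
  refine ContDiff.mul ?_ (Complex.conjCLE.contDiff.comp h2)
  exact ((contDiff_const.mul (Complex.ofRealCLM.contDiff.comp h1)).neg).cexp

theorem continuous_conjTimeFrequencyShift_uncurry (g : 𝓢(𝔼, ℂ)) :
    Continuous fun w : (𝔼 × 𝔼) × 𝔼 => conjTimeFrequencyShift g w.1 w.2 :=
  (contDiff_conjTimeFrequencyShift_uncurry g).continuous

theorem continuous_conjTimeFrequencyShift_left (g : 𝓢(𝔼, ℂ)) (y : 𝔼) :
    Continuous fun z : 𝔼 × 𝔼 => conjTimeFrequencyShift g z y := by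
  exact (continuous_conjTimeFrequencyShift_uncurry g).comp (f := fun z => (z, y))
    (continuous_id.prodMk continuous_const)

theorem continuous_timeFrequencyShift_left (g : 𝓢(𝔼, ℂ)) (y : 𝔼) :
    Continuous fun z : 𝔼 × 𝔼 => timeFrequencyShift g z y := by
  simp_rw [timeFrequencyShift_apply]
  exact Complex.continuous_conj.comp (continuous_conjTimeFrequencyShift_left g y)

/-- The derivatives in $y$ are the joint derivatives restricted to directions in the last factor, so
joint smoothness gives continuity in $z$. It provides the measurability needed to differentiate the
inversion formula. -/
theorem continuous_iteratedFDeriv_conjTimeFrequencyShift (g : 𝓢(𝔼, ℂ)) (l : ℕ) (y : 𝔼) :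
    Continuous fun z : 𝔼 × 𝔼 => iteratedFDeriv ℝ l (conjTimeFrequencyShift g z) y := by
  set G : (𝔼 × 𝔼) × 𝔼 → ℂ := fun w => conjTimeFrequencyShift g w.1 w.2 with hG
  have hGs := contDiff_conjTimeFrequencyShift_uncurry g
  have h : ∀ z : 𝔼 × 𝔼, iteratedFDeriv ℝ l (conjTimeFrequencyShift g z) y
      = (iteratedFDeriv ℝ l G (z, y)).compContinuousLinearMap
          fun _ => ContinuousLinearMap.inr ℝ (𝔼 × 𝔼) 𝔼 := by
    intro z
    have e : (conjTimeFrequencyShift g z : 𝔼 → ℂ)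
        = (fun w => G ((z, 0) + w)) ∘ ContinuousLinearMap.inr ℝ (𝔼 × 𝔼) 𝔼 := by
      ext y; simp [hG]
    have hs : ContDiff ℝ (⊤ : ℕ∞) fun w => G ((z, 0) + w) :=
      hGs.comp (contDiff_const.add contDiff_id)
    rw [e, ContinuousLinearMap.iteratedFDeriv_comp_right (i := l) _ hs _ (by exact_mod_cast le_top),
      iteratedFDeriv_comp_add_left]
    simp
  simp_rw [h]
  have h1 : Continuous fun z : 𝔼 × 𝔼 => iteratedFDeriv ℝ l G (z, y) :=
    (hGs.continuous_iteratedFDeriv (by exact_mod_cast le_top)).comp (by fun_prop)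
  exact (ContinuousMultilinearMap.compContinuousLinearMapL
    fun _ : Fin l => ContinuousLinearMap.inr ℝ (𝔼 × 𝔼) 𝔼).continuous.comp h1

theorem norm_conjTimeFrequencyShift_apply (g : 𝓢(𝔼, ℂ)) (z : 𝔼 × 𝔼) (y : 𝔼) :
    ‖conjTimeFrequencyShift g z y‖ = ‖g (y - z.1)‖ := by
  rw [conjTimeFrequencyShift_apply, norm_mul, norm_cexp_neg_I_mul, one_mul, RCLike.norm_conj]

theorem norm_timeFrequencyShift_apply (g : 𝓢(𝔼, ℂ)) (z : 𝔼 × 𝔼) (y : 𝔼) :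
    ‖timeFrequencyShift g z y‖ = ‖g (y - z.1)‖ := by
  rw [timeFrequencyShift_apply, RCLike.norm_conj, norm_conjTimeFrequencyShift_apply]

theorem continuous_gaborPairing (g φ : 𝓢(𝔼, ℂ)) : Continuous (gaborPairing g φ) := by
  refine continuous_of_dominated (bound := fun y => ‖φ y‖ * SchwartzMap.seminorm ℂ 0 0 g)
    (fun z => (φ.integrable_mul _).aestronglyMeasurable) (fun z => Eventually.of_forall fun y => ?_)
    (φ.integrable.norm.mul_const _) (Eventually.of_forall fun y => ?_)
  · rw [norm_mul, norm_timeFrequencyShift_apply]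
    gcongr
    exact SchwartzMap.norm_le_seminorm ℂ g _
  · exact continuous_const.mul (continuous_timeFrequencyShift_left g y)

theorem continuous_gaborPairing_conjTimeFrequencyShift (g : 𝓢(𝔼, ℂ)) :
    Continuous fun w : (𝔼 × 𝔼) × (𝔼 × 𝔼) =>
      gaborPairing g (conjTimeFrequencyShift g w.2) w.1 := by
  simp_rw [gaborPairing_conjTimeFrequencyShift]
  have := continuous_gaborPairing g (postcompCLM (𝕜 := ℝ) (Complex.conjCLE : ℂ →L[ℝ] ℂ) g)
  have h2 : Continuous fun w : (𝔼 × 𝔼) × (𝔼 × 𝔼) => (⟪w.2.1, w.2.2 - w.1.2⟫_ℝ : ℝ) := by fun_prop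
  fun_prop

theorem integrable_gaborPairing (g φ : 𝓢(𝔼, ℂ)) : Integrable (gaborPairing g φ) := by
  obtain ⟨p, -, h⟩ := exists_seminorm_norm_gaborPairing_le g (n + 1)
  exact ((integrable_phaseWeight_pow_inv (Nat.lt_succ_self n)).const_mul (p φ)).mono'
    (continuous_gaborPairing g φ).aestronglyMeasurable (Eventually.of_forall (h φ))

/-- The constant `(2π)ⁿ ∫ |g|²` in the inversion formula for the short-time Fourier transform. -/
noncomputable def gaborConst (g : 𝓢(𝔼, ℂ)) : ℝ := (2 * Real.pi) ^ n * ∫ y, ‖g y‖ ^ 2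

theorem SchwartzMap.integrable_norm_sq (g : 𝓢(𝔼, ℂ)) : Integrable fun y => ‖g y‖ ^ 2 := by
  have := (g.memLp 2 volume).integrable_norm_pow (p := 2) (by norm_num)
  simpa using this

theorem gaborConst_pos {g : 𝓢(𝔼, ℂ)} (hg : g ≠ 0) : 0 < gaborConst g := by
  refine mul_pos (by positivity) ?_
  obtain ⟨y, hy⟩ : ∃ y, g y ≠ 0 := by
    by_contra! h
    exact hg (SchwartzMap.ext h)
  rw [integral_pos_iff_support_of_nonneg (fun y => by positivity) g.integrable_norm_sq]
  exact (continuous_norm.comp g.continuous |>.pow 2).isOpen_support.measure_pos _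
    ⟨y, by simpa using hy⟩

/-- For fixed $x$, the $\xi$-integral is Fourier inversion for $\varphi\cdot g(\cdot-x)$ at $y$; the
rescaling by $2\pi$ contributes $(2\pi)^n$, and the result is $(2\pi)^n\varphi(y)|g(y-x)|^2$.
Integration over $x$ leaves $\|g\|_2^2$. -/
theorem integral_gaborPairing_mul_conjTimeFrequencyShift (g φ : 𝓢(𝔼, ℂ)) (y : 𝔼) :
    ∫ z, gaborPairing g φ z * conjTimeFrequencyShift g z y = gaborConst g * φ y := by
  have hint : Integrable fun z => gaborPairing g φ z * conjTimeFrequencyShift g z y := by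
    refine (integrable_gaborPairing g φ).mul_bdd (c := SchwartzMap.seminorm ℂ 0 0 g)
      (continuous_conjTimeFrequencyShift_left g y).aestronglyMeasurable ?_
    refine Eventually.of_forall fun z => ?_
    rw [norm_conjTimeFrequencyShift_apply]
    exact SchwartzMap.norm_le_seminorm ℂ g _
  rw [show (volume : Measure (𝔼 × 𝔼)) = (volume : Measure 𝔼).prod volume from rfl] at hint ⊢
  rw [integral_prod _ hint]
  have hx : ∀ x : 𝔼, ∫ ξ, gaborPairing g φ (x, ξ) * conjTimeFrequencyShift g (x, ξ) y
      = ((2 * Real.pi) ^ n : ℝ) * (φ y * ((‖g (y - x)‖ ^ 2 : ℝ) : ℂ)) := by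
    intro x
    set Fx : 𝓢(𝔼, ℂ) := SchwartzMap.pairing (ContinuousLinearMap.mul ℂ ℂ) φ (compSubConstCLM ℂ x g)
      with hFx
    have hFa : ∀ t, Fx t = φ t * g (t - x) := fun t => rfl
    have e1 : ∀ ξ, gaborPairing g φ (x, ξ) = 𝓕⁻ Fx ((2 * Real.pi)⁻¹ • ξ) := by
      intro ξ
      rw [fourierInv_coe, Real.fourierInv_eq', gaborPairing]
      congr 1
      ext t
      rw [timeFrequencyShift_apply', hFa, smul_eq_mul, mul_left_comm]
      congr 2
      rw [inner_neg_right, inner_smul_right]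
      push_cast
      field_simp
    obtain ⟨H, hH⟩ : ∃ H : 𝔼 → ℂ, H = fun η : 𝔼 =>
        (Complex.exp (↑(-2 * Real.pi * ⟪η, y⟫_ℝ) * Complex.I) • 𝓕⁻ Fx η)
          * (starRingEnd ℂ) (g (y - x)) := ⟨_, rfl⟩
    have e2 : ∀ ξ, gaborPairing g φ (x, ξ) * conjTimeFrequencyShift g (x, ξ) y
        = H ((2 * Real.pi)⁻¹ • ξ) := by
      intro ξ
      rw [e1, hH, conjTimeFrequencyShift_apply]
      simp only [smul_eq_mul]
      rw [← mul_assoc, mul_comm (𝓕⁻ Fx _)]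
      congr 3
      rw [inner_smul_left, real_inner_comm]
      simp only [conj_trivial]
      push_cast
      field_simp
    rw [integral_congr_ae (Eventually.of_forall e2), Measure.integral_comp_inv_smul volume H, hH, integral_mul_const]
    have e3 : ∫ η : 𝔼, Complex.exp (↑(-2 * Real.pi * ⟪η, y⟫_ℝ) * Complex.I) • 𝓕⁻ Fx η = Fx y := by
      rw [← Real.fourier_eq' (⇑(𝓕⁻ Fx : 𝓢(𝔼, ℂ))) y, ← fourier_coe, fourier_fourierInv_eq]
    rw [e3, hFa, finrank_euclideanSpace_fin, abs_of_pos (by positivity)]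
    rw [Complex.real_smul, mul_assoc, Complex.mul_conj, Complex.normSq_eq_norm_sq]
  simp_rw [hx]
  rw [integral_const_mul, integral_const_mul, integral_complex_ofReal]
  rw [integral_sub_left_eq_self (fun t => ‖g t‖ ^ 2) volume y, gaborConst]
  push_cast
  ring

end Inversion

/-! ### The reproducing formula for tempered distributions -/

section IteratedFDeriv

variable {α E F : Type*} [MeasurableSpace α] {μ : Measure α} [NormedAddCommGroup E]
  [NormedSpace ℝ E] [NormedAddCommGroup F] [NormedSpace ℝ F] [CompleteSpace F]

/-- Iterated differentiation under the integral sign. -/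
theorem iteratedFDeriv_integral {f : α → E → F} (hf : ∀ a, ContDiff ℝ (⊤ : ℕ∞) (f a))
    (hm : ∀ l y, AEStronglyMeasurable (fun a => iteratedFDeriv ℝ l (f a) y) μ)
    {b : ℕ → α → ℝ} (hb : ∀ l, Integrable (b l) μ)
    (hle : ∀ l a y, ‖iteratedFDeriv ℝ l (f a) y‖ ≤ b l a) (l : ℕ) :
    iteratedFDeriv ℝ l (fun y => ∫ a, f a y ∂μ) = fun y => ∫ a, iteratedFDeriv ℝ l (f a) y ∂μ := by
  have hint : ∀ l y, Integrable (fun a => iteratedFDeriv ℝ l (f a) y) μ := fun l y =>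
    (hb l).mono' (hm l y) (Eventually.of_forall fun a => hle l a y)
  induction l with
  | zero =>
    simp only [iteratedFDeriv_zero_eq_comp]
    funext y
    exact ((continuousMultilinearCurryFin0 ℝ E F).symm.toContinuousLinearEquiv.integral_comp_comm
      fun a => f a y).symm
  | succ l ih =>
    funext y
    set L := (continuousMultilinearCurryLeftEquiv ℝ (fun _ : Fin (l + 1) => E) F) with hL
    have hfd : ∀ a y, fderiv ℝ (iteratedFDeriv ℝ l (f a)) y = L (iteratedFDeriv ℝ (l + 1) (f a) y) := by
      intro a y
      rw [iteratedFDeriv_succ_eq_comp_left, Function.comp_apply, hL,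
        LinearIsometryEquiv.apply_symm_apply]
    have hd : HasFDerivAt (fun y => ∫ a, iteratedFDeriv ℝ l (f a) y ∂μ)
        (∫ a, fderiv ℝ (iteratedFDeriv ℝ l (f a)) y ∂μ) y := by
      refine hasFDerivAt_integral_of_dominated_of_fderiv_le (s := Set.univ) (bound := b (l + 1))
        (F' := fun y a => fderiv ℝ (iteratedFDeriv ℝ l (f a)) y)
        univ_mem (Eventually.of_forall fun y => hm l y) (hint l y) ?_ ?_ (hb _) ?_
      · simp_rw [hfd]
        exact L.continuous.comp_aestronglyMeasurable (hm (l + 1) y)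
      · refine Eventually.of_forall fun a y _ => ?_
        rw [hfd, LinearIsometryEquiv.norm_map]
        exact hle _ a y
      · refine Eventually.of_forall fun a y _ => DifferentiableAt.hasFDerivAt ?_
        exact (hf a).differentiable_iteratedFDeriv (by exact_mod_cast WithTop.coe_lt_top l) y
    rw [iteratedFDeriv_succ_eq_comp_left, ih, Function.comp_apply, hd.fderiv]
    simp_rw [hfd]
    have := LinearIsometry.integral_comp_comm (𝕜 := ℝ) (F := E →L[ℝ] E [×l]→L[ℝ] F) (μ := μ)
      L.toLinearIsometry fun a => iteratedFDeriv ℝ (l + 1) (f a) y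
    refine (congrArg L.symm this).trans ?_
    exact L.symm_apply_apply _

end IteratedFDeriv

/-! ### Tempered distributions as superpositions of time-frequency shifts. -/

section Reproducing

variable {n : ℕ}

local notation "𝔼" => EuclideanSpace ℝ (Fin n)

theorem integrable_norm_gaborPairing_mul_phaseWeight_pow (g φ : 𝓢(𝔼, ℂ)) (N : ℕ) :
    Integrable fun z => ‖gaborPairing g φ z‖ * phaseWeight z ^ N := by
  obtain ⟨p, -, h⟩ := exists_seminorm_norm_gaborPairing_le g (N + (n + 1))
  refine ((integrable_phaseWeight_pow_inv (Nat.lt_succ_self n)).const_mul (p φ)).mono'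
    ((continuous_gaborPairing g φ).norm.mul (continuous_phaseWeight.pow N)).aestronglyMeasurable
    (Eventually.of_forall fun z => ?_)
  have h0 := phaseWeight_pos z
  rw [norm_mul, norm_norm, norm_pow, Real.norm_of_nonneg h0.le]
  calc _ ≤ (p φ * (phaseWeight z ^ (N + (n + 1)))⁻¹) * phaseWeight z ^ N := by gcongr; exact h φ z
    _ = _ := by rw [pow_add]; field_simp

/-- The inversion formula is differentiated under the integral sign, and the seminorm of the
resulting superposition is at most the integral of the seminorms. -/
theorem gaborConst_mul_seminorm_le (g φ : 𝓢(𝔼, ℂ)) {k l N : ℕ} {C : ℝ}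
    (hC : ∀ z, SchwartzMap.seminorm ℂ k l (conjTimeFrequencyShift g z) ≤ C * phaseWeight z ^ N) :
    gaborConst g * SchwartzMap.seminorm ℂ k l φ
      ≤ C * ∫ z, ‖gaborPairing g φ z‖ * phaseWeight z ^ N := by
  -- The seminorms with index $(0,l)$ bound the $l$-th derivatives uniformly in $y$; they supply the
  -- integrable majorants for all orders of differentiation.
  choose M D hD hle using fun l : ℕ => exists_seminorm_conjTimeFrequencyShift_le g
    (SchwartzMap.seminorm ℂ 0 l) (SchwartzMap.continuous_seminorm 0 l)
  set f : 𝔼 × 𝔼 → 𝓢(𝔼, ℂ) := fun z => gaborPairing g φ z • conjTimeFrequencyShift g z with hf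
  have hfd : ∀ l z y, iteratedFDeriv ℝ l (f z) y
      = gaborPairing g φ z • iteratedFDeriv ℝ l (conjTimeFrequencyShift g z) y := fun l z y =>
    iteratedFDeriv_const_smul_apply ((conjTimeFrequencyShift g z).contDiffAt l)
  have hm : ∀ l y, AEStronglyMeasurable (fun z => iteratedFDeriv ℝ l (f z) y)
      (volume : Measure (𝔼 × 𝔼)) := fun l y => by
    simp_rw [hfd]
    exact ((continuous_gaborPairing g φ).smul
      (continuous_iteratedFDeriv_conjTimeFrequencyShift g l y)).aestronglyMeasurable
  have hI := iteratedFDeriv_integral (μ := volume) (f := fun z => ⇑(f z)) (fun z => (f z).smooth ⊤)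
    hm (b := fun l z => D l * (‖gaborPairing g φ z‖ * phaseWeight z ^ M l))
    (fun l => (integrable_norm_gaborPairing_mul_phaseWeight_pow g φ (M l)).const_mul _)
    (fun l z y => ?_) l
  swap
  · rw [hfd, norm_smul]
    calc _ ≤ ‖gaborPairing g φ z‖ * (D l * phaseWeight z ^ M l) := by
          gcongr
          exact (SchwartzMap.norm_iteratedFDeriv_le_seminorm ℂ _ l y).trans (hle l z)
      _ = _ := by ring
  have hκφ : (fun y => ∫ z, f z y) = ⇑((gaborConst g : ℂ) • φ) := by
    funext y
    exact integral_gaborPairing_mul_conjTimeFrequencyShift g φ y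
  rw [hκφ] at hI
  have hκ : 0 ≤ gaborConst g := mul_nonneg (by positivity) (integral_nonneg fun _ => by positivity)
  have e : gaborConst g * SchwartzMap.seminorm ℂ k l φ
      = SchwartzMap.seminorm ℂ k l ((gaborConst g : ℂ) • φ) := by
    rw [map_smul_eq_mul, Complex.norm_real, Real.norm_of_nonneg hκ]
  rw [e]
  have hint := integrable_norm_gaborPairing_mul_phaseWeight_pow g φ N
  have hb : ∀ y z, ‖y‖ ^ k * ‖iteratedFDeriv ℝ l (f z) y‖
      ≤ C * (‖gaborPairing g φ z‖ * phaseWeight z ^ N) := by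
    intro y z
    rw [hfd, norm_smul]
    calc _ = ‖gaborPairing g φ z‖ *
          (‖y‖ ^ k * ‖iteratedFDeriv ℝ l (conjTimeFrequencyShift g z) y‖) := by ring
      _ ≤ ‖gaborPairing g φ z‖ * (C * phaseWeight z ^ N) := by
          refine mul_le_mul_of_nonneg_left ?_ (norm_nonneg _)
          exact (SchwartzMap.le_seminorm ℂ k l _ y).trans (hC z)
      _ = _ := by ring
  have hbound : ∀ y, ‖y‖ ^ k * ‖iteratedFDeriv ℝ l ((gaborConst g : ℂ) • φ : 𝓢(𝔼, ℂ)) y‖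
      ≤ C * ∫ z, ‖gaborPairing g φ z‖ * phaseWeight z ^ N := by
    intro y
    rw [congrFun hI y, ← integral_const_mul]
    calc _ ≤ ‖y‖ ^ k * ∫ z, ‖iteratedFDeriv ℝ l (f z) y‖ := by
          gcongr; exact norm_integral_le_integral_norm _
      _ = ∫ z, ‖y‖ ^ k * ‖iteratedFDeriv ℝ l (f z) y‖ := (integral_const_mul _ _).symm
      _ ≤ _ := integral_mono_of_nonneg (Eventually.of_forall fun z => by positivity)
            (hint.const_mul C) (Eventually.of_forall (hb y))
  exact SchwartzMap.seminorm_le_bound ℂ k l _ (le_trans (by positivity) (hbound 0)) hbound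

/-- Together with the decay estimate, this says that polynomially weighted $L^1$ norms of
`gaborPairing g φ` define the topology of `𝓢`. -/
theorem exists_continuous_seminorm_le_integral_gaborPairing {g : 𝓢(𝔼, ℂ)} (hg : g ≠ 0)
    (p : Seminorm ℂ 𝓢(𝔼, ℂ)) (hp : Continuous p) :
    ∃ (N : ℕ) (C : ℝ), 0 ≤ C ∧ ∀ φ : 𝓢(𝔼, ℂ),
      p φ ≤ C * ∫ z, ‖gaborPairing g φ z‖ * phaseWeight z ^ N := by
  obtain ⟨s, C, -, hC⟩ := Seminorm.bound_of_continuous (schwartz_withSeminorms ℂ 𝔼 ℂ) p hp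
  choose N D hD hle using fun m : ℕ × ℕ => exists_seminorm_conjTimeFrequencyShift_le g
    (SchwartzMap.seminorm ℂ m.1 m.2) (SchwartzMap.continuous_seminorm m.1 m.2)
  have hκ := gaborConst_pos hg
  refine ⟨∑ m ∈ s, N m, C * ∑ m ∈ s, (gaborConst g)⁻¹ * D m, ?_, fun φ => ?_⟩
  · exact mul_nonneg C.2 (Finset.sum_nonneg fun m _ => mul_nonneg (by positivity) (hD m).le)
  calc p φ ≤ (C • s.sup (schwartzSeminormFamily ℂ 𝔼 ℂ)) φ := hC _
    _ ≤ C * ∑ m ∈ s, SchwartzMap.seminorm ℂ m.1 m.2 φ := by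
        rw [smul_apply, NNReal.smul_def, smul_eq_mul]
        gcongr
        refine (Seminorm.finset_sup_le_sum _ _ _).trans_eq ?_
        rw [Seminorm.finsetSum_apply]; rfl
    _ ≤ C * ∑ m ∈ s, ((gaborConst g)⁻¹ * D m) *
          ∫ z, ‖gaborPairing g φ z‖ * phaseWeight z ^ (∑ m ∈ s, N m) := by
        gcongr with m hm
        rw [mul_assoc, le_inv_mul_iff₀ hκ]
        refine gaborConst_mul_seminorm_le g φ fun z => (hle m z).trans ?_
        have := hD m
        gcongr
        · exact one_le_phaseWeight z
        · exact Finset.single_le_sum (fun _ _ => Nat.zero_le _) hm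
    _ = _ := by rw [← Finset.sum_mul, mul_assoc]

theorem memLp_two_phaseWeight_pow_inv :
    MemLp (fun z : 𝔼 × 𝔼 => (phaseWeight z ^ (n + 1))⁻¹) 2 := by
  have hc : Continuous fun z : 𝔼 × 𝔼 => (phaseWeight z ^ (n + 1))⁻¹ :=
    (continuous_phaseWeight.pow _).inv₀ fun z => (pow_pos (phaseWeight_pos z) _).ne'
  rw [memLp_two_iff_integrable_sq hc.aestronglyMeasurable]
  refine (integrable_phaseWeight_pow_inv (Nat.lt_succ_self n)).mono' (hc.pow 2).aestronglyMeasurable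
    (Eventually.of_forall fun z => ?_)
  have h1 : 1 ≤ phaseWeight z ^ (n + 1) := one_le_pow₀ (one_le_phaseWeight z)
  rw [Real.norm_of_nonneg (by positivity), sq]
  exact mul_le_of_le_one_left (by positivity) (inv_le_one_of_one_le₀ h1)

theorem memLp_two_phaseWeight_pow_mul_gaborPairing (g φ : 𝓢(𝔼, ℂ)) (K : ℕ) :
    MemLp (fun z => ((phaseWeight z ^ K : ℝ) : ℂ) * gaborPairing g φ z) 2 := by
  obtain ⟨p, -, h⟩ := exists_seminorm_norm_gaborPairing_le g (K + (n + 1))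
  refine (memLp_two_phaseWeight_pow_inv.const_mul (p φ)).mono'
    (((Complex.continuous_ofReal.comp (continuous_phaseWeight.pow K))).mul
      (continuous_gaborPairing g φ)).aestronglyMeasurable (Eventually.of_forall fun z => ?_)
  have h0 := phaseWeight_pos z
  rw [norm_mul, Complex.norm_real, norm_pow, Real.norm_of_nonneg h0.le]
  calc _ ≤ phaseWeight z ^ K * (p φ * (phaseWeight z ^ (K + (n + 1)))⁻¹) := by gcongr; exact h φ z
    _ = _ := by rw [pow_add]; field_simp

theorem gaborPairing_add (g φ ψ : 𝓢(𝔼, ℂ)) (z : 𝔼 × 𝔼) :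
    gaborPairing g (φ + ψ) z = gaborPairing g φ z + gaborPairing g ψ z := by
  rw [gaborPairing, gaborPairing, gaborPairing,
    ← integral_add (φ.integrable_mul _) (ψ.integrable_mul _)]
  congr 1
  ext y
  exact add_mul _ _ _

theorem gaborPairing_smul (g φ : 𝓢(𝔼, ℂ)) (c : ℂ) (z : 𝔼 × 𝔼) :
    gaborPairing g (c • φ) z = c * gaborPairing g φ z := by
  rw [gaborPairing, gaborPairing, ← integral_const_mul]
  congr 1
  ext y
  exact mul_assoc _ _ _

/-- The map `φ ↦ (1 + |x|)ᴷ (1 + |ξ|)ᴷ ∫ φ(y) g(y - x) exp (i y·ξ) dy` from `𝓢` to `L²`. -/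
noncomputable def weightedGaborPairing (g : 𝓢(𝔼, ℂ)) (K : ℕ) :
    𝓢(𝔼, ℂ) →ₗ[ℂ] Lp ℂ 2 (volume : Measure (𝔼 × 𝔼)) where
  toFun φ := (memLp_two_phaseWeight_pow_mul_gaborPairing g φ K).toLp _
  map_add' φ ψ := by
    rw [← MemLp.toLp_add]
    congr 1
    ext z
    rw [gaborPairing_add, Pi.add_apply, mul_add]
  map_smul' c φ := by
    rw [RingHom.id_apply, ← MemLp.toLp_const_smul]
    congr 1
    ext z
    rw [gaborPairing_smul, Pi.smul_apply, smul_eq_mul, mul_left_comm]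

/-- Cauchy–Schwarz replaces the weighted $L^1$ norm by a weighted $L^2$ norm, at the cost of $n+1$
powers of the weight; in $L^2$, functionals are represented by Riesz's theorem. -/
theorem integral_gaborPairing_mul_le_norm (g φ : 𝓢(𝔼, ℂ)) (N : ℕ) :
    ∫ z, ‖gaborPairing g φ z‖ * phaseWeight z ^ N
      ≤ (∫ z : 𝔼 × 𝔼, ‖(phaseWeight z ^ (n + 1))⁻¹‖ ^ (2 : ℝ)) ^ (1 / (2 : ℝ))
        * ‖weightedGaborPairing g (N + (n + 1)) φ‖ := by
  have hA := memLp_two_phaseWeight_pow_mul_gaborPairing g φ (N + (n + 1))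
  have h1 : ‖weightedGaborPairing g (N + (n + 1)) φ‖ = (∫ z, ‖((phaseWeight z ^ (N + (n + 1)) : ℝ) : ℂ)
      * gaborPairing g φ z‖ ^ (2 : ℝ)) ^ (1 / (2 : ℝ)) := by
    refine (Lp.norm_toLp _ hA).trans ?_
    rw [hA.eLpNorm_eq_integral_rpow_norm (by norm_num) (by norm_num), ENNReal.toReal_ofReal]
    · simp
    · exact Real.rpow_nonneg (integral_nonneg fun _ => by positivity) _
  have h2 : (2 : ℝ).HolderConjugate 2 := Real.holderConjugate_iff.2 ⟨by norm_num, by norm_num⟩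
  have h3 : (2 : ℝ≥0∞) = ENNReal.ofReal 2 := by norm_num
  rw [h1]
  refine le_trans (le_of_eq ?_) (integral_mul_norm_le_Lp_mul_Lq h2
    (f := fun z : 𝔼 × 𝔼 => (phaseWeight z ^ (n + 1))⁻¹)
    (g := fun z => ‖((phaseWeight z ^ (N + (n + 1)) : ℝ) : ℂ) * gaborPairing g φ z‖)
    (by rw [← h3]; exact memLp_two_phaseWeight_pow_inv) (by rw [← h3]; exact hA.norm) |>.trans_eq
      (by simp_rw [norm_norm]))
  congr 1
  ext z
  have h0 := phaseWeight_pos z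
  rw [norm_norm, norm_mul, Complex.norm_real, norm_inv, norm_pow, norm_pow, Real.norm_of_nonneg h0.le,
    pow_add]
  field_simp
  ring

/-- Every tempered distribution is the adjoint short-time Fourier transform of a function. -/
theorem exists_memLp_two_eq_integral_gaborPairing {g : 𝓢(𝔼, ℂ)} (hg : g ≠ 0) (f : 𝓢'(𝔼, ℂ)) :
    ∃ (K : ℕ) (H : 𝔼 × 𝔼 → ℂ), MemLp H 2 ∧
      ∀ φ, f φ = ∫ z, H z * (((phaseWeight z ^ K : ℝ) : ℂ) * gaborPairing g φ z) := by
  let fL : 𝓢(𝔼, ℂ) →ₗ[ℂ] ℂ := ⟨⟨f, map_add f⟩, map_smul f⟩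
  obtain ⟨N, C, hC, hle⟩ := exists_continuous_seminorm_le_integral_gaborPairing hg
    ((normSeminorm ℂ ℂ).comp fL) (continuous_norm.comp (map_continuous f))
  set Λ := weightedGaborPairing g (N + (n + 1)) with hΛ
  set D := (∫ z : 𝔼 × 𝔼, ‖(phaseWeight z ^ (n + 1))⁻¹‖ ^ (2 : ℝ)) ^ (1 / (2 : ℝ)) with hD
  have hbd : ∀ φ, ‖fL φ‖ ≤ (C * D) * ‖Λ φ‖ := fun φ => by
    rw [mul_assoc]
    exact (hle φ).trans (mul_le_mul_of_nonneg_left (integral_gaborPairing_mul_le_norm g φ N) hC)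
  -- By `hbd`, $f$ vanishes on the kernel of $\Lambda$ and is bounded in terms of
  -- $\|\Lambda\varphi\|$. Choosing preimages by a linear section $s$ gives the induced functional
  -- on the range, which Hahn–Banach extends to $L^2$.
  obtain ⟨s, hs⟩ := Λ.rangeRestrict.exists_rightInverse_of_surjective Λ.range_rangeRestrict
  have hs' : ∀ v, Λ (s v) = v := fun v => congrArg Subtype.val (LinearMap.congr_fun hs v)
  have hfs : ∀ φ, fL (s (Λ.rangeRestrict φ)) = fL φ := fun φ => by
    have h := hbd (s (Λ.rangeRestrict φ) - φ)
    have h0 : Λ (s (Λ.rangeRestrict φ) - φ) = 0 := by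
      rw [map_sub, hs']
      exact sub_self _
    rw [h0, norm_zero, mul_zero, norm_le_zero_iff, map_sub, sub_eq_zero] at h
    exact h
  obtain ⟨G, hG, -⟩ := exists_extension_norm_eq (LinearMap.range Λ)
    ((fL ∘ₗ s).mkContinuous (C * D) fun v => by
      have := hbd (s v)
      rw [hs'] at this
      exact this)
  set h := (InnerProductSpace.toDual ℂ _).symm G with hh
  refine ⟨N + (n + 1), fun z => (starRingEnd ℂ) (h z), (Lp.memLp h).star, fun φ => ?_⟩
  have e1 : f φ = G (Λ φ) := (hfs φ).symm.trans (hG (Λ.rangeRestrict φ)).symm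
  rw [e1, ← InnerProductSpace.toDual_symm_apply, L2.inner_def]
  refine integral_congr_ae ?_
  filter_upwards [(memLp_two_phaseWeight_pow_mul_gaborPairing g φ (N + (n + 1))).coeFn_toLp] with z hz
  rw [RCLike.inner_apply, mul_comm]
  congr 1

/-- The inversion formula is paired with a time-frequency shift, and Fubini moves the pairing
inside. -/
theorem gaborConst_mul_gaborPairing (g φ : 𝓢(𝔼, ℂ)) (z : 𝔼 × 𝔼) :
    gaborConst g * gaborPairing g φ z
      = ∫ z', gaborPairing g φ z' * gaborPairing g (conjTimeFrequencyShift g z') z := by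
  have hint : Integrable (Function.uncurry fun (y : 𝔼) (z' : 𝔼 × 𝔼) =>
      gaborPairing g φ z' * conjTimeFrequencyShift g z' y * timeFrequencyShift g z y)
      ((volume : Measure 𝔼).prod volume) := by
    refine (((timeFrequencyShift g z).integrable.norm.mul_prod
      (integrable_gaborPairing g φ).norm).const_mul (SchwartzMap.seminorm ℂ 0 0 g)).mono'
      ?_ (Eventually.of_forall fun w => ?_)
    · have h1 : Continuous fun w : 𝔼 × (𝔼 × 𝔼) => gaborPairing g φ w.2 :=
        (continuous_gaborPairing g φ).comp continuous_snd
      have h2 : Continuous fun w : 𝔼 × (𝔼 × 𝔼) => conjTimeFrequencyShift g w.2 w.1 :=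
        (continuous_conjTimeFrequencyShift_uncurry g).comp
          (f := fun w : 𝔼 × (𝔼 × 𝔼) => (w.2, w.1)) (continuous_snd.prodMk continuous_fst)
      have h3 : Continuous fun w : 𝔼 × (𝔼 × 𝔼) => timeFrequencyShift g z w.1 :=
        (timeFrequencyShift g z).continuous.comp continuous_fst
      exact ((h1.mul h2).mul h3).aestronglyMeasurable
    · rw [Function.uncurry_def]
      simp only [norm_mul, norm_conjTimeFrequencyShift_apply]
      calc _ ≤ ‖gaborPairing g φ w.2‖ * SchwartzMap.seminorm ℂ 0 0 g
            * ‖timeFrequencyShift g z w.1‖ := by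
            gcongr
            exact SchwartzMap.norm_le_seminorm ℂ g _
        _ = _ := by ring
  calc gaborConst g * gaborPairing g φ z
      = ∫ y, ∫ z', gaborPairing g φ z' * conjTimeFrequencyShift g z' y
          * timeFrequencyShift g z y := by
        rw [gaborPairing, ← integral_const_mul]
        congr 1
        ext y
        rw [integral_mul_const, integral_gaborPairing_mul_conjTimeFrequencyShift, mul_assoc]
    _ = ∫ z', ∫ y, gaborPairing g φ z' * conjTimeFrequencyShift g z' y
          * timeFrequencyShift g z y := integral_integral_swap hint
    _ = _ := by
        congr 1
        ext z'
        simp_rw [mul_assoc]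
        rw [integral_const_mul]
        rfl

/-- The reproducing formula for tempered distributions. -/
theorem integrable_and_integral_stft_mul_gaborPairing {g : 𝓢(𝔼, ℂ)} (hg : g ≠ 0) (f : 𝓢'(𝔼, ℂ))
    (φ : 𝓢(𝔼, ℂ)) :
    Integrable (fun z => stft g f z * gaborPairing g φ z) ∧
      ∫ z, stft g f z * gaborPairing g φ z = gaborConst g * f φ := by
  obtain ⟨K, H, hH, hf⟩ := exists_memLp_two_eq_integral_gaborPairing hg f
  set R : 𝔼 × 𝔼 → 𝔼 × 𝔼 → ℂ := fun z z' => gaborPairing g (conjTimeFrequencyShift g z') z with hR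
  obtain ⟨C, hC, hRC⟩ := exists_norm_gaborPairing_conjTimeFrequencyShift_le g (K + (n + 1))
  have hHi : Integrable fun z => ‖H z‖ * (phaseWeight z ^ (n + 1))⁻¹ :=
    hH.norm.integrable_mul memLp_two_phaseWeight_pow_inv
  -- Absolute convergence for Fubini: $K+n+1$ powers of decay of the kernel in $z-z'$ become decay
  -- in $z$ and growth in $z'$. The decay compensates the weight at $z$ and leaves $n+1$ powers to
  -- pair with $H\in L^2$; the growth is absorbed by `gaborPairing g φ z'`.
  have hint : Integrable (Function.uncurry fun (z z' : 𝔼 × 𝔼) =>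
      H z * (((phaseWeight z ^ K : ℝ) : ℂ) * (gaborPairing g φ z' * R z z')))
      ((volume : Measure (𝔼 × 𝔼)).prod volume) := by
    refine ((hHi.mul_prod (integrable_norm_gaborPairing_mul_phaseWeight_pow g φ
      (K + (n + 1)))).const_mul C).mono' ?_ (Eventually.of_forall fun w => ?_)
    · refine AEStronglyMeasurable.mul ?_ (Continuous.aestronglyMeasurable ?_)
      · exact hH.aestronglyMeasurable.comp_fst
      · refine Continuous.mul ?_ (Continuous.mul ?_ ?_)
        · exact Complex.continuous_ofReal.comp ((continuous_phaseWeight.pow K).comp continuous_fst)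
        · exact (continuous_gaborPairing g φ).comp continuous_snd
        · exact continuous_gaborPairing_conjTimeFrequencyShift g
    · obtain ⟨z, z'⟩ := w
      simp only [Function.uncurry_apply_pair, norm_mul, Complex.norm_real, norm_pow]
      have h0 := phaseWeight_pos z
      have h1 := phaseWeight_pos z'
      have h2 := phaseWeight_pos (z - z')
      rw [Real.norm_of_nonneg h0.le]
      have h3 : (phaseWeight (z - z') ^ (K + (n + 1)))⁻¹
          ≤ phaseWeight z' ^ (K + (n + 1)) * (phaseWeight z ^ (K + (n + 1)))⁻¹ := by
        rw [← div_eq_mul_inv, le_div_iff₀ (by positivity), inv_mul_le_iff₀ (by positivity),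
          ← mul_pow, mul_comm]
        exact pow_le_pow_left₀ h0.le (phaseWeight_le_mul_sub z z') _
      calc ‖H z‖ * (phaseWeight z ^ K * (‖gaborPairing g φ z'‖ * ‖R z z'‖))
          ≤ ‖H z‖ * (phaseWeight z ^ K * (‖gaborPairing g φ z'‖ * (C *
            (phaseWeight z' ^ (K + (n + 1)) * (phaseWeight z ^ (K + (n + 1)))⁻¹)))) := by
            gcongr
            exact (hRC z z').trans (by gcongr)
        _ = _ := by
            rw [pow_add (phaseWeight z)]
            field_simp
  have hst : ∀ z', stft g f z' = ∫ z, H z * (((phaseWeight z ^ K : ℝ) : ℂ) * R z z') :=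
    fun z' => hf _
  have e : ∀ z', ∫ z, H z * (((phaseWeight z ^ K : ℝ) : ℂ) * (gaborPairing g φ z' * R z z'))
      = stft g f z' * gaborPairing g φ z' := by
    intro z'
    rw [hst, ← integral_mul_const]
    congr 1
    ext z
    ring
  refine ⟨?_, ?_⟩
  · have := hint.integral_prod_right
    simpa only [Function.uncurry_apply_pair, e] using this
  -- With $V_gf$ expressed through $H$, integrating in $z'$ first leaves the reproducing formula for
  -- the Schwartz function $\varphi$.
  · simp_rw [← e]
    rw [← integral_integral_swap hint, hf φ, ← integral_const_mul]
    congr 1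
    ext z
    simp_rw [integral_const_mul]
    rw [← gaborConst_mul_gaborPairing]
    ring

end Reproducing

/-! ### Moderate weights -/

section Weight

variable {n : ℕ}

local notation "𝔼" => EuclideanSpace ℝ (Fin n)

/-- A positive measurable weight that is moderate with respect to a power of `(1 + |x|)(1 + |ξ|)`. -/
structure IsModerateWeight (w : 𝔼 × 𝔼 → ℝ) (C : ℝ) (N : ℕ) : Prop where
  pos : ∀ z, 0 < w z
  aestronglyMeasurable : AEStronglyMeasurable w volume
  const_pos : 0 < C
  add_le : ∀ z z', w (z + z') ≤ C * phaseWeight z ^ N * w z'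

theorem polyWeight_pos (s : ℝ) (z : 𝔼 × 𝔼) : 0 < polyWeight s z := by
  unfold polyWeight; positivity

theorem polyWeight_le_phaseWeight_pow {s : ℝ} {N : ℕ} (hs : s ≤ N) (z : 𝔼 × 𝔼) :
    polyWeight s z ≤ phaseWeight z ^ N := by
  have h1 : 1 ≤ 1 + ‖z.1‖ ^ 2 + ‖z.2‖ ^ 2 := by nlinarith [sq_nonneg ‖z.1‖, sq_nonneg ‖z.2‖]
  have h2 : 1 + ‖z.1‖ ^ 2 + ‖z.2‖ ^ 2 ≤ phaseWeight z ^ (2 : ℝ) := by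
    rw [Real.rpow_two, phaseWeight]
    have h3 := norm_nonneg z.1
    have h4 := norm_nonneg z.2
    have h5 := mul_nonneg h3 h4
    nlinarith [mul_nonneg h3 h5, mul_nonneg h4 h5, mul_nonneg h5 h5]
  have h0 := phaseWeight_pos z
  calc polyWeight s z ≤ (1 + ‖z.1‖ ^ 2 + ‖z.2‖ ^ 2) ^ ((N : ℝ) / 2) :=
        Real.rpow_le_rpow_of_exponent_le h1 (by linarith)
    _ ≤ (phaseWeight z ^ (2 : ℝ)) ^ ((N : ℝ) / 2) := by gcongr
    _ = phaseWeight z ^ N := by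
        rw [← Real.rpow_mul h0.le, mul_div_cancel₀ _ (by norm_num : (2 : ℝ) ≠ 0), Real.rpow_natCast]

theorem IsWeight.exists_isModerateWeight {w : 𝔼 × 𝔼 → ℝ} (hw : IsWeight w)
    (hm : IsPolynomiallyModerate w) : ∃ C N, IsModerateWeight w C N := by
  obtain ⟨s, C, h⟩ := hm
  obtain ⟨N, hN⟩ := exists_nat_ge s
  -- Moderateness at the origin bounds $w(0)>0$ by a positive multiple of $C$.
  have hC : 0 < C := by
    have := (hw.pos (0 + 0)).trans_le (h 0 0)
    exact pos_of_mul_pos_left this (mul_pos (polyWeight_pos s 0) (hw.pos 0)).le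
  refine ⟨C, N, hw.pos, hw.locallyIntegrable.aestronglyMeasurable, hC, fun z z' => ?_⟩
  rw [mul_assoc]
  refine (h z z').trans ?_
  have := (hw.pos z').le
  gcongr
  exact polyWeight_le_phaseWeight_pow hN z

namespace IsModerateWeight

theorem le_sub {w : 𝔼 × 𝔼 → ℝ} {C : ℝ} {N : ℕ} (hw : IsModerateWeight w C N) (z z' : 𝔼 × 𝔼) :
    w z ≤ C * phaseWeight (z - z') ^ N * w z' := by
  simpa using hw.add_le (z - z') z'

/-- Moderateness applied to $0=(-z)+z$ bounds the weight from below. -/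
theorem inv_le {w : 𝔼 × 𝔼 → ℝ} {C : ℝ} {N : ℕ} (hw : IsModerateWeight w C N) (z : 𝔼 × 𝔼) :
    (w z)⁻¹ ≤ (C / w 0) * phaseWeight z ^ N := by
  have h := hw.le_sub 0 z
  rw [zero_sub, phaseWeight_neg] at h
  have h0 := hw.pos 0
  have hz := hw.pos z
  rw [inv_le_iff_one_le_mul₀ hz, div_mul_eq_mul_div, div_mul_eq_mul_div, one_le_div h0]
  exact h

theorem aestronglyMeasurable_mul {w : 𝔼 × 𝔼 → ℝ} {C : ℝ} {N : ℕ}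
    (hw : IsModerateWeight w C N) {F : 𝔼 × 𝔼 → ℂ}
    (hF : AEStronglyMeasurable F volume) :
    AEStronglyMeasurable (fun z => (w z : ℂ) * F z) volume :=
  (Complex.continuous_ofReal.comp_aestronglyMeasurable hw.aestronglyMeasurable).mul hF

end IsModerateWeight

theorem eLpNorm_const_mul_le_ofReal {X : Type*} [MeasurableSpace X] {μ : Measure X} (p : ℝ≥0∞)
    (c : ℝ) (f : X → ℝ≥0∞) :
    eLpNorm (fun x => ENNReal.ofReal c * f x) p μ ≤ ENNReal.ofReal c * eLpNorm f p μ :=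
  eLpNorm_le_nnreal_smul_eLpNorm_of_ae_le_mul' (c := c.toNNReal)
    (Eventually.of_forall fun x => by simp [ENNReal.ofReal]) p

theorem eLpNorm_one_add_norm_pow_inv_ne_top {p : ℝ≥0∞} (hp : 1 ≤ p) {N : ℕ} (hN : n < N) :
    eLpNorm (fun x : 𝔼 => ENNReal.ofReal ((1 + ‖x‖) ^ N)⁻¹) p volume ≠ ∞ := by
  have h1 : ∀ x : 𝔼, ENNReal.ofReal ((1 + ‖x‖) ^ N)⁻¹ ≤ 1 := fun x => by
    rw [ENNReal.ofReal_le_one]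
    exact inv_le_one_of_one_le₀ (one_le_pow₀ (by linarith [norm_nonneg x]))
  rcases eq_or_ne p ∞ with rfl | hp'
  · refine ne_top_of_le_ne_top ENNReal.one_ne_top ?_
    rw [eLpNorm_exponent_top]
    exact eLpNormEssSup_le_of_ae_enorm_bound (Eventually.of_forall fun x => by simpa using h1 x)
  · rw [eLpNorm_ennreal_eq hp hp']
    refine (ENNReal.rpow_lt_top_of_nonneg (by positivity) ?_).ne
    have hp1 : 1 ≤ p.toReal := ENNReal.toReal_mono hp' hp
    refine ne_top_of_le_ne_top (integrable_one_add_norm_pow_inv hN).lintegral_lt_top.ne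
      (lintegral_mono fun x => ?_)
    exact (ENNReal.rpow_le_rpow_of_exponent_ge (h1 x) hp1).trans_eq (ENNReal.rpow_one _)

theorem mixedLNorm_phaseWeight_pow_inv_ne_top {p q : ℝ≥0∞} (hp : 1 ≤ p) (hq : 1 ≤ q) {N : ℕ}
    (hN : n < N) (c : ℝ) :
    mixedLNorm p q (fun z : 𝔼 × 𝔼 => ENNReal.ofReal (c * (phaseWeight z ^ N)⁻¹)) ≠ ∞ := by
  have h : ∀ z : 𝔼 × 𝔼, ENNReal.ofReal (c * (phaseWeight z ^ N)⁻¹)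
      = ENNReal.ofReal c * (ENNReal.ofReal ((1 + ‖z.2‖) ^ N)⁻¹
        * ENNReal.ofReal ((1 + ‖z.1‖) ^ N)⁻¹) := fun z => by
    rw [phaseWeight, mul_pow, mul_inv, mul_comm ((1 + ‖z.1‖) ^ N)⁻¹,
      ENNReal.ofReal_mul' (by positivity), ENNReal.ofReal_mul (by positivity)]
  simp_rw [mixedLNorm, h]
  set A := eLpNorm (fun x : 𝔼 => ENNReal.ofReal ((1 + ‖x‖) ^ N)⁻¹) p volume with hA
  have h1 : eLpNorm (fun ξ : 𝔼 => eLpNorm (fun x : 𝔼 => ENNReal.ofReal c *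
      (ENNReal.ofReal ((1 + ‖ξ‖) ^ N)⁻¹ * ENNReal.ofReal ((1 + ‖x‖) ^ N)⁻¹)) p volume) q volume
      ≤ eLpNorm (fun ξ : 𝔼 => ENNReal.ofReal (c.toNNReal * A.toNNReal)
        * ENNReal.ofReal ((1 + ‖ξ‖) ^ N)⁻¹) q volume := by
    refine eLpNorm_mono_enorm fun ξ => ?_
    rw [enorm_eq_self, enorm_eq_self]
    refine (eLpNorm_const_mul_le_ofReal p c _).trans ?_
    rw [ENNReal.ofReal_mul (by positivity), ENNReal.ofReal_coe_nnreal, ENNReal.ofReal_coe_nnreal,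
      ENNReal.coe_toNNReal (eLpNorm_one_add_norm_pow_inv_ne_top hp hN), mul_assoc, mul_comm A]
    exact mul_le_mul_right (eLpNorm_const_mul_le_ofReal p _ _) _
  refine ne_top_of_le_ne_top ?_ (h1.trans (eLpNorm_const_mul_le_ofReal q _ _))
  exact ENNReal.mul_ne_top ENNReal.ofReal_ne_top (eLpNorm_one_add_norm_pow_inv_ne_top hq hN)

/-- Hölder's inequality: $1/w$ grows with at most $N$ powers of the phase weight, and the other
$n+1$ powers lie in $L^{p',q'}$. Hence a function with $wF\in L^{p,q}$ has few enough singularities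
and little enough growth to be synthesized into a tempered distribution. -/
theorem IsModerateWeight.exists_lintegral_mul_phaseWeight_le {w : 𝔼 × 𝔼 → ℝ} {C : ℝ} {N : ℕ}
    (hw : IsModerateWeight w C N) {p q : ℝ≥0∞} (hp : 1 ≤ p) (hp' : p ≠ ∞) (hq : 1 ≤ q)
    (hq' : q ≠ ∞) :
    ∃ D : ℝ≥0∞, D ≠ ∞ ∧ ∀ F : 𝔼 × 𝔼 → ℂ, AEStronglyMeasurable F volume →
      ∫⁻ z, ‖F z‖ₑ * ENNReal.ofReal (phaseWeight z ^ (N + (n + 1)))⁻¹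
        ≤ mixedENorm p q (fun z => (w z : ℂ) * F z) * D := by
  refine ⟨_, mixedLNorm_phaseWeight_pow_inv_ne_top (p := p.conjExponent) (q := q.conjExponent)
    (N := n + 1) (by simp [ENNReal.conjExponent]) (by simp [ENNReal.conjExponent])
    (Nat.lt_succ_self n) (C / w 0), fun F hF => ?_⟩
  rw [mixedENorm_eq_mixedLNorm]
  refine le_trans (lintegral_mono fun z => ?_) (lintegral_mul_le_mixedLNorm_mul hp hp' hq hq'
    (hw.aestronglyMeasurable_mul hF).enorm ?_)
  · have hz := hw.pos z
    have h0 := phaseWeight_pos z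
    rw [enorm_mul, mul_comm _ ‖F z‖ₑ, mul_assoc]
    refine mul_le_mul_right ?_ _
    rw [← ofReal_norm, Complex.norm_real, Real.norm_of_nonneg hz.le,
      ← ENNReal.ofReal_mul hz.le]
    refine ENNReal.ofReal_le_ofReal ?_
    have := hw.inv_le z
    rw [inv_le_iff_one_le_mul₀ hz] at this
    calc (phaseWeight z ^ (N + (n + 1)))⁻¹ = 1 * (phaseWeight z ^ (N + (n + 1)))⁻¹ := (one_mul _).symm
      _ ≤ (C / w 0 * phaseWeight z ^ N * w z) * (phaseWeight z ^ (N + (n + 1)))⁻¹ := by gcongr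
      _ = _ := by rw [pow_add]; field_simp
  · exact (Continuous.measurable (by
      exact (continuous_const.mul ((continuous_phaseWeight.pow _).inv₀
        fun z => (pow_pos (phaseWeight_pos z) _).ne')))).ennreal_ofReal.aemeasurable

end Weight

/-! ### Continuity of the short-time Fourier transform of a tempered distribution. -/

section StftContinuous

variable {n : ℕ}

local notation "𝔼" => EuclideanSpace ℝ (Fin n)

theorem phaseWeight_pow_inv_sub_le (z z' : 𝔼 × 𝔼) (N : ℕ) :
    (phaseWeight (z - z') ^ N)⁻¹ ≤ phaseWeight z' ^ N * (phaseWeight z ^ N)⁻¹ := by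
  have h0 := phaseWeight_pos z
  have h2 := phaseWeight_pos (z - z')
  rw [← div_eq_mul_inv, le_div_iff₀ (by positivity), inv_mul_le_iff₀ (by positivity),
    ← mul_pow, mul_comm]
  exact pow_le_pow_left₀ h0.le (phaseWeight_le_mul_sub z z') _

/-- The representation of $f$ by an $L^2$ function reduces continuity to dominated convergence; the
decay of the kernel gives a majorant that is uniform for $z'$ near a given point. -/
theorem continuous_stft {g : 𝓢(𝔼, ℂ)} (hg : g ≠ 0) (f : 𝓢'(𝔼, ℂ)) : Continuous (stft g f) := by
  obtain ⟨K, H, hH, hf⟩ := exists_memLp_two_eq_integral_gaborPairing hg f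
  obtain ⟨C, hC, hRC⟩ := exists_norm_gaborPairing_conjTimeFrequencyShift_le g (K + (n + 1))
  have hHi : Integrable fun z => ‖H z‖ * (phaseWeight z ^ (n + 1))⁻¹ :=
    hH.norm.integrable_mul memLp_two_phaseWeight_pow_inv
  have hst : stft g f = fun z' => ∫ z, H z * (((phaseWeight z ^ K : ℝ) : ℂ)
      * gaborPairing g (conjTimeFrequencyShift g z') z) := funext fun z' => hf _
  rw [hst]
  refine continuous_iff_continuousAt.2 fun a => ?_
  have hnear : ∀ᶠ z' in 𝓝 a, phaseWeight z' < phaseWeight a + 1 :=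
    continuous_phaseWeight.continuousAt.eventually_lt_const (lt_add_one _)
  refine continuousAt_of_dominated (bound := fun z => (C * (phaseWeight a + 1) ^ (K + (n + 1))) *
    (‖H z‖ * (phaseWeight z ^ (n + 1))⁻¹)) ?_ ?_ (hHi.const_mul _) ?_
  · refine Eventually.of_forall fun z' => hH.aestronglyMeasurable.mul ?_
    exact ((Complex.continuous_ofReal.comp (continuous_phaseWeight.pow K)).mul
      (continuous_gaborPairing g _)).aestronglyMeasurable
  · filter_upwards [hnear] with z' hz'
    refine Eventually.of_forall fun z => ?_
    have h0 := phaseWeight_pos z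
    have h1 := phaseWeight_pos z'
    rw [norm_mul, norm_mul, Complex.norm_real, norm_pow, Real.norm_of_nonneg h0.le]
    calc ‖H z‖ * (phaseWeight z ^ K * ‖gaborPairing g (conjTimeFrequencyShift g z') z‖)
        ≤ ‖H z‖ * (phaseWeight z ^ K * (C *
          ((phaseWeight a + 1) ^ (K + (n + 1)) * (phaseWeight z ^ (K + (n + 1)))⁻¹))) := by
          gcongr
          refine (hRC z z').trans ?_
          gcongr
          refine (phaseWeight_pow_inv_sub_le z z' _).trans ?_
          gcongr
      _ = _ := by
          rw [pow_add (phaseWeight z)]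
          field_simp
  · refine Eventually.of_forall fun z => Continuous.continuousAt ?_
    have : Continuous fun z' => gaborPairing g (conjTimeFrequencyShift g z') z :=
      (continuous_gaborPairing_conjTimeFrequencyShift g).comp (f := fun z' => (z, z'))
        (continuous_const.prodMk continuous_id)
    exact continuous_const.mul (continuous_const.mul this)

end StftContinuous

/-! ### Synthesis operators on modulation spaces -/

theorem LinearMap.exists_continuousLinearMap_of_enorm_le {E F : Type*} [SeminormedAddCommGroup E]
    [NormedSpace ℂ E] [SeminormedAddCommGroup F] [NormedSpace ℂ F] (f : E →ₗ[ℂ] F) {K : ℝ≥0∞}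
    (hK : K ≠ ∞) (h : ∀ x, ‖f x‖ₑ ≤ K * ‖x‖ₑ) :
    ∃ T : E →L[ℂ] F, (∀ x, T x = f x) ∧ ‖T‖ₑ ≤ K := by
  have hb : ∀ x, ‖f x‖ ≤ K.toReal * ‖x‖ := fun x => by
    have := ENNReal.toReal_mono (ENNReal.mul_ne_top hK enorm_ne_top) (h x)
    rwa [ENNReal.toReal_mul, toReal_enorm, toReal_enorm] at this
  refine ⟨f.mkContinuous _ hb, fun _ => rfl, ?_⟩
  rw [← ofReal_norm]
  exact (ENNReal.ofReal_le_ofReal (f.mkContinuous_norm_le ENNReal.toReal_nonneg hb)).trans_eq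
    (ENNReal.ofReal_toReal hK)

section Synthesis

variable {n : ℕ}

local notation "𝔼" => EuclideanSpace ℝ (Fin n)

/-- Since `gaborPairing g φ` decays like the $M$-th inverse power of the phase weight times a
continuous seminorm of $\varphi$, the integral converges absolutely and is continuous in $\varphi$.
-/
theorem exists_tempered_eq_integral_mul_gaborPairing (g : 𝓢(𝔼, ℂ)) {M : ℕ} {F : 𝔼 × 𝔼 → ℂ}
    (hF : AEStronglyMeasurable F volume)
    (hM : ∫⁻ z, ‖F z‖ₑ * ENNReal.ofReal (phaseWeight z ^ M)⁻¹ ≠ ∞) :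
    ∃ f : 𝓢'(𝔼, ℂ), ∀ φ, Integrable (fun z => F z * gaborPairing g φ z) ∧
      f φ = ∫ z, F z * gaborPairing g φ z := by
  obtain ⟨p, hp, hpφ⟩ := exists_seminorm_norm_gaborPairing_le g M
  have hc : Continuous fun z : 𝔼 × 𝔼 => (phaseWeight z ^ M)⁻¹ :=
    (continuous_phaseWeight.pow _).inv₀ fun z => (pow_pos (phaseWeight_pos z) _).ne'
  have hFi : Integrable fun z => ‖F z‖ * (phaseWeight z ^ M)⁻¹ := by
    refine ⟨hF.norm.mul hc.aestronglyMeasurable, ?_⟩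
    refine lt_of_le_of_lt (lintegral_mono fun z => ?_) hM.lt_top
    have := phaseWeight_pos z
    rw [enorm_mul, enorm_norm, Real.enorm_of_nonneg (by positivity)]
  have hle : ∀ φ z, ‖F z * gaborPairing g φ z‖ ≤ p φ * (‖F z‖ * (phaseWeight z ^ M)⁻¹) :=
    fun φ z => by
      rw [norm_mul, mul_left_comm]
      exact mul_le_mul_of_nonneg_left (hpφ φ z) (norm_nonneg _)
  have hint : ∀ φ, Integrable (fun z => F z * gaborPairing g φ z) := fun φ =>
    (hFi.const_mul (p φ)).mono' (hF.mul (continuous_gaborPairing g φ).aestronglyMeasurable)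
      (Eventually.of_forall (hle φ))
  let L : 𝓢(𝔼, ℂ) →ₗ[ℂ] ℂ :=
    { toFun := fun φ => ∫ z, F z * gaborPairing g φ z
      map_add' := fun φ ψ => by
        rw [← integral_add (hint φ) (hint ψ)]
        simp_rw [gaborPairing_add, mul_add]
      map_smul' := fun c φ => by
        rw [RingHom.id_apply, smul_eq_mul, ← integral_const_mul]
        simp_rw [gaborPairing_smul, mul_left_comm] }
  have hL : ∀ φ, ‖L φ‖ ≤ p φ * ∫ z, ‖F z‖ * (phaseWeight z ^ M)⁻¹ := fun φ => by
    rw [← integral_const_mul]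
    exact norm_integral_le_of_norm_le (hFi.const_mul _) (Eventually.of_forall (hle φ))
  have hcont : Continuous L := by
    refine continuous_of_continuousAt_zero L ?_
    rw [ContinuousAt, map_zero]
    refine squeeze_zero_norm hL ?_
    have : Tendsto (fun φ => p φ * ∫ z, ‖F z‖ * (phaseWeight z ^ M)⁻¹) (𝓝 0)
        (𝓝 (p 0 * ∫ z, ‖F z‖ * (phaseWeight z ^ M)⁻¹)) := (hp.mul continuous_const).tendsto 0
    rwa [map_zero, zero_mul] at this
  exact ⟨⟨L, hcont⟩, fun φ => ⟨hint φ, rfl⟩⟩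

/-- Passing from $w(z')$ to $w(z)$ costs $N$ powers of the phase weight of $z'-z$; the kernel still
has $n+1$ powers to spare, enough for integrability. -/
theorem IsModerateWeight.exists_mul_norm_gaborPairing_le {w : 𝔼 × 𝔼 → ℝ} {C : ℝ} {N : ℕ}
    (hw : IsModerateWeight w C N) (g : 𝓢(𝔼, ℂ)) :
    ∃ C' : ℝ, 0 < C' ∧ ∀ z z' : 𝔼 × 𝔼, w z' * ‖gaborPairing g (conjTimeFrequencyShift g z') z‖
      ≤ (C' * (phaseWeight (z' - z) ^ (n + 1))⁻¹) * w z := by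
  obtain ⟨C', hC', hR⟩ := exists_norm_gaborPairing_conjTimeFrequencyShift_le g (N + (n + 1))
  have h3 := hw.const_pos
  refine ⟨C * C', by positivity, fun z z' => ?_⟩
  have h0 := phaseWeight_pos (z' - z)
  have h1 := hw.pos z
  have h2 := hw.pos z'
  calc w z' * ‖gaborPairing g (conjTimeFrequencyShift g z') z‖
      ≤ (C * phaseWeight (z' - z) ^ N * w z) *
        (C' * (phaseWeight (z' - z) ^ (N + (n + 1)))⁻¹) := by
        refine mul_le_mul (hw.le_sub z' z) ?_ (norm_nonneg _) (by positivity)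
        rw [phaseWeight_sub_comm]
        exact hR z z'
    _ = _ := by
        rw [pow_add]
        field_simp

theorem continuous_const_mul_phaseWeight_pow_inv (c : ℝ) (N : ℕ) :
    Continuous fun z : 𝔼 × 𝔼 => c * (phaseWeight z ^ N)⁻¹ :=
  continuous_const.mul ((continuous_phaseWeight.pow _).inv₀
    fun z => (pow_pos (phaseWeight_pos z) _).ne')

/-- The transform of a synthesized distribution is $F$ integrated against the reproducing kernel.
After weighting it is dominated by the convolution of $w|F|$ with an integrable kernel, so Young's
inequality applies. -/
theorem IsModerateWeight.exists_mixedENorm_stft_le {w : 𝔼 × 𝔼 → ℝ} {C : ℝ} {N : ℕ}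
    (hw : IsModerateWeight w C N) (g : 𝓢(𝔼, ℂ)) {p q : ℝ≥0∞} (hp : 1 ≤ p) (hp' : p ≠ ∞)
    (hq : 1 ≤ q) (hq' : q ≠ ∞) :
    ∃ D : ℝ≥0∞, D ≠ ∞ ∧ ∀ F : 𝔼 × 𝔼 → ℂ, AEStronglyMeasurable F volume → ∀ f : 𝓢'(𝔼, ℂ),
      (∀ φ, f φ = ∫ z, F z * gaborPairing g φ z) →
        modulationENorm g w p q f ≤ D * mixedENorm p q (fun z => (w z : ℂ) * F z) := by
  obtain ⟨C', hC', hR⟩ := hw.exists_mul_norm_gaborPairing_le g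
  set k : 𝔼 × 𝔼 → ℝ≥0∞ := fun z => ENNReal.ofReal (C' * (phaseWeight z ^ (n + 1))⁻¹) with hk
  have hkm : Measurable k :=
    (continuous_const_mul_phaseWeight_pow_inv C' (n + 1)).measurable.ennreal_ofReal
  refine ⟨∫⁻ z, k z, ((integrable_phaseWeight_pow_inv (Nat.lt_succ_self n)).const_mul
    _).lintegral_lt_top.ne, fun F hF f hf => ?_⟩
  rw [modulationENorm, mixedENorm_eq_mixedLNorm, mixedENorm_eq_mixedLNorm]
  refine le_trans (mixedLNorm_mono fun z' => ?_) (mixedLNorm_convolution_le hp hp' hq hq' hkm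
    (fun z => ENNReal.ofReal_ne_top) (hw.aestronglyMeasurable_mul hF).enorm)
  have e : ∀ z, ‖((w z : ℝ) : ℂ)‖ₑ = ENNReal.ofReal (w z) := fun z => by
    rw [← ofReal_norm, Complex.norm_real, Real.norm_of_nonneg (hw.pos z).le]
  rw [stft, hf, enorm_mul]
  calc _ ≤ ‖(w z' : ℂ)‖ₑ * ∫⁻ z, ‖F z * gaborPairing g (conjTimeFrequencyShift g z') z‖ₑ := by
        gcongr
        exact enorm_integral_le_lintegral_enorm _
    _ = ∫⁻ z, ‖(w z' : ℂ)‖ₑ * ‖F z * gaborPairing g (conjTimeFrequencyShift g z') z‖ₑ :=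
        (lintegral_const_mul' _ _ enorm_ne_top).symm
    _ ≤ _ := by
        refine lintegral_mono fun z => ?_
        rw [enorm_mul, enorm_mul, mul_left_comm, ← mul_assoc (k _), mul_comm _ ‖F z‖ₑ]
        refine mul_le_mul_right ?_ _
        rw [e, e, hk, ← ofReal_norm, ← ENNReal.ofReal_mul (hw.pos z').le,
          ← ENNReal.ofReal_mul' (hw.pos z).le]
        exact ENNReal.ofReal_le_ofReal (hR z z')

end Synthesis

namespace ModulationSpace

variable {n : ℕ} {g : 𝓢(EuclideanSpace ℝ (Fin n), ℂ)}
  {w : EuclideanSpace ℝ (Fin n) × EuclideanSpace ℝ (Fin n) → ℝ} {p q : ℝ≥0∞}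
  [hp : Fact (1 ≤ p)] [hp' : Fact (p ≠ ∞)] [hq : Fact (1 ≤ q)] [hq' : Fact (q ≠ ∞)]
  {C : ℝ} {N : ℕ}

theorem toDistribution_injective :
    Function.Injective (toDistribution (g := g) (w := w) (p := p) (q := q)) :=
  Subtype.val_injective

theorem enorm_eq (a : ModulationSpace g w p q) :
    ‖a‖ₑ = modulationENorm g w p q (toDistribution a) := by
  rw [← ofReal_norm, norm_def, ENNReal.ofReal_toReal (modulationENorm_lt_top a).ne]

theorem exists_toDistribution_eq (hg : g ≠ 0) (hw : IsModerateWeight w C N)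
    {f : 𝓢'(EuclideanSpace ℝ (Fin n), ℂ)} (h : modulationENorm g w p q f ≠ ∞) :
    ∃ a : ModulationSpace g w p q, toDistribution a = f :=
  ⟨⟨f, hw.aestronglyMeasurable_mul (continuous_stft hg f).aestronglyMeasurable, h.lt_top⟩, rfl⟩

/-- The synthesis of elements of `M_w^{p,q}` from functions with `w F ∈ L^{p,q}`. -/
theorem exists_synthesis (hg : g ≠ 0) (hw : IsModerateWeight w C N) :
    ∃ D : ℝ≥0∞, D ≠ ∞ ∧
      ∀ F : EuclideanSpace ℝ (Fin n) × EuclideanSpace ℝ (Fin n) → ℂ,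
        AEStronglyMeasurable F volume → mixedENorm p q (fun z => (w z : ℂ) * F z) ≠ ∞ →
        ∃ a : ModulationSpace g w p q,
          (∀ φ, Integrable (fun z => F z * gaborPairing g φ z) ∧
            toDistribution a φ = ∫ z, F z * gaborPairing g φ z) ∧
          ‖a‖ₑ ≤ D * mixedENorm p q (fun z => (w z : ℂ) * F z) := by
  obtain ⟨D, hD, h⟩ := hw.exists_mixedENorm_stft_le g hp.out hp'.out hq.out hq'.out
  obtain ⟨D', hD', h'⟩ := hw.exists_lintegral_mul_phaseWeight_le hp.out hp'.out hq.out hq'.out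
  refine ⟨D, hD, fun F hF hfin => ?_⟩
  obtain ⟨f, hf⟩ := exists_tempered_eq_integral_mul_gaborPairing g hF
    (ne_top_of_le_ne_top (ENNReal.mul_ne_top hfin hD') (h' F hF))
  have hle := h F hF f fun φ => (hf φ).2
  obtain ⟨a, rfl⟩ := exists_toDistribution_eq hg hw
    (ne_top_of_le_ne_top (ENNReal.mul_ne_top hD hfin) hle)
  exact ⟨a, hf, (enorm_eq a).trans_le hle⟩

/-- The reproducing formula expresses the value at $\varphi$ as an integral of the transform against
a rapidly decaying function, to which the weighted Hölder bound applies. -/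
theorem exists_enorm_apply_le (hg : g ≠ 0) (hw : IsModerateWeight w C N)
    (φ : 𝓢(EuclideanSpace ℝ (Fin n), ℂ)) :
    ∃ K : ℝ≥0∞, K ≠ ∞ ∧ ∀ a : ModulationSpace g w p q, ‖toDistribution a φ‖ₑ ≤ K * ‖a‖ₑ := by
  obtain ⟨D, hD, h⟩ := hw.exists_lintegral_mul_phaseWeight_le hp.out hp'.out hq.out hq'.out
  obtain ⟨s, -, hs⟩ := exists_seminorm_norm_gaborPairing_le g (N + (n + 1))
  have hκ := gaborConst_pos hg
  refine ⟨ENNReal.ofReal (gaborConst g)⁻¹ * (ENNReal.ofReal (s φ) * D),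
    ENNReal.mul_ne_top ENNReal.ofReal_ne_top (ENNReal.mul_ne_top ENNReal.ofReal_ne_top hD),
    fun a => ?_⟩
  have hm := (continuous_stft hg (toDistribution a)).aestronglyMeasurable (μ := volume)
  have e : toDistribution a φ = ((gaborConst g)⁻¹ : ℝ) *
      ∫ z, stft g (toDistribution a) z * gaborPairing g φ z := by
    rw [(integrable_and_integral_stft_mul_gaborPairing hg _ φ).2]
    push_cast
    rw [inv_mul_cancel_left₀ (by exact_mod_cast hκ.ne')]
  rw [e, enorm_mul, ← ofReal_norm, Complex.norm_real, Real.norm_of_nonneg (by positivity), mul_assoc]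
  refine mul_le_mul_right ?_ _
  calc _ ≤ ∫⁻ z, ‖stft g (toDistribution a) z * gaborPairing g φ z‖ₑ :=
        enorm_integral_le_lintegral_enorm _
    _ ≤ ∫⁻ z, ENNReal.ofReal (s φ) * (‖stft g (toDistribution a) z‖ₑ
          * ENNReal.ofReal (phaseWeight z ^ (N + (n + 1)))⁻¹) := by
        refine lintegral_mono fun z => ?_
        rw [enorm_mul, mul_left_comm]
        refine mul_le_mul_right ?_ _
        rw [← ofReal_norm, ← ENNReal.ofReal_mul (apply_nonneg s φ)]
        exact ENNReal.ofReal_le_ofReal (hs φ z)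
    _ = ENNReal.ofReal (s φ) * ∫⁻ z, (‖stft g (toDistribution a) z‖ₑ
          * ENNReal.ofReal (phaseWeight z ^ (N + (n + 1)))⁻¹) :=
        lintegral_const_mul' _ _ ENNReal.ofReal_ne_top
    _ ≤ _ := by
        rw [enorm_eq, mul_assoc]
        refine mul_le_mul_right ((h _ hm).trans_eq (mul_comm _ _)) _

/-- The evaluation at a test function is continuous on `M_w^{p,q}`. -/
theorem exists_clm_eq_apply (hg : g ≠ 0) (hw : IsModerateWeight w C N)
    (φ : 𝓢(EuclideanSpace ℝ (Fin n), ℂ)) :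
    ∃ e : ModulationSpace g w p q →L[ℂ] ℂ, ∀ a, e a = toDistribution a φ := by
  obtain ⟨K, hK, h⟩ := exists_enorm_apply_le (p := p) (q := q) hg hw φ
  let L : ModulationSpace g w p q →ₗ[ℂ] ℂ :=
    { toFun := fun a => toDistribution a φ
      map_add' := fun _ _ => rfl
      map_smul' := fun _ _ => rfl }
  obtain ⟨T, hT, -⟩ := LinearMap.exists_continuousLinearMap_of_enorm_le L hK h
  exact ⟨T, hT⟩

/-- For a nonzero window, the modulation norm is definite. -/
noncomputable abbrev normedAddCommGroup (hg : g ≠ 0) (hw : IsModerateWeight w C N) :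
    NormedAddCommGroup (ModulationSpace g w p q) :=
  NormedAddCommGroup.ofSeparation fun a ha => by
    refine toDistribution_injective ?_
    rw [map_zero]
    ext φ
    obtain ⟨K, -, h⟩ := exists_enorm_apply_le (p := p) (q := q) hg hw φ
    have h0 := h a
    rw [← ofReal_norm a, ha, ENNReal.ofReal_zero, mul_zero, nonpos_iff_eq_zero, enorm_eq_zero] at h0
    exact h0

end ModulationSpace

/-! ### Completeness and the time-frequency shifts -/

namespace ModulationSpace

variable {n : ℕ} {g : 𝓢(EuclideanSpace ℝ (Fin n), ℂ)}
  {w : EuclideanSpace ℝ (Fin n) × EuclideanSpace ℝ (Fin n) → ℝ} {p q : ℝ≥0∞}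
  [hp : Fact (1 ≤ p)] [hp' : Fact (p ≠ ∞)] [hq : Fact (1 ≤ q)] [hq' : Fact (q ≠ ∞)]
  {C : ℝ} {N : ℕ}

local notation "𝔼" => EuclideanSpace ℝ (Fin n)

theorem integral_stft_mul_gaborPairing (hg : g ≠ 0) (a : ModulationSpace g w p q) (φ : 𝓢(𝔼, ℂ)) :
    ∫ z, stft g (toDistribution a) z * gaborPairing g φ z
      = toDistribution ((gaborConst g : ℂ) • a) φ := by
  rw [(integrable_and_integral_stft_mul_gaborPairing hg _ φ).2, map_smul]
  rfl

/-- The transforms of an absolutely summable series converge almost everywhere to a function in the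
weighted $L^{p,q}$. Synthesis of this function, divided by $\kappa$, is the sum of the series,
because the synthesized tails tend to $0$ in norm. -/
theorem completeSpace (hg : g ≠ 0) (hw : IsModerateWeight w C N) :
    CompleteSpace (ModulationSpace g w p q) := by
  let _ := normedAddCommGroup (p := p) (q := q) hg hw
  refine NormedAddCommGroup.completeSpace_of_summable_imp_tendsto
    (E := ModulationSpace g w p q) fun u hu => ?_
  have hu' : ∑' j, ‖u j‖ₑ ≠ ∞ := tsum_enorm_ne_top_iff_summable_norm.2 hu
  set V : ℕ → 𝔼 × 𝔼 → ℂ := fun j => stft g (toDistribution (u j)) with hV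
  have hVc : ∀ j, Continuous (V j) := fun j => continuous_stft hg _
  set G : ℕ → 𝔼 × 𝔼 → ℝ≥0∞ := fun j z => ‖(w z : ℂ) * V j z‖ₑ with hG
  have hGm : ∀ j, AEMeasurable (G j) volume := fun j =>
    (hw.aestronglyMeasurable_mul (hVc j).aestronglyMeasurable).enorm
  have hGu : ∀ j, mixedLNorm p q (G j) = ‖u j‖ₑ := fun j => by
    rw [enorm_eq, modulationENorm, mixedENorm_eq_mixedLNorm]
  have htail : ∀ m, mixedLNorm p q (fun z => ∑' j, G (j + m) z) ≤ ∑' j, ‖u (j + m)‖ₑ := fun m => by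
    refine (mixedLNorm_tsum_le hp.out hp'.out hq.out hq'.out fun j => hGm (j + m)).trans_eq ?_
    exact tsum_congr fun j => hGu _
  have htail_top : ∀ m, ∑' j, ‖u (j + m)‖ₑ ≠ ∞ := fun m =>
    ne_top_of_le_ne_top hu' (ENNReal.tsum_comp_le_tsum_of_injective (add_left_injective m) _)
  have hae : ∀ᵐ z, ∑' j, G j z < ∞ := by
    refine ae_lt_top_of_mixedLNorm_ne_top hp.out hp'.out hq.out hq'.out
      (AEMeasurable.tsum hGm) ?_
    exact ne_top_of_le_ne_top (htail_top 0) (htail 0)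
  have hsum : ∀ᵐ z, Summable fun j => V j z := by
    filter_upwards [hae] with z hz
    have h1 := Summable.of_enorm hz.ne
    have h2 : (w z : ℂ) ≠ 0 := by exact_mod_cast (hw.pos z).ne'
    exact (summable_mul_left_iff h2).1 h1
  set F : ℕ → 𝔼 × 𝔼 → ℂ := fun m z => ∑' j, V (j + m) z with hF
  have hFeq : ∀ m, F m =ᵐ[volume] fun z => F 0 z - ∑ j ∈ Finset.range m, V j z := fun m => by
    filter_upwards [hsum] with z hz
    exact eq_sub_of_add_eq' (hz.sum_add_tsum_nat_add m)
  have hFm0 : AEStronglyMeasurable (F 0) volume := by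
    refine aestronglyMeasurable_of_tendsto_ae atTop
      (f := fun (m : ℕ) z => ∑ j ∈ Finset.range m, V j z) (fun m => ?_) ?_
    · exact (continuous_finsetSum _ fun j _ => hVc j).aestronglyMeasurable
    · filter_upwards [hsum] with z hz
      exact hz.hasSum.tendsto_sum_nat
  have hFm : ∀ m, AEStronglyMeasurable (F m) volume := fun m =>
    (hFm0.sub (continuous_finsetSum _ fun j _ => hVc j).aestronglyMeasurable).congr (hFeq m).symm
  have hFle : ∀ m, mixedENorm p q (fun z => (w z : ℂ) * F m z) ≤ ∑' j, ‖u (j + m)‖ₑ := fun m => by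
    rw [mixedENorm_eq_mixedLNorm]
    refine le_trans (mixedLNorm_mono fun z => ?_) (htail m)
    rw [hF, ← tsum_mul_left]
    exact enorm_tsum_le_tsum_enorm
  obtain ⟨D, hD, hsyn⟩ := exists_synthesis (p := p) (q := q) hg hw
  choose a ha haD using fun m => hsyn (F m) (hFm m) (ne_top_of_le_ne_top (htail_top m) (hFle m))
  set κ : ℂ := (gaborConst g : ℂ) with hκ
  have hκ0 : κ ≠ 0 :=
    Complex.ofReal_ne_zero.2 (gaborConst_pos hg).ne'
  -- The synthesis of the transform of $u_j$ is $\kappa u_j$ by the reproducing formula; removing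
  -- finitely many terms from the full sum of transforms therefore subtracts $\kappa$ times a
  -- partial sum.
  have ham : ∀ m, a m = a 0 - κ • ∑ j ∈ Finset.range m, u j := fun m => by
    refine toDistribution_injective ?_
    ext φ
    have e1 : toDistribution (a 0 - κ • ∑ j ∈ Finset.range m, u j) φ = toDistribution (a 0) φ
        - ∑ j ∈ Finset.range m, toDistribution (κ • u j) φ := by
      rw [map_sub, Finset.smul_sum, map_sum]
      change toDistribution (a 0) φ - (∑ j ∈ Finset.range m, toDistribution (κ • u j)) φ = _
      congr 1
      induction Finset.range m using Finset.induction_on with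
      | empty => rfl
      | insert i s hi ih => rw [Finset.sum_insert hi, Finset.sum_insert hi, ← ih]; rfl
    rw [e1, (ha m φ).2, (ha 0 φ).2]
    simp_rw [hκ, ← integral_stft_mul_gaborPairing hg]
    rw [← integral_finsetSum _ fun j _ =>
        (integrable_and_integral_stft_mul_gaborPairing hg (toDistribution (u j)) φ).1,
      ← integral_sub (ha 0 φ).1 (integrable_finsetSum _ fun j _ =>
        (integrable_and_integral_stft_mul_gaborPairing hg (toDistribution (u j)) φ).1)]
    refine integral_congr_ae ?_
    filter_upwards [hFeq m] with z hz
    rw [hz, sub_mul, Finset.sum_mul]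
  have hlim : Tendsto a atTop (𝓝 0) := by
    rw [tendsto_iff_enorm_sub_tendsto_zero]
    simp only [sub_zero]
    have h1 : Tendsto (fun m => D * ∑' j, ‖u (j + m)‖ₑ) atTop (𝓝 (D * 0)) :=
      ENNReal.Tendsto.const_mul (ENNReal.tendsto_sum_nat_add _ hu') (Or.inr hD)
    rw [mul_zero] at h1
    exact tendsto_of_tendsto_of_tendsto_of_le_of_le tendsto_const_nhds h1 (fun _ => zero_le)
      fun m => (haD m).trans (mul_le_mul_right (hFle m) _)
  refine ⟨κ⁻¹ • a 0, ?_⟩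
  have h2 : ∀ m, ∑ j ∈ Finset.range m, u j = κ⁻¹ • a 0 - κ⁻¹ • a m := fun m => by
    rw [ham m, smul_sub, inv_smul_smul₀ hκ0, sub_sub_cancel]
  simp_rw [h2]
  have h3 := (hlim.const_smul κ⁻¹).const_sub (κ⁻¹ • a 0)
  rwa [smul_zero, sub_zero] at h3

/-- The time-frequency shifts of the window form a continuous family in `M_w^{p,q}`. -/
theorem exists_continuous_timeFrequencyShift (hg : g ≠ 0) (hw : IsModerateWeight w C N) :
    ∃ π : 𝔼 × 𝔼 → ModulationSpace g w p q, Continuous π ∧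
      (∀ z φ, toDistribution (π z) φ = gaborPairing g φ z) ∧
      ∀ z, ∃ f : Lp ℂ 2 (volume : Measure 𝔼), toDistribution (π z) = Lp.toTemperedDistribution f := by
  obtain ⟨C', hC', hR⟩ := hw.exists_mul_norm_gaborPairing_le g
  set f : 𝔼 × 𝔼 → Lp ℂ 2 (volume : Measure 𝔼) := fun z => (timeFrequencyShift g z).toLp 2 with hf
  have hfφ : ∀ z φ, Lp.toTemperedDistribution (f z) φ = gaborPairing g φ z := fun z φ => by
    rw [Lp.toTemperedDistribution_apply, gaborPairing]
    refine integral_congr_ae ?_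
    filter_upwards [(timeFrequencyShift g z).coeFn_toLp 2 volume] with y hy
    rw [hy, smul_eq_mul]
  have hle : ∀ z z', ‖(w z' : ℂ) * stft g (Lp.toTemperedDistribution (f z)) z'‖ₑ
      ≤ ENNReal.ofReal ((C' * w z) * (phaseWeight (z' - z) ^ (n + 1))⁻¹) := fun z z' => by
    rw [stft, hfφ, ← ofReal_norm, norm_mul, Complex.norm_real, Real.norm_of_nonneg (hw.pos z').le]
    exact ENNReal.ofReal_le_ofReal ((hR z z').trans_eq (by ring))
  have hfin : ∀ (c : ℝ) (z : 𝔼 × 𝔼), mixedLNorm p q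
      (fun z' => ENNReal.ofReal (c * (phaseWeight (z' - z) ^ (n + 1))⁻¹)) ≠ ∞ := fun c z => by
    rw [mixedLNorm_sub_right hp.out hp'.out hq.out hq'.out
      (fun z' => ENNReal.ofReal (c * (phaseWeight z' ^ (n + 1))⁻¹)) z]
    exact mixedLNorm_phaseWeight_pow_inv_ne_top hp.out hq.out (Nat.lt_succ_self n) c
  have hM : ∀ z, modulationENorm g w p q (Lp.toTemperedDistribution (f z)) ≠ ∞ := fun z => by
    rw [modulationENorm, mixedENorm_eq_mixedLNorm]
    exact ne_top_of_le_ne_top (hfin _ z) (mixedLNorm_mono (hle z))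
  choose π hπ using fun z => exists_toDistribution_eq hg hw (hM z)
  refine ⟨π, ?_, fun z φ => by rw [hπ, hfφ], fun z => ⟨f z, hπ z⟩⟩
  refine continuous_iff_seqContinuous.2 fun s z hs => ?_
  rw [tendsto_iff_enorm_sub_tendsto_zero]
  have hnorm : ∀ j, ‖π (s j) - π z‖ₑ = mixedLNorm p q (fun z' => ‖(w z' : ℂ) *
      (gaborPairing g (conjTimeFrequencyShift g z') (s j)
        - gaborPairing g (conjTimeFrequencyShift g z') z)‖ₑ) := fun j => by
    rw [enorm_eq, modulationENorm, mixedENorm_eq_mixedLNorm]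
    congr 1
    ext z'
    rw [stft, map_sub, hπ, hπ, ← hfφ, ← hfφ]
    rfl
  simp only [Function.comp_apply, hnorm]
  have hsz : Tendsto (fun j => phaseWeight (s j - z)) atTop (𝓝 (phaseWeight (z - z))) :=
    (continuous_phaseWeight.tendsto _).comp (hs.sub_const z)
  -- The bound on the phase weights of $s_j-z$ along the convergent sequence lets the weight and the
  -- kernel at $s_j$ be dominated by those at $z$. This gives one majorant for all $j$.
  obtain ⟨b, hb⟩ := hsz.bddAbove_range
  have hb' : ∀ j, phaseWeight (s j - z) ≤ b := fun j => hb ⟨j, rfl⟩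
  have hb0 : 0 < b := (phaseWeight_pos _).trans_le (hb' 0)
  have hcont : ∀ z : 𝔼 × 𝔼, Continuous fun z' => gaborPairing g (conjTimeFrequencyShift g z') z :=
    fun z => (continuous_gaborPairing_conjTimeFrequencyShift g).comp (f := fun z' => (z, z'))
        (continuous_const.prodMk continuous_id)
  have hcont' : ∀ z' : 𝔼 × 𝔼, Continuous fun z => gaborPairing g (conjTimeFrequencyShift g z') z :=
    fun z' => continuous_gaborPairing g _
  have hw0 := hw.pos z
  have hC := hw.const_pos
  refine mixedLNorm_tendsto_zero hp.out hp'.out hq.out hq'.out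
    (B := fun z' => ENNReal.ofReal ((C' * (C * b ^ N * w z) * b ^ (n + 1) + C' * w z)
      * (phaseWeight (z' - z) ^ (n + 1))⁻¹)) (fun j => ?_) ?_ (hfin _ z) (fun j => ?_) ?_
  · exact (hw.aestronglyMeasurable_mul ((hcont _).sub (hcont _)).aestronglyMeasurable).enorm
  · exact ((continuous_const_mul_phaseWeight_pow_inv _ (n + 1)).comp
      (continuous_id.sub continuous_const)).measurable.ennreal_ofReal.aemeasurable
  · refine Eventually.of_forall fun z' => ?_
    rw [← ofReal_norm, norm_mul, Complex.norm_real, Real.norm_of_nonneg (hw.pos z').le]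
    refine ENNReal.ofReal_le_ofReal ?_
    have h0 := phaseWeight_pos (z' - z)
    have h1 : w (s j) ≤ C * b ^ N * w z := by
      refine (hw.le_sub (s j) z).trans ?_
      have := phaseWeight_pos (s j - z)
      gcongr
      exact hb' j
    have h2 : (phaseWeight (z' - s j) ^ (n + 1))⁻¹
        ≤ b ^ (n + 1) * (phaseWeight (z' - z) ^ (n + 1))⁻¹ := by
      have := phaseWeight_pow_inv_sub_le (z' - z) (s j - z) (n + 1)
      rw [sub_sub_sub_cancel_right] at this
      refine this.trans ?_
      have := phaseWeight_pos (s j - z)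
      gcongr
      exact hb' j
    calc _ ≤ w z' * (‖gaborPairing g (conjTimeFrequencyShift g z') (s j)‖
          + ‖gaborPairing g (conjTimeFrequencyShift g z') z‖) :=
          mul_le_mul_of_nonneg_left (norm_sub_le _ _) (hw.pos z').le
      _ = w z' * ‖gaborPairing g (conjTimeFrequencyShift g z') (s j)‖
          + w z' * ‖gaborPairing g (conjTimeFrequencyShift g z') z‖ := mul_add _ _ _
      _ ≤ (C' * (phaseWeight (z' - s j) ^ (n + 1))⁻¹) * w (s j)
          + (C' * (phaseWeight (z' - z) ^ (n + 1))⁻¹) * w z := add_le_add (hR _ _) (hR _ _)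
      _ ≤ (C' * (b ^ (n + 1) * (phaseWeight (z' - z) ^ (n + 1))⁻¹)) * (C * b ^ N * w z)
          + (C' * (phaseWeight (z' - z) ^ (n + 1))⁻¹) * w z := by
          have h3 := (hw.pos (s j)).le
          gcongr
      _ = _ := by ring
  · refine Eventually.of_forall fun z' => ?_
    have h1 : Tendsto (fun j => (w z' : ℂ) * (gaborPairing g (conjTimeFrequencyShift g z') (s j)
        - gaborPairing g (conjTimeFrequencyShift g z') z)) atTop (𝓝 ((w z' : ℂ) *
        (gaborPairing g (conjTimeFrequencyShift g z') z
          - gaborPairing g (conjTimeFrequencyShift g z') z))) :=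
      ((((hcont' z').tendsto z).comp hs).sub_const _).const_mul _
    rw [sub_self, mul_zero] at h1
    have h2 := h1.enorm
    rwa [enorm_zero] at h2

end ModulationSpace

/-! ### Integral representation of functionals and nuclear traces -/

/-- The Bochner integral commutes with every functional. The separating family identifies it with
$b$, so the formula passes from that family to all functionals. -/
theorem ContinuousLinearMap.apply_eq_integral_of_separating {X B : Type*} [MeasurableSpace X]
    {μ : Measure X} [NormedAddCommGroup B] [NormedSpace ℂ B] [CompleteSpace B] {π : X → B}
    {F : X → ℂ} (hint : Integrable (fun x => F x • π x) μ) {b : B} {S : Set (B →L[ℂ] ℂ)}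
    (hS : ∀ x y : B, (∀ e ∈ S, e x = e y) → x = y) (h : ∀ e ∈ S, e b = ∫ x, F x * e (π x) ∂μ)
    (ψ : B →L[ℂ] ℂ) : ψ b = ∫ x, F x * ψ (π x) ∂μ := by
  have key : ∀ e : B →L[ℂ] ℂ, ∫ x, F x * e (π x) ∂μ = e (∫ x, F x • π x ∂μ) := fun e => by
    rw [← e.integral_comp_comm hint]
    simp
  rw [key, hS b _ fun e he => (h e he).trans (key e)]

/-- A functional that separates a point from the closed subspace has real part bounded above on it,
and must therefore vanish there. -/
theorem Submodule.dense_of_forall_dual_eq_zero {E : Type*} [SeminormedAddCommGroup E]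
    [NormedSpace ℂ E] (S : Submodule ℂ E)
    (h : ∀ ψ : E →L[ℂ] ℂ, (∀ x ∈ S, ψ x = 0) → ψ = 0) : Dense (S : Set E) := by
  intro x
  by_contra hx
  obtain ⟨f, u, hf, hu⟩ := RCLike.geometric_hahn_banach_closed_point (𝕜 := ℂ)
    (S.topologicalClosure.restrictScalars ℝ).convex S.isClosed_topologicalClosure hx
  have h0 : 0 < u := by simpa using hf 0 (Submodule.zero_mem _)
  have hf0 : f = 0 := h f fun a ha => by
    by_contra hfa
    -- The multiple is chosen so that the functional takes the excluded value $u$ at it.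
    have h1 := hf (((u : ℂ) / f a) • a) (S.le_topologicalClosure (S.smul_mem _ ha))
    rw [map_smul, smul_eq_mul, div_mul_cancel₀ _ hfa] at h1
    exact lt_irrefl _ h1
  rw [hf0] at hu
  exact lt_asymm h0 (by simpa using hu)

namespace ModulationSpace

variable {n : ℕ} {g : 𝓢(EuclideanSpace ℝ (Fin n), ℂ)}
  {w : EuclideanSpace ℝ (Fin n) × EuclideanSpace ℝ (Fin n) → ℝ} {p q : ℝ≥0∞}
  [hp : Fact (1 ≤ p)] [hp' : Fact (p ≠ ∞)] [hq : Fact (1 ≤ q)] [hq' : Fact (q ≠ ∞)]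
  {C : ℝ} {N : ℕ}

local notation "𝔼" => EuclideanSpace ℝ (Fin n)

/-- For bounded $F$ of compact support the synthesis is a Bochner integral in the modulation space,
since $z\mapsto\pi(z)g$ is continuous; evaluations at test functions separate points. The
restriction to compact support avoids integrability questions at infinity. -/
theorem apply_eq_integral (hg : g ≠ 0) (hw : IsModerateWeight w C N)
    {π : 𝔼 × 𝔼 → ModulationSpace g w p q} (hπ : Continuous π)
    (hπφ : ∀ z φ, toDistribution (π z) φ = gaborPairing g φ z) {F : 𝔼 × 𝔼 → ℂ}
    (hF : AEStronglyMeasurable F volume) {R c : ℝ} (hFc : ∀ z, ‖F z‖ ≤ c)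
    (hFR : ∀ z ∉ Metric.closedBall 0 R, F z = 0) {b : ModulationSpace g w p q}
    (hb : ∀ φ, toDistribution b φ = ∫ z, F z * gaborPairing g φ z)
    (ψ : ModulationSpace g w p q →L[ℂ] ℂ) : ψ b = ∫ z, F z * ψ (π z) := by
  let _ := normedAddCommGroup (p := p) (q := q) hg hw
  have := completeSpace (p := p) (q := q) hg hw
  choose e he using exists_clm_eq_apply (p := p) (q := q) hg hw
  have hK : IsCompact (Metric.closedBall (0 : 𝔼 × 𝔼) R) := isCompact_closedBall 0 R
  obtain ⟨d, hd⟩ := hK.exists_bound_of_continuousOn hπ.continuousOn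
  have hint : Integrable (fun z => F z • π z) := by
    have hi : Integrable (fun z => F z • π z) (volume.restrict (Metric.closedBall 0 R)) := by
      refine Measure.integrableOn_of_bounded (s_finite := hK.measure_lt_top.ne) (M := c * d)
        (hF.smul hπ.aestronglyMeasurable) ?_
      filter_upwards [ae_restrict_mem Metric.isClosed_closedBall.measurableSet] with z hz
      rw [norm_smul]
      exact mul_le_mul (hFc z) (hd z hz) (norm_nonneg _) ((norm_nonneg _).trans (hFc z))
    refine IntegrableOn.integrable_of_forall_notMem_eq_zero hi fun z hz => ?_
    rw [hFR z hz, zero_smul]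
  refine ContinuousLinearMap.apply_eq_integral_of_separating (S := Set.range e) hint ?_ ?_ ψ
  · intro x y hxy
    refine toDistribution_injective ?_
    ext φ
    rw [← he, ← he]
    exact hxy _ ⟨φ, rfl⟩
  · rintro _ ⟨φ, rfl⟩
    simp_rw [he, hπφ, hb]

/-- Every functional on `M_w^{p,q}` is represented by its values on the time-frequency shifts. -/
theorem exists_lintegral_stft_mul_le (hg : g ≠ 0) (hw : IsModerateWeight w C N)
    {π : 𝔼 × 𝔼 → ModulationSpace g w p q} (hπ : Continuous π)
    (hπφ : ∀ z φ, toDistribution (π z) φ = gaborPairing g φ z) :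
    ∃ D : ℝ≥0∞, D ≠ ∞ ∧ ∀ (ψ : ModulationSpace g w p q →L[ℂ] ℂ) (a : ModulationSpace g w p q),
      ∫⁻ z, ‖stft g (toDistribution a) z * ψ (π z)‖ₑ ≤ D * (‖ψ‖ₑ * ‖a‖ₑ) ∧
      ∫ z, stft g (toDistribution a) z * ψ (π z) = gaborConst g * ψ a := by
  obtain ⟨D, hD, hsyn⟩ := exists_synthesis (p := p) (q := q) hg hw
  refine ⟨D, hD, fun ψ a => ?_⟩
  set V := stft g (toDistribution a) with hV
  have hVc : Continuous V := continuous_stft hg _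
  have hψc : Continuous fun z => ψ (π z) := ψ.continuous.comp hπ
  have hVa : mixedENorm p q (fun z => (w z : ℂ) * V z) = ‖a‖ₑ := (enorm_eq a).symm
  set K : ℕ → Set (𝔼 × 𝔼) := fun m => Metric.closedBall 0 m with hK
  have hKm : ∀ m, MeasurableSet (K m) := fun m => Metric.isClosed_closedBall.measurableSet
  have hcov : AECover volume atTop K := aecover_closedBall tendsto_natCast_atTop_atTop
  have hFle : ∀ F : 𝔼 × 𝔼 → ℂ, (∀ z, ‖F z‖ ≤ ‖V z‖) →
      mixedENorm p q (fun z => (w z : ℂ) * F z) ≤ ‖a‖ₑ := fun F hF => by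
    rw [← hVa, mixedENorm_eq_mixedLNorm, mixedENorm_eq_mixedLNorm]
    refine mixedLNorm_mono fun z => ?_
    rw [enorm_mul, enorm_mul]
    exact mul_le_mul_right (enorm_le_iff_norm_le.2 (hF z)) _
  -- The function $f$ is only required to be measurable, because it will be $V$ multiplied by a
  -- discontinuous phase.
  have main : ∀ (m : ℕ) (f : 𝔼 × 𝔼 → ℂ), Measurable f → (∀ z, ‖f z‖ ≤ ‖V z‖) →
      ∃ b : ModulationSpace g w p q, ‖b‖ₑ ≤ D * ‖a‖ₑ ∧
        (∀ φ, Integrable (fun z => (K m).indicator f z * gaborPairing g φ z) ∧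
          toDistribution b φ = ∫ z, (K m).indicator f z * gaborPairing g φ z) ∧
        ψ b = ∫ z in K m, f z * ψ (π z) := by
    intro m f hf hfV
    have hle : ∀ z, ‖(K m).indicator f z‖ ≤ ‖V z‖ := fun z =>
      (norm_indicator_le_norm_self f z).trans (hfV z)
    have hm : AEStronglyMeasurable ((K m).indicator f) volume :=
      (hf.indicator (hKm m)).aestronglyMeasurable
    obtain ⟨b, hb, hbD⟩ := hsyn _ hm (ne_top_of_le_ne_top enorm_ne_top (hFle _ hle))
    obtain ⟨c, hc⟩ := (isCompact_closedBall (0 : 𝔼 × 𝔼) m).exists_bound_of_continuousOn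
      hVc.continuousOn
    refine ⟨b, hbD.trans (mul_le_mul_right (hFle _ hle) _), hb, ?_⟩
    rw [apply_eq_integral hg hw hπ hπφ hm (R := m) (c := max c 0) (fun z => ?_)
      (fun z hz => Set.indicator_of_notMem hz f) (fun φ => (hb φ).2) ψ,
      ← integral_indicator (hKm m)]
    · congr 1
      ext z
      by_cases hz : z ∈ K m <;> simp [hz]
    · by_cases hz : z ∈ K m
      · exact (hle z).trans ((hc z hz).trans (le_max_left _ _))
      · rw [Set.indicator_of_notMem hz, norm_zero]
        exact le_max_right _ _
  have hbound : ∫⁻ z, ‖V z * ψ (π z)‖ₑ ≤ D * (‖ψ‖ₑ * ‖a‖ₑ) := by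
    refine le_of_tendsto' (hcov.lintegral_tendsto_of_countably_generated
      (hVc.mul hψc).measurable.enorm.aemeasurable) fun m => ?_
    -- The factor $s(t)=\bar t/|t|$ (with $s(0)=0$) makes the integrand nonnegative without
    -- increasing $|V|$. Thus $\psi(b)$ becomes the integral of the absolute value over the ball,
    -- bounded by $\|\psi\|\|b\|$.
    set s : ℂ → ℂ := fun t => (starRingEnd ℂ) t / (‖t‖ : ℂ) with hs
    have hsm : Measurable s := Complex.continuous_conj.measurable.div
      (Complex.continuous_ofReal.measurable.comp measurable_norm)
    have hs1 : ∀ t, ‖s t‖ ≤ 1 := fun t => by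
      rw [hs, norm_div, RCLike.norm_conj, Complex.norm_real, norm_norm]
      exact div_self_le_one _
    have hs2 : ∀ t, t * s t = (‖t‖ : ℂ) := fun t => by
      rw [hs, ← mul_div_assoc, Complex.mul_conj, Complex.normSq_eq_norm_sq]
      rcases eq_or_ne t 0 with rfl | ht
      · simp
      · have : (‖t‖ : ℂ) ≠ 0 := by simpa using ht
        push_cast
        field_simp
    obtain ⟨b, hbD, -, hψb⟩ := main m (fun z => V z * s (V z * ψ (π z)))
      (hVc.measurable.mul (hsm.comp (hVc.mul hψc).measurable)) (fun z => by
        rw [norm_mul]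
        exact mul_le_of_le_one_right (norm_nonneg _) (hs1 _))
    have e1 : ψ b = ((∫ z in K m, ‖V z * ψ (π z)‖ : ℝ) : ℂ) := by
      rw [hψb, ← integral_complex_ofReal]
      congr 1
      ext z
      rw [← hs2]
      ring
    have hi : Integrable (fun z => V z * ψ (π z)) (volume.restrict (K m)) :=
      (hVc.mul hψc).continuousOn.integrableOn_compact (isCompact_closedBall _ _)
    have e2 : ∫⁻ z in K m, ‖V z * ψ (π z)‖ₑ = ‖ψ b‖ₑ := by
      rw [e1, ← ofReal_norm, Complex.norm_real,
        Real.norm_of_nonneg (integral_nonneg fun _ => norm_nonneg _),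
        ofReal_integral_norm_eq_lintegral_enorm hi]
    rw [e2, mul_left_comm]
    exact (ψ.le_opENorm b).trans (mul_le_mul_right hbD _)
  refine ⟨hbound, ?_⟩
  have hint : Integrable fun z => V z * ψ (π z) :=
    ⟨(hVc.mul hψc).aestronglyMeasurable, hbound.trans_lt
      (ENNReal.mul_lt_top hD.lt_top (ENNReal.mul_lt_top enorm_lt_top enorm_lt_top))⟩
  choose b _ hb hψb using fun m => main m V hVc.measurable fun z => le_rfl
  set κ : ℂ := (gaborConst g : ℂ) with hκ
  have hlim1 : Tendsto (fun m => ψ (b m)) atTop (𝓝 (∫ z, V z * ψ (π z))) := by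
    simp_rw [hψb]
    exact hcov.integral_tendsto_of_countably_generated hint
  -- The difference is minus the synthesis of $V$ outside the ball, whose weighted mixed norm tends
  -- to $0$ by dominated convergence; finite exponents are essential here.
  have hlim2 : Tendsto b atTop (𝓝 (κ • a)) := by
    have hcle : ∀ m z, ‖(K m)ᶜ.indicator V z‖ ≤ ‖V z‖ := fun m z => norm_indicator_le_norm_self V z
    have hcm : ∀ m, AEStronglyMeasurable ((K m)ᶜ.indicator V) volume := fun m =>
      (hVc.measurable.indicator (hKm m).compl).aestronglyMeasurable
    choose c hc hcD using fun m => hsyn ((K m)ᶜ.indicator V) (hcm m)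
      (ne_top_of_le_ne_top enorm_ne_top (hFle _ (hcle m)))
    have hcb : ∀ m, b m - κ • a = -c m := fun m => by
      rw [sub_eq_iff_eq_add, neg_add_eq_sub, eq_sub_iff_add_eq]
      refine toDistribution_injective ?_
      ext φ
      rw [← integral_stft_mul_gaborPairing hg, map_add]
      change toDistribution (b m) φ + toDistribution (c m) φ = _
      rw [(hb m φ).2, (hc m φ).2, ← integral_add (hb m φ).1 (hc m φ).1]
      congr 1
      ext z
      rw [← add_mul, Set.indicator_self_add_compl_apply]
    rw [tendsto_iff_enorm_sub_tendsto_zero]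
    simp_rw [hcb, enorm_neg]
    have h1 : Tendsto (fun m => mixedENorm p q (fun z => (w z : ℂ) * (K m)ᶜ.indicator V z)) atTop
        (𝓝 0) := by
      simp_rw [mixedENorm_eq_mixedLNorm]
      refine mixedLNorm_tendsto_zero hp.out hp'.out hq.out hq'.out
        (B := fun z => ‖(w z : ℂ) * V z‖ₑ) (fun m => (hw.aestronglyMeasurable_mul (hcm m)).enorm)
        (hw.aestronglyMeasurable_mul hVc.aestronglyMeasurable).enorm ?_
        (fun m => Eventually.of_forall fun z => ?_) (Eventually.of_forall fun z => ?_)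
      · rw [← mixedENorm_eq_mixedLNorm, hVa]
        exact enorm_ne_top
      · rw [enorm_mul, enorm_mul]
        exact mul_le_mul_right (enorm_le_iff_norm_le.2 (hcle m z)) _
      · refine tendsto_const_nhds.congr' ?_
        obtain ⟨m₀, hm₀⟩ := exists_nat_ge ‖z‖
        filter_upwards [eventually_ge_atTop m₀] with m hm
        have hz : z ∈ K m := by
          rw [hK, mem_closedBall_zero_iff]
          exact hm₀.trans (by exact_mod_cast hm)
        rw [Set.indicator_of_notMem (Set.notMem_compl_iff.2 hz), mul_zero, enorm_zero]
    have h2 := ENNReal.Tendsto.const_mul h1 (Or.inr hD)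
    rw [mul_zero] at h2
    exact tendsto_of_tendsto_of_tendsto_of_le_of_le tendsto_const_nhds h2 (fun _ => zero_le)
      fun m => hcD m
  have hlim3 := (ψ.continuous.tendsto _).comp hlim2
  rw [map_smul, smul_eq_mul] at hlim3
  exact tendsto_nhds_unique hlim1 hlim3

/-- The elements of `M_w^{p,q}` that are square integrable functions are dense. -/
theorem dense_lp_two (hg : g ≠ 0) (hw : IsModerateWeight w C N) :
    Dense {a : ModulationSpace g w p q | ∃ f : Lp ℂ 2 (volume : Measure 𝔼),
      toDistribution a = Lp.toTemperedDistribution f} := by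
  obtain ⟨π, hπ, hπφ, hπ2⟩ := exists_continuous_timeFrequencyShift (p := p) (q := q) hg hw
  obtain ⟨D, -, hrep⟩ := exists_lintegral_stft_mul_le hg hw hπ hπφ
  let S : Submodule ℂ (ModulationSpace g w p q) :=
    { carrier := {a | ∃ f : Lp ℂ 2 (volume : Measure 𝔼),
        toDistribution a = Lp.toTemperedDistribution f}
      zero_mem' := ⟨0, by
        rw [map_zero]
        exact (map_zero (Lp.toTemperedDistributionCLM ℂ volume 2)).symm⟩
      add_mem' := by
        rintro a b ⟨f, hf⟩ ⟨h, hh⟩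
        refine ⟨f + h, ?_⟩
        rw [map_add, hf, hh]
        exact (map_add (Lp.toTemperedDistributionCLM ℂ volume 2) f h).symm
      smul_mem' := by
        rintro c a ⟨f, hf⟩
        refine ⟨c • f, ?_⟩
        rw [map_smul, hf]
        exact (map_smul (Lp.toTemperedDistributionCLM ℂ volume 2) c f).symm }
  -- A functional vanishing on square integrable elements vanishes on every $\pi(z)g$, hence
  -- everywhere by the integral representation.
  refine S.dense_of_forall_dual_eq_zero fun ψ hψ => ContinuousLinearMap.ext fun a => ?_
  have h := (hrep ψ a).2
  simp_rw [hψ (π _) (hπ2 _), mul_zero, integral_zero] at h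
  exact (mul_eq_zero.1 h.symm).resolve_left (Complex.ofReal_ne_zero.2 (gaborConst_pos hg).ne')

/-- The nuclear trace is independent of the representation. -/
theorem exists_forall_hasSum_trace (hg : g ≠ 0) (hw : IsModerateWeight w C N)
    (T : ModulationSpace g w p q →L[ℂ] ModulationSpace g w p q) :
    ∃ t : ℂ, ∀ (φ : ℕ → ModulationSpace g w p q) (ψ : ℕ → (ModulationSpace g w p q →L[ℂ] ℂ)),
      IsNuclearRepresentation 1 T φ ψ → HasSum (fun j => ψ j (φ j)) t := by
  obtain ⟨π, hπ, hπφ, -⟩ := exists_continuous_timeFrequencyShift (p := p) (q := q) hg hw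
  obtain ⟨D, hD, hrep⟩ := exists_lintegral_stft_mul_le hg hw hπ hπφ
  choose e he using exists_clm_eq_apply (p := p) (q := q) hg hw
  have hκ : (gaborConst g : ℂ) ≠ 0 := Complex.ofReal_ne_zero.2 (gaborConst_pos hg).ne'
  -- The witness is $\kappa^{-1}\int V_g(T\pi(z)g)(z)\,dz$, in which no representation of $T$
  -- occurs.
  refine ⟨(gaborConst g : ℂ)⁻¹ * ∫ z, stft g (toDistribution (T (π z))) z, fun φ ψ h => ?_⟩
  have hint : ∀ j, Integrable fun z => stft g (toDistribution (φ j)) z * ψ j (π z) := fun j =>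
    ⟨((continuous_stft hg _).mul ((ψ j).continuous.comp hπ)).aestronglyMeasurable,
      (hrep (ψ j) (φ j)).1.trans_lt
        (ENNReal.mul_lt_top hD.lt_top (ENNReal.mul_lt_top enorm_lt_top enorm_lt_top))⟩
  have hsum : Summable fun j => ∫ z, ‖stft g (toDistribution (φ j)) z * ψ j (π z)‖ := by
    have h1 : Summable fun j => ‖ψ j‖ * ‖φ j‖ := by simpa using h.summable
    refine Summable.of_nonneg_of_le (fun j => integral_nonneg fun _ => norm_nonneg _) (fun j => ?_)
      (h1.mul_left D.toReal)
    have h2 := ENNReal.toReal_mono (ENNReal.mul_ne_top hD (ENNReal.mul_ne_top enorm_ne_top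
      enorm_ne_top)) (hrep (ψ j) (φ j)).1
    rw [ENNReal.toReal_mul, ENNReal.toReal_mul, toReal_enorm, toReal_enorm] at h2
    rwa [integral_norm_eq_lintegral_enorm (hint j).aestronglyMeasurable]
  -- Each term integrates to $\kappa\,\psi_j(\varphi_j)$. The bound by $\|\psi_j\|\|\varphi_j\|$
  -- justifies exchanging sum and integral, and pointwise the terms sum to the transform of
  -- $T\pi(z)g$ at $z$.
  have h3 := (hasSum_integral_of_summable_integral_norm hint hsum).mul_left (gaborConst g : ℂ)⁻¹
  have h4 : ∀ z, ∑' j, stft g (toDistribution (φ j)) z * ψ j (π z)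
      = stft g (toDistribution (T (π z))) z := fun z => by
    have h5 := (h.hasSum (π z)).mapL (e (conjTimeFrequencyShift g z))
    rw [stft, ← he, ← h5.tsum_eq]
    refine tsum_congr fun j => ?_
    rw [map_smul, smul_eq_mul, mul_comm, he, stft]
  simp_rw [h4, (hrep (ψ _) (φ _)).2] at h3
  refine h3.congr_fun fun j => ?_
  rw [inv_mul_cancel_left₀ hκ]

end ModulationSpace

/-! ### The orthogonality relation in `L²` -/

section Orthogonality

variable {n : ℕ}

local notation "𝔼" => EuclideanSpace ℝ (Fin n)

/-- The value of the distribution `f ∈ L²` at a test function, as a functional of `f`. -/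
theorem exists_clm_eq_lp_apply (φ : 𝓢(𝔼, ℂ)) :
    ∃ e : Lp ℂ 2 (volume : Measure 𝔼) →L[ℂ] ℂ, ∀ f, e f = Lp.toTemperedDistribution f φ :=
  ⟨(PointwiseConvergenceCLM.evalCLM (RingHom.id ℂ) ℂ φ).comp
    (Lp.toTemperedDistributionCLM ℂ volume 2), fun _ => rfl⟩

theorem stft_toTemperedDistribution_toLp (g χ : 𝓢(𝔼, ℂ)) (z : 𝔼 × 𝔼) :
    stft g (Lp.toTemperedDistribution (χ.toLp 2)) z = (starRingEnd ℂ)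
      (gaborPairing g (postcompCLM (𝕜 := ℝ) (Complex.conjCLE : ℂ →L[ℝ] ℂ) χ) z) := by
  rw [stft, Lp.toTemperedDistribution_apply, gaborPairing, ← integral_conj]
  refine integral_congr_ae ?_
  filter_upwards [χ.coeFn_toLp 2 volume] with y hy
  rw [hy, smul_eq_mul, map_mul, timeFrequencyShift_apply, Complex.conj_conj, mul_comm]
  congr 1
  exact (Complex.conj_conj _).symm

/-- This is the reproducing formula for the distribution $f$, tested on $\bar\chi$. -/
theorem integral_stft_mul_conj_stft_toLp {g : 𝓢(𝔼, ℂ)} (hg : g ≠ 0)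
    (f : Lp ℂ 2 (volume : Measure 𝔼)) (χ : 𝓢(𝔼, ℂ)) :
    ∫ z, stft g (Lp.toTemperedDistribution f) z *
        (starRingEnd ℂ) (stft g (Lp.toTemperedDistribution (χ.toLp 2)) z)
      = gaborConst g * ⟪χ.toLp 2, f⟫_ℂ := by
  simp_rw [stft_toTemperedDistribution_toLp, Complex.conj_conj]
  rw [(integrable_and_integral_stft_mul_gaborPairing hg _ _).2, Lp.toTemperedDistribution_apply,
    L2.inner_def]
  congr 1
  refine integral_congr_ae ?_
  filter_upwards [χ.coeFn_toLp 2 volume] with y hy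
  rw [hy, RCLike.inner_apply, smul_eq_mul, mul_comm]
  rfl

/-- With $f=\chi$ the orthogonality relation says that the transform multiplies $L^2$ norms by
$\sqrt\kappa$. -/
theorem eLpNorm_stft_toLp_le {g : 𝓢(𝔼, ℂ)} (hg : g ≠ 0) (χ : 𝓢(𝔼, ℂ)) :
    eLpNorm (stft g (Lp.toTemperedDistribution (χ.toLp 2))) 2 volume
      ≤ ENNReal.ofReal √(gaborConst g) * ‖χ.toLp 2 volume‖ₑ := by
  set J := stft g (Lp.toTemperedDistribution (χ.toLp 2)) with hJ
  have hm : MemLp J 2 volume := by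
    have h := memLp_two_phaseWeight_pow_mul_gaborPairing g
      (postcompCLM (𝕜 := ℝ) (Complex.conjCLE : ℂ →L[ℝ] ℂ) χ) 0
    simp only [pow_zero, Complex.ofReal_one, one_mul] at h
    have e : J = star (gaborPairing g (postcompCLM (𝕜 := ℝ) (Complex.conjCLE : ℂ →L[ℝ] ℂ) χ)) :=
      funext fun z => stft_toTemperedDistribution_toLp g χ z
    rw [e]
    exact h.star
  have hκ := gaborConst_pos hg
  have h1 : ‖hm.toLp J‖ ^ 2 = gaborConst g * ‖χ.toLp 2 volume‖ ^ 2 := by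
    have h2 : ⟪hm.toLp J, hm.toLp J⟫_ℂ = gaborConst g * ⟪χ.toLp 2 volume, χ.toLp 2 volume⟫_ℂ := by
      rw [← integral_stft_mul_conj_stft_toLp hg, L2.inner_def]
      refine integral_congr_ae ?_
      filter_upwards [hm.coeFn_toLp] with z hz
      rw [hz, RCLike.inner_apply]
    rw [inner_self_eq_norm_sq_to_K, inner_self_eq_norm_sq_to_K] at h2
    refine Complex.ofReal_injective ?_
    push_cast
    exact h2
  have h3 : ‖hm.toLp J‖ = √(gaborConst g) * ‖χ.toLp 2 volume‖ := by
    rw [← Real.sqrt_sq (norm_nonneg (hm.toLp J)), h1, Real.sqrt_mul hκ.le,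
      Real.sqrt_sq (norm_nonneg _)]
  rw [← Lp.enorm_toLp (hf := hm), ← ofReal_norm, h3, ENNReal.ofReal_mul (Real.sqrt_nonneg _),
    ofReal_norm]

/-- Schwartz functions are dense in $L^2$, and their transforms converge pointwise; Fatou's lemma
carries the bound to the limit. -/
theorem eLpNorm_stft_le {g : 𝓢(𝔼, ℂ)} (hg : g ≠ 0) (f : Lp ℂ 2 (volume : Measure 𝔼)) :
    eLpNorm (stft g (Lp.toTemperedDistribution f)) 2 volume
      ≤ ENNReal.ofReal √(gaborConst g) * ‖f‖ₑ := by
  obtain ⟨s, hs, hsf⟩ := mem_closure_iff_seq_limit.1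
    (SchwartzMap.denseRange_toLpCLM (F := ℂ) (μ := (volume : Measure 𝔼)) ENNReal.ofNat_ne_top f)
  choose χ hχ using hs
  have hχs : ∀ m, (χ m).toLp 2 volume = s m := hχ
  choose e he using exists_clm_eq_lp_apply (n := n)
  refine (Lp.eLpNorm_lim_le_liminf_eLpNorm
    (f := fun m => stft g (Lp.toTemperedDistribution ((χ m).toLp 2)))
    (fun m => (continuous_stft hg _).aestronglyMeasurable) _
    (Eventually.of_forall fun z => ?_)).trans ?_
  · simp_rw [stft, ← he, hχs]
    exact ((e _).continuous.tendsto f).comp hsf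
  · have h1 : Tendsto (fun m => ENNReal.ofReal √(gaborConst g) * ‖s m‖ₑ) atTop
        (𝓝 (ENNReal.ofReal √(gaborConst g) * ‖f‖ₑ)) :=
      ENNReal.Tendsto.const_mul hsf.enorm (Or.inr ENNReal.ofReal_ne_top)
    rw [← h1.liminf_eq]
    refine liminf_le_liminf (Eventually.of_forall fun m => ?_)
    rw [← hχs]
    exact eLpNorm_stft_toLp_le hg (χ m)

theorem memLp_stft {g : 𝓢(𝔼, ℂ)} (hg : g ≠ 0) (f : Lp ℂ 2 (volume : Measure 𝔼)) :
    MemLp (stft g (Lp.toTemperedDistribution f)) 2 volume :=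
  ⟨(continuous_stft hg _).aestronglyMeasurable, (eLpNorm_stft_le hg f).trans_lt
    (ENNReal.mul_lt_top ENNReal.ofReal_lt_top enorm_lt_top)⟩

/-- The orthogonality relation for the short-time Fourier transform. -/
theorem integral_stft_mul_conj_stft {g : 𝓢(𝔼, ℂ)} (hg : g ≠ 0)
    (f h : Lp ℂ 2 (volume : Measure 𝔼)) :
    ∫ z, stft g (Lp.toTemperedDistribution f) z *
        (starRingEnd ℂ) (stft g (Lp.toTemperedDistribution h) z) = gaborConst g * ⟪h, f⟫_ℂ := by
  choose e he using exists_clm_eq_lp_apply (n := n)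
  let L : Lp ℂ 2 (volume : Measure 𝔼) →ₗ[ℂ] Lp ℂ 2 (volume : Measure (𝔼 × 𝔼)) :=
    { toFun := fun f => (memLp_stft hg f).toLp _
      map_add' := fun f h => by
        rw [← MemLp.toLp_add]
        congr 1
        ext z
        simp only [Pi.add_apply, stft, ← he, map_add]
      map_smul' := fun c f => by
        rw [RingHom.id_apply, ← MemLp.toLp_const_smul]
        congr 1
        ext z
        simp only [Pi.smul_apply, stft, ← he, map_smul] }
  obtain ⟨T, hT, -⟩ := LinearMap.exists_continuousLinearMap_of_enorm_le L
    (ENNReal.ofReal_ne_top (r := √(gaborConst g))) fun f => by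
      change ‖(memLp_stft hg f).toLp _‖ₑ ≤ _
      rw [Lp.enorm_toLp]
      exact eLpNorm_stft_le hg f
  have hTe : ∀ f h, ⟪T h, T f⟫_ℂ = ∫ z, stft g (Lp.toTemperedDistribution f) z *
      (starRingEnd ℂ) (stft g (Lp.toTemperedDistribution h) z) := fun f h => by
    rw [L2.inner_def]
    refine integral_congr_ae ?_
    rw [hT, hT]
    filter_upwards [(memLp_stft hg f).coeFn_toLp, (memLp_stft hg h).coeFn_toLp] with z h1 h2
    change inner ℂ ((memLp_stft hg h).toLp _ z) ((memLp_stft hg f).toLp _ z) = _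
    rw [h1, h2, RCLike.inner_apply]
  rw [← hTe]
  -- Both sides are continuous in $h$ and agree for Schwartz $h$.
  refine congrFun ((SchwartzMap.denseRange_toLpCLM (F := ℂ) (p := 2) (μ := (volume : Measure 𝔼))
    ENNReal.ofNat_ne_top).equalizer (g := fun h => ⟪T h, T f⟫_ℂ)
    (h := fun h => gaborConst g * ⟪h, f⟫_ℂ) ?_ ?_ ?_) h
  · exact T.continuous.inner continuous_const
  · exact continuous_const.mul (continuous_id.inner continuous_const)
  · funext χ
    simp only [Function.comp_apply, hTe]
    exact integral_stft_mul_conj_stft_toLp hg f χ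

end Orthogonality

/-! ### Hölder duality between the weights $w$ and $1/w$. -/

section Duality

variable {n : ℕ}

local notation "𝔼" => EuclideanSpace ℝ (Fin n)

theorem lintegral_enorm_stft_mul_le {w : 𝔼 × 𝔼 → ℝ} {C : ℝ} {N : ℕ} {g : 𝓢(𝔼, ℂ)} (hg : g ≠ 0)
    (hw : IsModerateWeight w C N) {p q : ℝ≥0∞} (hp : 1 ≤ p) (hp' : p ≠ ∞) (hq : 1 ≤ q)
    (hq' : q ≠ ∞) (f h : 𝓢'(𝔼, ℂ)) :
    ∫⁻ z, ‖stft g f z * (starRingEnd ℂ) (stft g h z)‖ₑ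
      ≤ modulationENorm g w p q f
        * modulationENorm g (fun z => (w z)⁻¹) p.conjExponent q.conjExponent h := by
  rw [modulationENorm, modulationENorm, mixedENorm_eq_mixedLNorm, mixedENorm_eq_mixedLNorm]
  have hwi : AEStronglyMeasurable (fun z => (((w z)⁻¹ : ℝ) : ℂ)) volume :=
    (Complex.measurable_ofReal.comp_aemeasurable
      hw.aestronglyMeasurable.aemeasurable.inv).aestronglyMeasurable
  refine le_trans (lintegral_mono fun z => le_of_eq ?_) (lintegral_mul_le_mixedLNorm_mul hp hp' hq
    hq' (hw.aestronglyMeasurable_mul (continuous_stft hg f).aestronglyMeasurable).enorm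
    (hwi.mul (continuous_stft hg h).aestronglyMeasurable).enorm)
  have hz : (w z : ℂ) ≠ 0 := Complex.ofReal_ne_zero.2 (hw.pos z).ne'
  rw [← enorm_mul, enorm_mul, RCLike.enorm_conj, ← enorm_mul]
  congr 1
  push_cast
  field_simp

end Duality

/-! ### Summability of operator series and domains of bounded multipliers. -/

section Nuclear

/-- Subadditivity of $t\mapsto t^r$ for $r\le1$. It shows that an $r$-nuclear series is absolutely
convergent. -/
theorem ENNReal.tsum_rpow_le_tsum_rpow {ι : Type*} (x : ι → ℝ≥0∞) {r : ℝ} (h0 : 0 < r)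
    (h1 : r ≤ 1) : (∑' j, x j) ^ r ≤ ∑' j, x j ^ r := by
  have hfin : ∀ s : Finset ι, (∑ j ∈ s, x j) ^ r ≤ ∑ j ∈ s, x j ^ r := fun s => by
    classical
    induction s using Finset.induction_on with
    | empty => simp [h0]
    | insert i s hi ih =>
      rw [Finset.sum_insert hi, Finset.sum_insert hi]
      exact (ENNReal.rpow_add_le_add_rpow _ _ h0.le h1).trans (add_le_add_right ih _)
  rw [← ENNReal.le_rpow_inv_iff h0]
  refine ENNReal.summable.tsum_le_of_sum_le fun s => ?_
  rw [ENNReal.le_rpow_inv_iff h0]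
  exact (hfin s).trans (ENNReal.sum_le_tsum s)

theorem exists_clm_hasSum_of_summable {B : Type*} [NormedAddCommGroup B] [NormedSpace ℂ B]
    [CompleteSpace B] {φ : ℕ → B} {ψ : ℕ → (B →L[ℂ] ℂ)}
    (h : Summable fun j => ‖ψ j‖ * ‖φ j‖) :
    ∃ T : B →L[ℂ] B, ∀ f, HasSum (fun j => ψ j f • φ j) (T f) := by
  have hs : Summable fun j => (ψ j).smulRight (φ j) :=
    Summable.of_norm (by simpa only [ContinuousLinearMap.norm_smulRight_apply] using h)
  exact ⟨_, fun f => hs.hasSum.mapL (ContinuousLinearMap.apply ℂ B f)⟩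

theorem spectralDomain_eq_top_of_bounded {H : Type*} [NormedAddCommGroup H]
    [InnerProductSpace ℂ H] (u : HilbertBasis ℕ ℂ H) {m : ℕ → ℂ} {c : ℝ} (hm : ∀ j, ‖m j‖ ≤ c)
    (f : H) : f ∈ spectralDomain u m := by
  have h := (lp.memℓp (u.repr f)).summable (by norm_num)
  refine memℓp_gen ((h.mul_left (c ^ (2 : ℝ))).of_nonneg_of_le (fun j => by positivity) fun j => ?_)
  have hc : 0 ≤ c := (norm_nonneg _).trans (hm 0)
  simp only [ENNReal.toReal_ofNat]
  rw [norm_mul, Real.mul_rpow (norm_nonneg _) (norm_nonneg _)]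
  gcongr
  exact hm j

end Nuclear

/-! ### Spectral multipliers on modulation spaces -/

/-- Orthogonality with $h=f$, combined with Hölder. The lower bound keeps both norms away from $0$,
so a finite product forces both factors to be finite. -/
theorem ofReal_gaborConst_le {n : ℕ} {g : 𝓢(EuclideanSpace ℝ (Fin n), ℂ)} (hg : g ≠ 0)
    {w : EuclideanSpace ℝ (Fin n) × EuclideanSpace ℝ (Fin n) → ℝ} {C : ℝ} {N : ℕ}
    (hw : IsModerateWeight w C N) {p q : ℝ≥0∞} (hp : 1 ≤ p) (hp' : p ≠ ∞)
    (hq : 1 ≤ q) (hq' : q ≠ ∞) {f : Lp ℂ 2 (volume : Measure (EuclideanSpace ℝ (Fin n)))} (hf : ‖f‖ = 1) :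
    ENNReal.ofReal (gaborConst g) ≤ modulationENorm g w p q (Lp.toTemperedDistribution f)
      * modulationENorm g (fun z => (w z)⁻¹) p.conjExponent q.conjExponent
        (Lp.toTemperedDistribution f) := by
  have h := integral_stft_mul_conj_stft hg f f
  rw [inner_self_eq_norm_sq_to_K, hf, RCLike.ofReal_one, one_pow, mul_one] at h
  have h1 : ENNReal.ofReal (gaborConst g) = ‖(gaborConst g : ℂ)‖ₑ := by
    rw [← ofReal_norm, Complex.norm_real, Real.norm_of_nonneg (gaborConst_pos hg).le]
  rw [h1, ← h]
  exact (enorm_integral_le_lintegral_enorm _).trans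
    (lintegral_enorm_stft_mul_le hg hw hp hp' hq hq' _ _)

namespace ModulationSpace

variable {n : ℕ} {g : 𝓢(EuclideanSpace ℝ (Fin n), ℂ)}
  {w : EuclideanSpace ℝ (Fin n) × EuclideanSpace ℝ (Fin n) → ℝ} {p q : ℝ≥0∞}
  [hp : Fact (1 ≤ p)] [hp' : Fact (p ≠ ∞)] [hq : Fact (1 ≤ q)] [hq' : Fact (q ≠ ∞)]
  {C : ℝ} {N : ℕ}

local notation "𝔼" => EuclideanSpace ℝ (Fin n)

/-- The `L²` pairing with `h` extends to a functional on `M_w^{p,q}` if `h ∈ M_{1/w}^{p',q'}`. -/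
theorem exists_functional_extending_inner (hg : g ≠ 0) (hw : IsModerateWeight w C N)
    {h : Lp ℂ 2 (volume : Measure 𝔼)}
    (hh : modulationENorm g (fun z => (w z)⁻¹) p.conjExponent q.conjExponent
      (Lp.toTemperedDistribution h) ≠ ∞) :
    ∃ ψ : ModulationSpace g w p q →L[ℂ] ℂ,
      ‖ψ‖ₑ ≤ ENNReal.ofReal (gaborConst g)⁻¹ * modulationENorm g (fun z => (w z)⁻¹)
        p.conjExponent q.conjExponent (Lp.toTemperedDistribution h) ∧
      ∀ a f, toDistribution a = Lp.toTemperedDistribution f → ψ a = ⟪h, f⟫_ℂ := by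
  set B := modulationENorm g (fun z => (w z)⁻¹) p.conjExponent q.conjExponent
    (Lp.toTemperedDistribution h) with hB
  have hκ := gaborConst_pos hg
  set I : ModulationSpace g w p q → 𝔼 × 𝔼 → ℂ := fun a z => stft g (toDistribution a) z *
    (starRingEnd ℂ) (stft g (Lp.toTemperedDistribution h) z) with hI
  have hle : ∀ a, ∫⁻ z, ‖I a z‖ₑ ≤ ‖a‖ₑ * B := fun a => by
    rw [enorm_eq]
    exact lintegral_enorm_stft_mul_le hg hw hp.out hp'.out hq.out hq'.out _ _
  have hint : ∀ a, Integrable (I a) := fun a =>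
    ⟨((continuous_stft hg _).mul
      (Complex.continuous_conj.comp (continuous_stft hg _))).aestronglyMeasurable,
      (hle a).trans_lt (ENNReal.mul_lt_top enorm_lt_top hh.lt_top)⟩
  let L : ModulationSpace g w p q →ₗ[ℂ] ℂ :=
    { toFun := fun a => ((gaborConst g)⁻¹ : ℝ) * ∫ z, I a z
      map_add' := fun a b => by
        rw [← mul_add, ← integral_add (hint a) (hint b)]
        congr 2
        ext z
        exact add_mul _ _ _
      map_smul' := fun c a => by
        rw [RingHom.id_apply, smul_eq_mul, mul_left_comm, ← integral_const_mul c]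
        congr 2
        ext z
        exact mul_assoc _ _ _ }
  obtain ⟨ψ, hψ, hψB⟩ := LinearMap.exists_continuousLinearMap_of_enorm_le L
    (ENNReal.mul_ne_top (ENNReal.ofReal_ne_top (r := (gaborConst g)⁻¹)) hh) fun a => by
      change ‖(((gaborConst g)⁻¹ : ℝ) : ℂ) * ∫ z, I a z‖ₑ ≤ _
      rw [enorm_mul, ← ofReal_norm, Complex.norm_real, Real.norm_of_nonneg (by positivity),
        mul_assoc, mul_comm B]
      exact mul_le_mul_right ((enorm_integral_le_lintegral_enorm _).trans (hle a)) _
  refine ⟨ψ, hψB, fun a f haf => ?_⟩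
  rw [hψ]
  change (((gaborConst g)⁻¹ : ℝ) : ℂ) * ∫ z, I a z = _
  simp_rw [hI, haf]
  rw [integral_stft_mul_conj_stft hg, Complex.ofReal_inv,
    inv_mul_cancel_left₀ (Complex.ofReal_ne_zero.2 hκ.ne')]

/-- The rank one operators in the spectral decomposition, as operators on `M_w^{p,q}`. -/
theorem exists_rank_one (hg : g ≠ 0) (hw : IsModerateWeight w C N)
    {h : Lp ℂ 2 (volume : Measure 𝔼)} (hh : ‖h‖ = 1) {m : ℂ}
    (hm : m ≠ 0 → modulationENorm g w p q (Lp.toTemperedDistribution h)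
      * modulationENorm g (fun z => (w z)⁻¹) p.conjExponent q.conjExponent
        (Lp.toTemperedDistribution h) ≠ ∞) :
    ∃ (φ : ModulationSpace g w p q) (ψ : ModulationSpace g w p q →L[ℂ] ℂ),
      ‖ψ‖ₑ * ‖φ‖ₑ ≤ ENNReal.ofReal (gaborConst g)⁻¹ *
        (‖m‖ₑ * (modulationENorm g w p q (Lp.toTemperedDistribution h)
          * modulationENorm g (fun z => (w z)⁻¹) p.conjExponent q.conjExponent
            (Lp.toTemperedDistribution h))) ∧
      ψ φ = m ∧
      ∀ a f, toDistribution a = Lp.toTemperedDistribution f →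
        toDistribution (ψ a • φ) = Lp.toTemperedDistribution ((m * ⟪h, f⟫_ℂ) • h) := by
  have hsmul : ∀ (c : ℂ) (f : Lp ℂ 2 (volume : Measure 𝔼)),
      Lp.toTemperedDistribution (c • f) = c • Lp.toTemperedDistribution f := fun c f =>
    map_smul (Lp.toTemperedDistributionCLM ℂ volume 2) c f
  -- If $m=0$ the norms of $h$ may be infinite, and the zero operator is represented by zero
  -- vectors.
  rcases eq_or_ne m 0 with rfl | hm0
  · refine ⟨0, 0, ?_, by simp, fun a f _ => ?_⟩
    · rw [← ofReal_norm (0 : ModulationSpace g w p q), norm_zero, ENNReal.ofReal_zero, mul_zero]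
      exact zero_le
    · rw [smul_zero, map_zero, zero_mul, hsmul, zero_smul]
  set A := modulationENorm g w p q (Lp.toTemperedDistribution h) with hA
  set B := modulationENorm g (fun z => (w z)⁻¹) p.conjExponent q.conjExponent
    (Lp.toTemperedDistribution h) with hB
  have hAB := hm hm0
  have hAB0 : A * B ≠ 0 := (lt_of_lt_of_le (ENNReal.ofReal_pos.2 (gaborConst_pos hg))
    (ofReal_gaborConst_le hg hw hp.out hp'.out hq.out hq'.out hh)).ne'
  have hA0 : A ≠ 0 := left_ne_zero_of_mul hAB0
  have hB0 : B ≠ 0 := right_ne_zero_of_mul hAB0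
  have hAt : A ≠ ∞ := fun h => hAB (by rw [h, ENNReal.top_mul hB0])
  have hBt : B ≠ ∞ := fun h => hAB (by rw [h, ENNReal.mul_top hA0])
  obtain ⟨a₀, ha₀⟩ := exists_toDistribution_eq (p := p) (q := q) hg hw hAt
  obtain ⟨ψ, hψB, hψ⟩ := exists_functional_extending_inner (p := p) (q := q) hg hw hBt
  refine ⟨m • a₀, ψ, ?_, ?_, fun a f haf => ?_⟩
  · rw [enorm_smul, enorm_eq, ha₀, ← hA]
    calc ‖ψ‖ₑ * (‖m‖ₑ * A) ≤ (ENNReal.ofReal (gaborConst g)⁻¹ * B) * (‖m‖ₑ * A) := by gcongr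
      _ = _ := by ring
  · rw [map_smul, hψ a₀ h ha₀, inner_self_eq_norm_sq_to_K, hh]
    simp
  · rw [hψ a f haf, map_smul, map_smul, ha₀, hsmul, mul_smul, smul_comm]

end ModulationSpace

theorem HilbertBasis.hasSum_spectralMultiplier {H : Type*} [NormedAddCommGroup H]
    [InnerProductSpace ℂ H] (u : HilbertBasis ℕ ℂ H) (m : ℕ → ℂ) (f : (spectralMultiplier u m).domain) :
    HasSum (fun j => (m j * ⟪u j, (f : H)⟫_ℂ) • u j) (spectralMultiplier u m f) := by
  have h := u.hasSum_repr_symm (spectralCoeff u m f)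
  refine h.congr_fun fun j => ?_
  rw [← u.repr_apply_apply]
  rfl

/-- Spectral multipliers of an orthonormal basis on a modulation space. -/
theorem exists_isRealization_of_tsum_lt_top {n : ℕ}
    (u : HilbertBasis ℕ ℂ (Lp ℂ 2 (volume : Measure (EuclideanSpace ℝ (Fin n))))) (m : ℕ → ℂ)
    {g : 𝓢(EuclideanSpace ℝ (Fin n), ℂ)} (hg : g ≠ 0)
    {w : EuclideanSpace ℝ (Fin n) × EuclideanSpace ℝ (Fin n) → ℝ} {C : ℝ} {N : ℕ}
    (hw : IsModerateWeight w C N)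
    {p q : ℝ≥0∞} [hp : Fact (1 ≤ p)] [hp' : Fact (p ≠ ∞)] [hq : Fact (1 ≤ q)] [hq' : Fact (q ≠ ∞)]
    {r : ℝ} (hr0 : 0 < r) (hr1 : r ≤ 1)
    (hsum : ∑' j, ‖m j‖ₑ ^ r
        * modulationENorm g w p q (Lp.toTemperedDistribution (u j)) ^ r
        * modulationENorm g (fun z => (w z)⁻¹) p.conjExponent q.conjExponent
            (Lp.toTemperedDistribution (u j)) ^ r < ∞) :
    ∃ T : ModulationSpace g w p q →L[ℂ] ModulationSpace g w p q,
      IsRealization (spectralMultiplier u m) T ∧ IsRNuclear r T ∧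
      (r = 1 → Summable (fun j => ‖m j‖) ∧ HasNuclearTrace T (∑' j, m j)) := by
  set X : ℕ → ℝ≥0∞ := fun j => modulationENorm g w p q (Lp.toTemperedDistribution (u j))
    * modulationENorm g (fun z => (w z)⁻¹) p.conjExponent q.conjExponent
      (Lp.toTemperedDistribution (u j)) with hX
  have hκ := gaborConst_pos hg
  set K := ENNReal.ofReal (gaborConst g)⁻¹ with hK
  have hu : ∀ j, ‖u j‖ = 1 := u.orthonormal.1
  have hKX : ∀ j, 1 ≤ K * X j := fun j => by
    calc (1 : ℝ≥0∞) = K * ENNReal.ofReal (gaborConst g) := by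
          rw [hK, ← ENNReal.ofReal_mul (by positivity), inv_mul_cancel₀ hκ.ne', ENNReal.ofReal_one]
      _ ≤ _ := mul_le_mul_right
          (ofReal_gaborConst_le hg hw hp.out hp'.out hq.out hq'.out (hu j)) _
  have hsum' : ∑' j, (‖m j‖ₑ * X j) ^ r ≠ ∞ := by
    refine ne_of_eq_of_ne (tsum_congr fun j => ?_) hsum.ne
    rw [ENNReal.mul_rpow_of_nonneg _ _ hr0.le, hX, ENNReal.mul_rpow_of_nonneg _ _ hr0.le, mul_assoc]
  -- In $[0,\infty]$ a vanishing multiplier hides infinite norms, so finiteness can be read off only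
  -- for $m_j\ne0$.
  have hX1 : ∀ j, m j ≠ 0 → X j ≠ ∞ := fun j hj hXj => by
    refine ENNReal.ne_top_of_tsum_ne_top hsum' j ?_
    rw [hXj, ENNReal.mul_top (enorm_ne_zero.2 hj), ENNReal.top_rpow_of_pos hr0]
  choose φ ψ hle hψφ hspec using fun j =>
    ModulationSpace.exists_rank_one (p := p) (q := q) hg hw (hu j) (hX1 j)
  have hr : ∑' j, (‖ψ j‖ₑ * ‖φ j‖ₑ) ^ r ≠ ∞ := by
    refine ne_top_of_le_ne_top (ENNReal.mul_ne_top (ENNReal.rpow_ne_top_of_nonneg hr0.le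
      (ENNReal.ofReal_ne_top (r := (gaborConst g)⁻¹))) hsum') ?_
    rw [← ENNReal.tsum_mul_left]
    refine ENNReal.tsum_le_tsum fun j => ?_
    rw [← ENNReal.mul_rpow_of_nonneg _ _ hr0.le]
    exact ENNReal.rpow_le_rpow (hle j) hr0.le
  have hrs : Summable fun j => ‖ψ j‖ ^ r * ‖φ j‖ ^ r := by
    refine (ENNReal.summable_toReal hr).congr fun j => ?_
    rw [← ENNReal.toReal_rpow, ENNReal.toReal_mul, toReal_enorm, toReal_enorm,
      Real.mul_rpow (norm_nonneg _) (norm_nonneg _)]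
  have h1 : ∑' j, ‖ψ j‖ₑ * ‖φ j‖ₑ ≠ ∞ := fun h => by
    have := ENNReal.tsum_rpow_le_tsum_rpow (fun j => ‖ψ j‖ₑ * ‖φ j‖ₑ) hr0 hr1
    rw [h, ENNReal.top_rpow_of_pos hr0, top_le_iff] at this
    exact hr this
  have h1s : Summable fun j => ‖ψ j‖ * ‖φ j‖ := by
    refine (ENNReal.summable_toReal h1).congr fun j => ?_
    rw [ENNReal.toReal_mul, toReal_enorm, toReal_enorm]
  -- $|m_j|=|\psi_j(\varphi_j)|\le\|\psi_j\|\|\varphi_j\|$.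
  have hms : Summable fun j => ‖m j‖ :=
    Summable.of_nonneg_of_le (fun j => norm_nonneg _)
      (fun j => by rw [← hψφ j]; exact (ψ j).le_opNorm (φ j)) h1s
  let _ := ModulationSpace.normedAddCommGroup (p := p) (q := q) hg hw
  have := ModulationSpace.completeSpace (p := p) (q := q) hg hw
  obtain ⟨T, hT⟩ := exists_clm_hasSum_of_summable (B := ModulationSpace g w p q) h1s
  -- A summable multiplier is bounded, so the domain is all of $L^2$ and its density in the
  -- modulation space is that of the square integrable elements.
  have hdom : ∀ f, f ∈ (spectralMultiplier u m).domain :=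
    spectralDomain_eq_top_of_bounded u fun j => hms.le_tsum j fun _ _ => norm_nonneg _
  refine ⟨T, ⟨?_, fun a f haf => ?_⟩, ⟨φ, ψ, hrs, hT⟩, fun hr_one => ⟨hms, ?_⟩⟩
  · refine (ModulationSpace.dense_lp_two (p := p) (q := q) hg hw).mono ?_
    rintro a ⟨f, hf⟩
    exact ⟨⟨f, hdom f⟩, hf⟩
  -- Evaluation at a test function is continuous both on the modulation space and on $L^2$, so the
  -- two expansions can be compared term by term.
  · ext χ
    obtain ⟨e, he⟩ := ModulationSpace.exists_clm_eq_apply (p := p) (q := q) hg hw χ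
    obtain ⟨e', he'⟩ := exists_clm_eq_lp_apply χ
    have h2 := (hT a).mapL e
    have h3 := (u.hasSum_spectralMultiplier m f).mapL e'
    rw [← he, ← he']
    refine h2.unique (h3.congr_fun fun j => ?_)
    rw [he, he', hspec j a f haf]
  -- All nuclear representations give one value $t$, and the spectral one evaluates it as
  -- $\sum_jm_j$.
  · obtain ⟨t, ht⟩ := ModulationSpace.exists_forall_hasSum_trace hg hw T
    have hrep : IsNuclearRepresentation 1 T φ ψ := ⟨hr_one ▸ hrs, hT⟩
    have h2 := ht φ ψ hrep
    simp_rw [hψφ] at h2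
    rw [h2.tsum_eq]
    exact ⟨⟨φ, ψ, hrep⟩, ht⟩

/-- The sum is taken in $[0,\infty]$ with $0\cdot\infty=0$: an index with $F(\lambda_j)=0$ imposes
nothing on the norms of $u_j$. -/
theorem theorem5p4 {n k l : ℕ} (hk : 1 ≤ k) (hl : 1 ≤ l)
    (u : HilbertBasis ℕ ℂ (Lp ℂ 2 (volume : Measure (EuclideanSpace ℝ (Fin n)))))
    (lam : ℕ → ℝ) (hu : IsAnharmonicEigenbasis k l u lam)
    (F : ℝ → ℂ)
    (g : 𝓢(EuclideanSpace ℝ (Fin n), ℂ)) (hg : g ≠ 0)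
    (w : EuclideanSpace ℝ (Fin n) × EuclideanSpace ℝ (Fin n) → ℝ) (hw : IsWeight w)
    (hw_sub : IsSubmultiplicativeWeight w) (hw_mod : IsPolynomiallyModerate w)
    (p q : ℝ≥0∞) [Fact (1 ≤ p)] [Fact (p ≠ ∞)] [Fact (1 ≤ q)] [Fact (q ≠ ∞)]
    (r : ℝ) (hr0 : 0 < r) (hr1 : r ≤ 1)
    (hsum : ∑' j, ‖F (lam j)‖ₑ ^ r
        * modulationENorm g w p q (Lp.toTemperedDistribution (u j)) ^ r
        * modulationENorm g (fun z => (w z)⁻¹) p.conjExponent q.conjExponent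
            (Lp.toTemperedDistribution (u j)) ^ r < ∞) :
    ∃ T : ModulationSpace g w p q →L[ℂ] ModulationSpace g w p q,
      IsRealization (spectralMultiplier u (fun j => F (lam j))) T ∧
      IsRNuclear r T ∧
      (r = 1 →
        Summable (fun j => ‖F (lam j)‖) ∧ HasNuclearTrace T (∑' j, F (lam j))) := by
  obtain ⟨C, N, hwC⟩ := hw.exists_isModerateWeight hw_mod
  exact exists_isRealization_of_tsum_lt_top u (fun j => F (lam j)) hg hwC hr0 hr1 hsum
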